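/- For a finite set $P$ of points in the plane, its skyline is $\mathrm{sky}(P)=\{p\in P \mid \forall q\in P\setminus\{p\}:\ x(q)<x(p)\text{ or }y(q)<y(p)\}$. For nonempty $P$ and nonempty $Q\subseteq \mathrm{sky}(P)$ let $\psi(Q,P)=\max_{p\in \mathrm{sky}(P)}\min_{q\in Q} d(p,q)$, where $d$ is the Euclidean distance, and for a positive integer $k$ let $\mathrm{opt}(P,k)=\min\{\psi(Q,P)\mid \emptyset\ne Q\subseteq \mathrm{sky}(P),\ |Q|\le k\}$. Theorem. There is an algorithm on the real RAM (exact real arithmetic $+,-,\cdot,/$ and comparisons of reals, integer variables and indexed arrays, unit cost per operation) and an absolute constant $C$ such that the following holds. Given a set $P$ of $n\ge 1$ points in the plane (as a list of the coordinates of its points), a positive integer $k$ and a real number $\varepsilon$ with $0<\varepsilon<1$, the algorithm computes, in at most $C\,\bigl(kn+n\max\{0,\log\log(1/\varepsilon)\}\bigr)$ steps, a set $Q\subseteq \mathrm{sky}(P)$ with $|Q|\le k$ and $\psi(Q,P)\le(1+\varepsilon)\,\mathrm{opt}(P,k)$. -/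

import Mathlib

open scoped ENNReal

/-- The Euclidean plane; `p 0` is the `x`-coordinate of `p`, and `p 1` its `y`-coordinate. -/
abbrev Point : Type := EuclideanSpace ℝ (Fin 2)

namespace RepSkyline

/-- The skyline (Pareto front) of `P`: the points of `P` not dominated by another point of `P`. -/
def skyline (P : Set Point) : Set Point :=
  {p | p ∈ P ∧ ∀ q ∈ P, q ≠ p → q 0 < p 0 ∨ q 1 < p 1}

/-- `ψ(Q, P)`, the largest distance from a point of the skyline of `P` to its closest point of `Q`.
Values are in `[0, ∞]`, so that the empty `Q` has cost `∞` when the skyline is nonempty. -/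
noncomputable def psi (Q P : Set Point) : ℝ≥0∞ :=
  ⨆ p ∈ skyline P, ⨅ q ∈ Q, ENNReal.ofReal (dist p q)

/-- The feasible solutions: the sets of at most `k` skyline points of `P`. -/
def Feasible (P : Set Point) (k : ℕ) (Q : Set Point) : Prop :=
  Q ⊆ skyline P ∧ Q.encard ≤ k

/-- `opt(P, k)`, the smallest cost of a feasible solution. -/
noncomputable def opt (P : Set Point) (k : ℕ) : ℝ≥0∞ :=
  ⨅ Q ∈ {Q : Set Point | Feasible P k Q}, psi Q P

end RepSkyline

/-! A real RAM. It has natural-number and real-number variables and arrays, each named by a number.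
A program is a fixed finite term, so it mentions finitely many names; arrays are unbounded and are
indexed by computed natural numbers. The operations on natural numbers are addition, truncated
subtraction, halving rounded down, and comparison; the operations on reals are the four arithmetic
operations and comparison. There is no rounding of reals, no root and no conversion between the two
kinds of numbers. Constants are natural, respectively rational. Each operation costs one step. -/

namespace RealRAM

/-- The memory of the machine. -/
structure State where
  /-- natural-number variables -/
  nvar : ℕ → ℕ
  /-- real variables -/
  rvar : ℕ → ℝ
  /-- natural-number arrays: `narr a i` is entry `i` of array `a` -/
  narr : ℕ → ℕ → ℕ
  /-- real arrays -/
  rarr : ℕ → ℕ → ℝ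

/-- Expressions with a natural number as their value. -/
inductive NatExpr : Type
  | const (c : ℕ)
  | var (x : ℕ)
  | get (a : ℕ) (i : NatExpr)
  | add (e f : NatExpr)
  | sub (e f : NatExpr)
  | half (e : NatExpr)

/-- The value of an expression. -/
def NatExpr.eval (s : State) : NatExpr → ℕ
  | .const c => c
  | .var x => s.nvar x
  | .get a i => s.narr a (i.eval s)
  | .add e f => e.eval s + f.eval s
  | .sub e f => e.eval s - f.eval s
  | .half e => e.eval s / 2

/-- The number of steps for evaluating an expression. -/
def NatExpr.cost : NatExpr → ℕ
  | .const _ => 1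
  | .var _ => 1
  | .get _ i => i.cost + 1
  | .add e f => e.cost + f.cost + 1
  | .sub e f => e.cost + f.cost + 1
  | .half e => e.cost + 1

/-- Expressions with a real number as their value. -/
inductive RealExpr : Type
  | const (c : ℚ)
  | var (x : ℕ)
  | get (a : ℕ) (i : NatExpr)
  | add (e f : RealExpr)
  | sub (e f : RealExpr)
  | mul (e f : RealExpr)
  | div (e f : RealExpr)

/-- The value of an expression; a division by zero returns zero. -/
noncomputable def RealExpr.eval (s : State) : RealExpr → ℝ
  | .const c => (c : ℝ)
  | .var x => s.rvar x
  | .get a i => s.rarr a (i.eval s)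
  | .add e f => e.eval s + f.eval s
  | .sub e f => e.eval s - f.eval s
  | .mul e f => e.eval s * f.eval s
  | .div e f => e.eval s / f.eval s

/-- The number of steps for evaluating an expression. -/
def RealExpr.cost : RealExpr → ℕ
  | .const _ => 1
  | .var _ => 1
  | .get _ i => i.cost + 1
  | .add e f => e.cost + f.cost + 1
  | .sub e f => e.cost + f.cost + 1
  | .mul e f => e.cost + f.cost + 1
  | .div e f => e.cost + f.cost + 1

/-- Tests. -/
inductive Test : Type
  | natLe (e f : NatExpr)
  | realLe (e f : RealExpr)
  | not (b : Test)
  | and (b c : Test)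
  | or (b c : Test)

/-- The truth of a test. -/
def Test.Holds (s : State) : Test → Prop
  | .natLe e f => e.eval s ≤ f.eval s
  | .realLe e f => e.eval s ≤ f.eval s
  | .not b => ¬ b.Holds s
  | .and b c => b.Holds s ∧ c.Holds s
  | .or b c => b.Holds s ∨ c.Holds s

/-- The number of steps for evaluating a test. -/
def Test.cost : Test → ℕ
  | .natLe e f => e.cost + f.cost + 1
  | .realLe e f => e.cost + f.cost + 1
  | .not b => b.cost + 1
  | .and b c => b.cost + c.cost + 1
  | .or b c => b.cost + c.cost + 1

/-- Programs. -/
inductive Program : Type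
  | skip
  | setNat (x : ℕ) (e : NatExpr)
  | setReal (x : ℕ) (e : RealExpr)
  | storeNat (a : ℕ) (i : NatExpr) (e : NatExpr)
  | storeReal (a : ℕ) (i : NatExpr) (e : RealExpr)
  | seq (c d : Program)
  | ite (b : Test) (c d : Program)
  | while (b : Test) (c : Program)

/-- `Run c s s' t`: the program `c`, started in the state `s`, halts in the state `s'` after exactly
`t` steps. -/
inductive Run : Program → State → State → ℕ → Prop
  | skip (s : State) : Run .skip s s 1
  | setNat (x : ℕ) (e : NatExpr) (s : State) :
      Run (.setNat x e) s { s with nvar := Function.update s.nvar x (e.eval s) } (e.cost + 1)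
  | setReal (x : ℕ) (e : RealExpr) (s : State) :
      Run (.setReal x e) s { s with rvar := Function.update s.rvar x (e.eval s) } (e.cost + 1)
  | storeNat (a : ℕ) (i e : NatExpr) (s : State) :
      Run (.storeNat a i e) s
        { s with narr :=
            Function.update s.narr a (Function.update (s.narr a) (i.eval s) (e.eval s)) }
        (i.cost + e.cost + 1)
  | storeReal (a : ℕ) (i : NatExpr) (e : RealExpr) (s : State) :
      Run (.storeReal a i e) s
        { s with rarr :=
            Function.update s.rarr a (Function.update (s.rarr a) (i.eval s) (e.eval s)) }
        (i.cost + e.cost + 1)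
  | seq {c d : Program} {s s₁ s₂ : State} {t₁ t₂ : ℕ} :
      Run c s s₁ t₁ → Run d s₁ s₂ t₂ → Run (.seq c d) s s₂ (t₁ + t₂)
  | iteTrue {b : Test} {c d : Program} {s s₁ : State} {t : ℕ} :
      b.Holds s → Run c s s₁ t → Run (.ite b c d) s s₁ (b.cost + t + 1)
  | iteFalse {b : Test} {c d : Program} {s s₁ : State} {t : ℕ} :
      ¬ b.Holds s → Run d s s₁ t → Run (.ite b c d) s s₁ (b.cost + t + 1)
  | whileFalse {b : Test} {c : Program} {s : State} :
      ¬ b.Holds s → Run (.while b c) s s (b.cost + 1)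
  | whileTrue {b : Test} {c : Program} {s s₁ s₂ : State} {t₁ t₂ : ℕ} :
      b.Holds s → Run c s s₁ t₁ → Run (.while b c) s₁ s₂ t₂ →
      Run (.while b c) s s₂ (b.cost + t₁ + t₂ + 1)

/-- A sequence of `m` points is stored with `m` in the natural-number variable `0`, the
`x`-coordinates in the real array `0` and the `y`-coordinates in the real array `1`. -/
def State.Stores (s : State) {m : ℕ} (q : Fin m → Point) : Prop :=
  s.nvar 0 = m ∧ ∀ i : Fin m, s.rarr 0 i = q i 0 ∧ s.rarr 1 i = q i 1

/-- The initial state for the points `p`, the natural number `k` in the natural-number variable `1`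
and the real number `ε` in the real variable `0`. All other memory is zero. -/
noncomputable def input {n : ℕ} (p : Fin n → Point) (k : ℕ) (ε : ℝ) : State where
  nvar x := if x = 0 then n else if x = 1 then k else 0
  rvar x := if x = 0 then ε else 0
  narr _ _ := 0
  rarr a j :=
    if h : j < n then
      if a = 0 then p ⟨j, h⟩ 0 else if a = 1 then p ⟨j, h⟩ 1 else 0
    else 0

end RealRAM

/-! The machine has no roots, so everything is phrased with squared distances: `Cov P k μ` says that
`k` skyline points cover the skyline within squared distance `μ`. A factor `1 + ε` for the squared
radius is more than enough, since `√(1 + ε) ≤ 1 + ε`.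

From left to right the skyline descends, so the distance between two of its points grows when they
move apart along it (`sqDist_le_left`, `sqDist_le_right`). Hence `Cov P k μ` is decided greedily:
from the first uncovered point `l` go to the last skyline point `c` within reach of `l`, make `c` a
center, and continue with the first point out of reach of `c`. If something is uncovered after `k`
centers, no `k` points suffice (`NeedsBefore.succ`, `NeedsBefore.not_cov`).

Sorting all points would cost `n log n`. Instead the points are merged into staircases in blocks of
length `b = 2 ^ w` only, in `O(n w)` steps. A predicate closed under moving left and up holds on an
initial segment of each block, so binary search in every block finds the last skyline point with the
predicate and the first one without it, in `O((n / b + 1) (w + 1))` steps (`search_spec`,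
`cut_spec`). A merge does not delete dominated points. It outputs the points (smaller `x`, larger
`y`) of the two heads, so the arrays may hold fictitious points. These stay dominated by the skyline
and all true skyline points stay present (`Carries`), which is all that the searches rely on.

Let `l` be least with `(1 / 2) ^ 2 ^ l ≤ ε`, put `K = 2 ^ l`, and let `w = 2 l + 2 m` with `k ≤ 2 ^
m` and `m ≤ k`, where `k` has been capped at `n`. Then `(K + 2) (w + 1) ≤ 6 b`. If `b < n`, so that
there are many blocks, farthest-point insertion with `k + 1` points yields `δ` such that the optimal
squared radius lies between `δ / 4` and `δ` (`Inserted.le_four_mul`), and `K + 2` greedy decisions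
bisect this interval to relative precision `ε`. Each decision costs `O(k)` cuts, and `(K + 2) (n / b
+ 1) (w + 1) = O(n)`, so the bisection takes `O(k n)` steps. If `n ≤ b`, there are at most two block
searches per scan and a cut costs only `O(w + 1)`; the whole skyline is extracted by at most `n`
cuts, and a dynamic program finds the exact optimum in `O(k n)` steps. A last greedy run outputs the
centers.

The total is `O(n (l + k))`, and `l ≤ 2 + 2 max 0 (log (log (1 / ε)))` by `squarings_bound`. -/

namespace RealRAM

/-! ### Weakest preconditions, frames and loops -/

/-- Assign the value `v` to the natural-number variable `x`. -/
def State.setN (s : State) (x v : ℕ) : State := { s with nvar := Function.update s.nvar x v }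

/-- Assign the value `v` to the real variable `x`. -/
noncomputable def State.setR (s : State) (x : ℕ) (v : ℝ) : State :=
  { s with rvar := Function.update s.rvar x v }

/-- Assign the value `v` to the entry `i` of the real array `a`. -/
noncomputable def State.setA (s : State) (a i : ℕ) (v : ℝ) : State :=
  { s with rarr := Function.update s.rarr a (Function.update (s.rarr a) i v) }

section

variable (s : State) (x y a b i j m : ℕ) (v : ℝ)

@[simp] theorem State.setN_nvar : (s.setN x m).nvar y = if y = x then m else s.nvar y := by
  simp [State.setN, Function.update_apply]

@[simp] theorem State.setN_rvar : (s.setN x m).rvar = s.rvar := rfl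

@[simp] theorem State.setN_rarr : (s.setN x m).rarr = s.rarr := rfl

@[simp] theorem State.setR_rvar : (s.setR x v).rvar y = if y = x then v else s.rvar y := by
  simp [State.setR, Function.update_apply]

@[simp] theorem State.setR_nvar : (s.setR x v).nvar = s.nvar := rfl

@[simp] theorem State.setR_rarr : (s.setR x v).rarr = s.rarr := rfl

@[simp] theorem State.setA_rarr :
    (s.setA a i v).rarr b j = if b = a ∧ j = i then v else s.rarr b j := by
  by_cases hb : b = a
  · subst hb; simp [State.setA, Function.update_apply]
  · simp [State.setA, hb]

@[simp] theorem State.setA_nvar : (s.setA a i v).nvar = s.nvar := rfl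

@[simp] theorem State.setA_rvar : (s.setA a i v).rvar = s.rvar := rfl

end

attribute [simp] NatExpr.eval NatExpr.cost RealExpr.eval RealExpr.cost Test.Holds Test.cost

/-- The program `c`, started in `s`, halts in a state and after a number of steps that satisfy
`Q`. -/
def Program.wp (c : Program) (s : State) (Q : State → ℕ → Prop) : Prop :=
  ∃ s' t, Run c s s' t ∧ Q s' t

/-- The natural-number variables that a program may write. -/
def Program.natVars : Program → List ℕ
  | .setNat x _ => [x]
  | .seq c d => c.natVars ++ d.natVars
  | .ite _ c d => c.natVars ++ d.natVars
  | .while _ c => c.natVars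
  | _ => []

/-- The real variables that a program may write. -/
def Program.realVars : Program → List ℕ
  | .setReal x _ => [x]
  | .seq c d => c.realVars ++ d.realVars
  | .ite _ c d => c.realVars ++ d.realVars
  | .while _ c => c.realVars
  | _ => []

/-- The real arrays that a program may write. -/
def Program.realArrs : Program → List ℕ
  | .storeReal a _ _ => [a]
  | .seq c d => c.realArrs ++ d.realArrs
  | .ite _ c d => c.realArrs ++ d.realArrs
  | .while _ c => c.realArrs
  | _ => []

/-- `s'` agrees with `s` on all the memory that `c` cannot write. -/
structure Frame (c : Program) (s s' : State) : Prop where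
  nvar : ∀ x, x ∉ c.natVars → s'.nvar x = s.nvar x
  rvar : ∀ x, x ∉ c.realVars → s'.rvar x = s.rvar x
  rarr : ∀ a, a ∉ c.realArrs → s'.rarr a = s.rarr a

theorem Frame.refl (c : Program) (s : State) : Frame c s s :=
  ⟨fun _ _ => rfl, fun _ _ => rfl, fun _ _ => rfl⟩

theorem Frame.trans {c : Program} {s s₁ s₂ : State} (h : Frame c s s₁) (h' : Frame c s₁ s₂) :
    Frame c s s₂ :=
  ⟨fun x hx => (h'.nvar x hx).trans (h.nvar x hx), fun x hx => (h'.rvar x hx).trans (h.rvar x hx),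
    fun x hx => (h'.rarr x hx).trans (h.rarr x hx)⟩

/-- The written names are read off the syntax, so facts about other registers and arrays survive a
whole subprogram without entering its loop invariants. -/
theorem Run.frame {c : Program} {s s' : State} {t : ℕ} (h : Run c s s' t) : Frame c s s' := by
  induction h with
  | skip s => exact Frame.refl _ _
  | setNat x e s =>
    refine ⟨fun y hy => ?_, fun _ _ => rfl, fun _ _ => rfl⟩
    simp only [Program.natVars, List.mem_singleton] at hy
    simp [hy]
  | setReal x e s =>
    refine ⟨fun _ _ => rfl, fun y hy => ?_, fun _ _ => rfl⟩
    simp only [Program.realVars, List.mem_singleton] at hy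
    simp [hy]
  | storeNat a i e s => exact ⟨fun _ _ => rfl, fun _ _ => rfl, fun _ _ => rfl⟩
  | storeReal a i e s =>
    refine ⟨fun _ _ => rfl, fun _ _ => rfl, fun y hy => ?_⟩
    simp only [Program.realArrs, List.mem_singleton] at hy
    simp [hy]
  | seq _ _ h₁ h₂ =>
    refine ⟨fun x hx => ?_, fun x hx => ?_, fun x hx => ?_⟩
    · simp only [Program.natVars, List.mem_append, not_or] at hx
      exact (h₂.nvar x hx.2).trans (h₁.nvar x hx.1)
    · simp only [Program.realVars, List.mem_append, not_or] at hx
      exact (h₂.rvar x hx.2).trans (h₁.rvar x hx.1)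
    · simp only [Program.realArrs, List.mem_append, not_or] at hx
      exact (h₂.rarr x hx.2).trans (h₁.rarr x hx.1)
  | iteTrue _ _ h =>
    refine ⟨fun x hx => ?_, fun x hx => ?_, fun x hx => ?_⟩
    · simp only [Program.natVars, List.mem_append, not_or] at hx
      exact h.nvar x hx.1
    · simp only [Program.realVars, List.mem_append, not_or] at hx
      exact h.rvar x hx.1
    · simp only [Program.realArrs, List.mem_append, not_or] at hx
      exact h.rarr x hx.1
  | iteFalse _ _ h =>
    refine ⟨fun x hx => ?_, fun x hx => ?_, fun x hx => ?_⟩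
    · simp only [Program.natVars, List.mem_append, not_or] at hx
      exact h.nvar x hx.2
    · simp only [Program.realVars, List.mem_append, not_or] at hx
      exact h.rvar x hx.2
    · simp only [Program.realArrs, List.mem_append, not_or] at hx
      exact h.rarr x hx.2
  | whileFalse _ => exact Frame.refl _ _
  | whileTrue _ _ _ h₁ h₂ =>
    exact ⟨fun x hx => (h₂.nvar x hx).trans (h₁.nvar x hx),
      fun x hx => (h₂.rvar x hx).trans (h₁.rvar x hx),
      fun x hx => (h₂.rarr x hx).trans (h₁.rarr x hx)⟩

theorem Frame.mono {c d : Program} {s s' : State} (h : Frame c s s')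
    (hN : c.natVars ⊆ d.natVars) (hR : c.realVars ⊆ d.realVars) (hA : c.realArrs ⊆ d.realArrs) :
    Frame d s s' :=
  ⟨fun x hx => h.nvar x fun hx' => hx (hN hx'), fun x hx => h.rvar x fun hx' => hx (hR hx'),
    fun x hx => h.rarr x fun hx' => hx (hA hx')⟩

theorem Frame.setN {c : Program} {s s' : State} (h : Frame c s s') {x : ℕ}
    (hx : x ∈ c.natVars) (v : ℕ) : Frame c s (s'.setN x v) :=
  ⟨fun y hy => by
    have : y ≠ x := fun h => hy (h ▸ hx)
    simp [this, h.nvar y hy], h.rvar, h.rarr⟩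

theorem Program.wp.imp {c : Program} {s : State} {Q Q' : State → ℕ → Prop} (h : c.wp s Q)
    (hQ : ∀ s' t, Frame c s s' → Q s' t → Q' s' t) : c.wp s Q' := by
  obtain ⟨s', t, hr, h⟩ := h
  exact ⟨s', t, hr, hQ s' t hr.frame h⟩

@[simp] theorem wp_skip {s : State} {Q : State → ℕ → Prop} : Program.skip.wp s Q ↔ Q s 1 :=
  ⟨fun ⟨_, _, hr, h⟩ => by cases hr; exact h, fun h => ⟨_, _, .skip s, h⟩⟩

@[simp] theorem wp_setNat {x : ℕ} {e : NatExpr} {s : State} {Q : State → ℕ → Prop} :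
    (Program.setNat x e).wp s Q ↔ Q (s.setN x (e.eval s)) (e.cost + 1) :=
  ⟨fun ⟨_, _, hr, h⟩ => by cases hr; exact h, fun h => ⟨_, _, .setNat x e s, h⟩⟩

@[simp] theorem wp_setReal {x : ℕ} {e : RealExpr} {s : State} {Q : State → ℕ → Prop} :
    (Program.setReal x e).wp s Q ↔ Q (s.setR x (e.eval s)) (e.cost + 1) :=
  ⟨fun ⟨_, _, hr, h⟩ => by cases hr; exact h, fun h => ⟨_, _, .setReal x e s, h⟩⟩

@[simp] theorem wp_storeReal {a : ℕ} {i : NatExpr} {e : RealExpr} {s : State}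
    {Q : State → ℕ → Prop} : (Program.storeReal a i e).wp s Q ↔
      Q (s.setA a (i.eval s) (e.eval s)) (i.cost + e.cost + 1) :=
  ⟨fun ⟨_, _, hr, h⟩ => by cases hr; exact h, fun h => ⟨_, _, .storeReal a i e s, h⟩⟩

theorem wp_seq {c d : Program} {s : State} {Q : State → ℕ → Prop} :
    (Program.seq c d).wp s Q ↔ c.wp s fun s₁ t₁ => d.wp s₁ fun s₂ t₂ => Q s₂ (t₁ + t₂) := by
  constructor
  · rintro ⟨s', t, hr, h⟩
    cases hr with
    | seq h₁ h₂ => exact ⟨_, _, h₁, _, _, h₂, h⟩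
  · rintro ⟨s₁, t₁, h₁, s₂, t₂, h₂, hQ⟩
    exact ⟨s₂, _, .seq h₁ h₂, hQ⟩

@[simp] theorem wp_ite {b : Test} {c d : Program} {s : State} {Q : State → ℕ → Prop} :
    (Program.ite b c d).wp s Q ↔ (b.Holds s → c.wp s fun s' t => Q s' (b.cost + t + 1)) ∧
      (¬ b.Holds s → d.wp s fun s' t => Q s' (b.cost + t + 1)) := by
  constructor
  · rintro ⟨s', t, hr, h⟩
    cases hr with
    | iteTrue hb hr => exact ⟨fun _ => ⟨_, _, hr, h⟩, fun hn => absurd hb hn⟩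
    | iteFalse hb hr => exact ⟨fun hn => absurd hn hb, fun _ => ⟨_, _, hr, h⟩⟩
  · rintro ⟨h₁, h₂⟩
    by_cases hb : b.Holds s
    · obtain ⟨s', t, hr, hQ⟩ := h₁ hb
      exact ⟨s', _, .iteTrue hb hr, hQ⟩
    · obtain ⟨s', t, hr, hQ⟩ := h₂ hb
      exact ⟨s', _, .iteFalse hb hr, hQ⟩

/-- A loop with the invariant `I`, whose steps are paid for by the potential `Φ`. -/
theorem wp_while {b : Test} {c : Program} {s : State} (I : State → Prop) (Φ : State → ℕ)
    (h₀ : I s)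
    (hstep : ∀ s₁, Frame c s s₁ → I s₁ → b.Holds s₁ →
      c.wp s₁ fun s₂ t => I s₂ ∧ b.cost + t + 1 + Φ s₂ ≤ Φ s₁) :
    (Program.while b c).wp s fun s' t =>
      I s' ∧ ¬ b.Holds s' ∧ t + Φ s' ≤ Φ s + b.cost + 1 := by
  -- Every round costs at least one step, so the potential drops strictly. Induction on a bound for
  -- it yields termination together with the time bound.
  suffices ∀ N s₁, Φ s₁ ≤ N → Frame c s s₁ → I s₁ → (Program.while b c).wp s₁ fun s' t =>
      I s' ∧ ¬ b.Holds s' ∧ t + Φ s' ≤ Φ s₁ + b.cost + 1 from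
    this _ s le_rfl (Frame.refl _ _) h₀
  intro N
  induction N with
  | zero =>
    intro s₁ hN hf hI
    by_cases hb : b.Holds s₁
    · obtain ⟨s₂, t, -, -, h⟩ := hstep s₁ hf hI hb
      omega
    · exact ⟨s₁, _, .whileFalse hb, hI, hb, by omega⟩
  | succ N ih =>
    intro s₁ hN hf hI
    by_cases hb : b.Holds s₁
    · obtain ⟨s₂, t, hr, hI₂, h⟩ := hstep s₁ hf hI hb
      obtain ⟨s₃, t', hr', hI₃, hb₃, h'⟩ := ih s₂ (by omega) (hf.trans hr.frame) hI₂
      exact ⟨s₃, _, .whileTrue hb hr hr', hI₃, hb₃, by omega⟩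
    · exact ⟨s₁, _, .whileFalse hb, hI, hb, by omega⟩

/-- The programs of a list, one after the other. -/
def block : List Program → Program
  | [] => .skip
  | c :: l => .seq c (block l)

@[simp] theorem wp_block_nil {s : State} {Q : State → ℕ → Prop} : (block []).wp s Q ↔ Q s 1 :=
  wp_skip

@[simp] theorem wp_block_cons {c : Program} {l : List Program} {s : State}
    {Q : State → ℕ → Prop} : (block (c :: l)).wp s Q ↔
      c.wp s fun s₁ t₁ => (block l).wp s₁ fun s₂ t₂ => Q s₂ (t₁ + t₂) :=
  wp_seq

/-- Repeat the program `c` while the natural-number variable `i` runs from `0` up to the value of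
the variable `y`, exclusively. -/
def forLoop (i y : ℕ) (c : Program) : Program :=
  block [.setNat i (.const 0),
    .while (.natLe (.add (.var i) (.const 1)) (.var y))
      (block [c, .setNat i (.add (.var i) (.const 1))])]

theorem wp_forLoop {i y : ℕ} {c : Program} {s : State} (I : ℕ → State → Prop) (B : ℕ)
    (hiy : i ≠ y) (hi : i ∉ c.natVars) (hy : y ∉ c.natVars)
    (h₀ : I 0 (s.setN i 0))
    (hstep : ∀ j s₁, Frame (forLoop i y c) s s₁ → s₁.nvar i = j → s₁.nvar y = s.nvar y →
      j < s.nvar y → I j s₁ →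
      c.wp s₁ fun s₂ t => I (j + 1) (s₂.setN i (j + 1)) ∧
        t ≤ B) :
    (forLoop i y c).wp s fun s' t => I (s.nvar y) s' ∧ t ≤ s.nvar y * (B + 20) + 20 := by
  refine wp_block_cons.2 (wp_setNat.2 (wp_block_cons.2 ?_))
  refine (wp_while (fun s₁ => s₁.nvar i ≤ s.nvar y ∧ I (s₁.nvar i) s₁)
    (fun s₁ => (s.nvar y - s₁.nvar i) * (B + 20)) ?_ ?_).imp ?_
  · simpa [NatExpr.eval] using h₀
  · rintro s₁ hf ⟨hle, hI⟩ hb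
    have hf' : Frame (forLoop i y c) s s₁ := by
      refine ⟨fun x hx => ?_, fun x hx => ?_, fun x hx => ?_⟩
      · simp only [forLoop, block, Program.natVars, List.mem_append, List.mem_singleton,
          List.append_nil, not_or] at hx
        rw [hf.nvar x (by simp [block, Program.natVars, hx])]
        simp [hx]
      · simp only [forLoop, block, Program.realVars, List.append_nil, List.nil_append] at hx
        exact hf.rvar x (by simpa [block, Program.realVars] using hx)
      · simp only [forLoop, block, Program.realArrs, List.append_nil, List.nil_append] at hx
        exact hf.rarr x (by simpa [block, Program.realArrs] using hx)
    have hyy : s₁.nvar y = s.nvar y := by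
      apply hf'.nvar
      simp [forLoop, block, Program.natVars, hy, hiy.symm]
    simp only [Test.Holds, NatExpr.eval, hyy] at hb
    refine wp_block_cons.2 ((hstep _ s₁ hf' rfl hyy (by omega) hI).imp ?_)
    rintro s₂ t hf₂ ⟨hI₂, ht⟩
    have hi₂ := hf₂.nvar i hi
    refine wp_block_cons.2 (wp_setNat.2 (wp_block_nil.2 ⟨⟨?_, ?_⟩, ?_⟩))
    · simp [NatExpr.eval, hi₂]; omega
    · simpa [NatExpr.eval, hi₂] using hI₂
    · have : s.nvar y - s₁.nvar i = (s.nvar y - (s₁.nvar i + 1)) + 1 := by omega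
      simp [hi₂, this, add_mul]
      omega
  · rintro s' t hf ⟨⟨hle, hI⟩, hb, ht⟩
    have hyy : s'.nvar y = s.nvar y := by
      rw [hf.nvar y (by simp [block, Program.natVars, hy, hiy.symm])]
      simp [hiy.symm]
    simp only [Test.Holds, NatExpr.eval, hyy] at hb
    have : s'.nvar i = s.nvar y := by omega
    refine wp_block_nil.2 ⟨this ▸ hI, ?_⟩
    simp only [NatExpr.eval, NatExpr.cost, Test.cost, State.setN_nvar, if_true, Nat.sub_zero] at ht ⊢
    omega

end RealRAM

namespace RepSkyline

/-! ### Skylines, staircases and covers in `ℝ × ℝ` -/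

/-- The squared Euclidean distance. -/
def sqDist (u v : ℝ × ℝ) : ℝ := (u.1 - v.1) ^ 2 + (u.2 - v.2) ^ 2

/-- `u` comes before `v` on a staircase that descends from the left to the right. -/
def Before (u v : ℝ × ℝ) : Prop := u.1 ≤ v.1 ∧ v.2 ≤ u.2

theorem Before.refl (u : ℝ × ℝ) : Before u u := ⟨le_rfl, le_rfl⟩

theorem sqDist_comm (u v : ℝ × ℝ) : sqDist u v = sqDist v u := by
  unfold sqDist; ring

theorem sqDist_nonneg (u v : ℝ × ℝ) : 0 ≤ sqDist u v := by
  unfold sqDist; positivity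

@[simp] theorem sqDist_self (u : ℝ × ℝ) : sqDist u u = 0 := by
  simp [sqDist]

theorem sqDist_eq_zero {u v : ℝ × ℝ} (h : sqDist u v ≤ 0) : u = v := by
  unfold sqDist at h
  have h1 : (u.1 - v.1) ^ 2 = 0 := by nlinarith [sq_nonneg (u.1 - v.1), sq_nonneg (u.2 - v.2)]
  have h2 : (u.2 - v.2) ^ 2 = 0 := by nlinarith [sq_nonneg (u.1 - v.1), sq_nonneg (u.2 - v.2)]
  rw [sq_eq_zero_iff, sub_eq_zero] at h1 h2
  exact Prod.ext h1 h2

/-- Along a staircase both coordinate differences grow in absolute value. This monotonicity drives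
the greedy cover, the gaps and the dynamic program alike. -/
theorem sqDist_le_left {u v w : ℝ × ℝ} (h : Before u v) (h' : Before v w) :
    sqDist u v ≤ sqDist u w := by
  obtain ⟨h1, h2⟩ := h
  obtain ⟨h3, h4⟩ := h'
  unfold sqDist
  nlinarith

theorem sqDist_le_right {u v w : ℝ × ℝ} (h : Before u v) (h' : Before v w) :
    sqDist v w ≤ sqDist u w := by
  obtain ⟨h1, h2⟩ := h
  obtain ⟨h3, h4⟩ := h'
  unfold sqDist
  nlinarith

/-- Two points that are close to a third are close to each other. -/
theorem sqDist_le_four_mul {u v w : ℝ × ℝ} {μ : ℝ} (h : sqDist w u ≤ μ) (h' : sqDist w v ≤ μ) :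
    sqDist u v ≤ 4 * μ := by
  unfold sqDist at *
  -- Parallelogram law: `2 |w - u|² + 2 |w - v|²` exceeds `|u - v|²` by `|2 w - u - v|²`.
  nlinarith [sq_nonneg (2 * w.1 - u.1 - v.1), sq_nonneg (2 * w.2 - u.2 - v.2)]

/-- The maximal elements of a set of points. -/
def Sky (P : Set (ℝ × ℝ)) : Set (ℝ × ℝ) := {p | Maximal (· ∈ P) p}

theorem Sky.subset (P : Set (ℝ × ℝ)) : Sky P ⊆ P := fun _ h => h.1

theorem Sky.eq_of_le {P : Set (ℝ × ℝ)} {s t : ℝ × ℝ} (hs : s ∈ Sky P) (ht : t ∈ Sky P)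
    (h : s ≤ t) : s = t :=
  Maximal.eq_of_le hs ht.1 h

theorem Sky.before {P : Set (ℝ × ℝ)} {s t : ℝ × ℝ} (hs : s ∈ Sky P) (ht : t ∈ Sky P)
    (h : s.1 ≤ t.1) : Before s t := by
  refine ⟨h, ?_⟩
  by_contra! h2
  have := Sky.eq_of_le hs ht ⟨h, h2.le⟩
  simp [this] at h2

theorem Sky.ext_fst {P : Set (ℝ × ℝ)} {s t : ℝ × ℝ} (hs : s ∈ Sky P) (ht : t ∈ Sky P)
    (h : s.1 = t.1) : s = t :=
  Prod.ext h (le_antisymm (Sky.before ht hs h.ge).2 (Sky.before hs ht h.le).2)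

theorem Sky.snd_lt {P : Set (ℝ × ℝ)} {s t : ℝ × ℝ} (hs : s ∈ Sky P) (ht : t ∈ Sky P)
    (h : s.1 < t.1) : t.2 < s.2 := by
  by_contra! h2
  have := Sky.eq_of_le hs ht ⟨h.le, h2⟩
  simp [this] at h

theorem Sky.fst_lt {P : Set (ℝ × ℝ)} {s t : ℝ × ℝ} (hs : s ∈ Sky P) (ht : t ∈ Sky P)
    (h : t.2 < s.2) : s.1 < t.1 := by
  by_contra! h2
  exact absurd (Sky.before ht hs h2).2 (not_le.2 h)

theorem Sky.exists_ge {P : Set (ℝ × ℝ)} (hP : P.Finite) {p : ℝ × ℝ} (hp : p ∈ P) :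
    ∃ s ∈ Sky P, p ≤ s := by
  obtain ⟨s, h, hs⟩ := hP.exists_le_maximal hp
  exact ⟨s, hs, h⟩

/-- The points `V i` with `i < n` include the skyline of `P`, and are dominated by it. -/
structure Carries (P : Set (ℝ × ℝ)) (n : ℕ) (V : ℕ → ℝ × ℝ) : Prop where
  le : ∀ i < n, ∃ s ∈ Sky P, V i ≤ s
  mem : ∀ s ∈ Sky P, ∃ i < n, V i = s

/-- Among the points that are dominated by the skyline of `P`, the set is closed under moving to the
left and upwards. -/
def LeftwardOn (P : Set (ℝ × ℝ)) (B : ℝ × ℝ → Prop) : Prop :=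
  ∀ u v, (∃ s ∈ Sky P, u ≤ s) → (∃ s ∈ Sky P, v ≤ s) → B u → Before v u → B v

/-- `X` may come from a fictitious point `V i`. A skyline point not to the right of `V i` is still
above it, because the skyline point dominating `V i` lies further right and hence lower; so it
inherits `B`. -/
theorem Carries.iff_fst_le {P : Set (ℝ × ℝ)} {n : ℕ} {V : ℕ → ℝ × ℝ} (h : Carries P n V)
    {B : ℝ × ℝ → Prop} (hB : LeftwardOn P B) {X : ℝ} (h₁ : ∃ i < n, B (V i) ∧ (V i).1 = X)
    (h₂ : ∀ i < n, B (V i) → (V i).1 ≤ X) {s : ℝ × ℝ} (hs : s ∈ Sky P) : B s ↔ s.1 ≤ X := by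
  constructor
  · intro hb
    obtain ⟨i, hi, rfl⟩ := h.mem s hs
    exact h₂ i hi hb
  · intro hX
    obtain ⟨i, hi, hb, rfl⟩ := h₁
    refine hB (V i) s (h.le i hi) ⟨s, hs, le_rfl⟩ hb ⟨hX, ?_⟩
    obtain ⟨t, ht, hle⟩ := h.le i hi
    exact hle.2.trans (Sky.before hs ht (hX.trans hle.1)).2

/-- Points not to the left of `s` are dominated by skyline points not to the right-hand side's left
of `s`, hence not above `s`. This recovers the ordinate of a skyline point from its abscissa, which
a maximum over fictitious points does not provide directly. -/
theorem Carries.snd_eq {P : Set (ℝ × ℝ)} {n : ℕ} {V : ℕ → ℝ × ℝ} (h : Carries P n V)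
    {s : ℝ × ℝ} (hs : s ∈ Sky P) {y : ℝ} (h₁ : ∃ i < n, s.1 ≤ (V i).1 ∧ (V i).2 = y)
    (h₂ : ∀ i < n, s.1 ≤ (V i).1 → (V i).2 ≤ y) : y = s.2 := by
  obtain ⟨i, hi, hx, rfl⟩ := h₁
  apply le_antisymm
  · obtain ⟨t, ht, hle⟩ := h.le i hi
    exact hle.2.trans (Sky.before hs ht (hx.trans hle.1)).2
  · obtain ⟨j, hj, rfl⟩ := h.mem s hs
    exact h₂ j hj le_rfl

theorem Carries.fst_eq {P : Set (ℝ × ℝ)} {n : ℕ} {V : ℕ → ℝ × ℝ} (h : Carries P n V)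
    {s : ℝ × ℝ} (hs : s ∈ Sky P) {x : ℝ} (h₁ : ∃ i < n, s.2 ≤ (V i).2 ∧ (V i).1 = x)
    (h₂ : ∀ i < n, s.2 ≤ (V i).2 → (V i).1 ≤ x) : x = s.1 := by
  obtain ⟨i, hi, hx, rfl⟩ := h₁
  apply le_antisymm
  · obtain ⟨t, ht, hle⟩ := h.le i hi
    by_contra! hlt
    exact absurd (Sky.snd_lt hs ht (hlt.trans_le hle.1)) (not_lt.2 (hx.trans hle.2))
  · obtain ⟨j, hj, rfl⟩ := h.mem s hs
    exact h₂ j hj le_rfl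

/-- The skyline descends, so the highest point beyond `X` is as high as the first skyline point
beyond `X`. Only the height can be trusted: a fictitious point may share it. -/
theorem Carries.exists_next {P : Set (ℝ × ℝ)} {n : ℕ} {V : ℕ → ℝ × ℝ} (h : Carries P n V)
    {X y : ℝ} (h₁ : ∃ i < n, X < (V i).1 ∧ (V i).2 = y)
    (h₂ : ∀ i < n, X < (V i).1 → (V i).2 ≤ y) :
    ∃ r ∈ Sky P, r.2 = y ∧ X < r.1 ∧ ∀ s ∈ Sky P, X < s.1 → r.1 ≤ s.1 := by
  obtain ⟨i, hi, hx, rfl⟩ := h₁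
  obtain ⟨r, hr, hle⟩ := h.le i hi
  obtain ⟨j, hj, rfl⟩ := h.mem r hr
  have hX := hx.trans_le hle.1
  refine ⟨V j, hr, le_antisymm (h₂ j hj hX) hle.2, hX, fun s hs hXs => ?_⟩
  obtain ⟨l, hl, rfl⟩ := h.mem s hs
  by_contra! hlt
  exact absurd (Sky.snd_lt hs hr hlt) (not_lt.2 ((h₂ l hl hXs).trans hle.2))

theorem Carries.exists_prev {P : Set (ℝ × ℝ)} {n : ℕ} {V : ℕ → ℝ × ℝ} (h : Carries P n V)
    {x y : ℝ} (h₁ : ∃ i < n, y < (V i).2 ∧ (V i).1 = x)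
    (h₂ : ∀ i < n, y < (V i).2 → (V i).1 ≤ x) :
    ∃ c ∈ Sky P, c.1 = x ∧ y < c.2 ∧ ∀ s ∈ Sky P, y < s.2 → s.1 ≤ c.1 := by
  obtain ⟨i, hi, hx, rfl⟩ := h₁
  obtain ⟨r, hr, hle⟩ := h.le i hi
  obtain ⟨j, hj, rfl⟩ := h.mem r hr
  have hX := hx.trans_le hle.2
  refine ⟨V j, hr, le_antisymm (h₂ j hj hX) hle.1, hX, fun s hs hXs => ?_⟩
  obtain ⟨l, hl, rfl⟩ := h.mem s hs
  exact (h₂ l hl hXs).trans hle.1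

/-- `c` is the last skyline point with `B`, and, if `found`, then `r` is the first skyline point
without `B`. -/
structure IsCut (P : Set (ℝ × ℝ)) (B : ℝ × ℝ → Prop) (c r : ℝ × ℝ) (found : Prop) : Prop where
  c_mem : c ∈ Sky P
  c_iff : ∀ s ∈ Sky P, B s ↔ s.1 ≤ c.1
  r_mem : found → r ∈ Sky P
  r_iff : found → ∀ s ∈ Sky P, ¬ B s ↔ r.1 ≤ s.1
  all : ¬ found → ∀ s ∈ Sky P, B s

theorem IsCut.c_holds {P : Set (ℝ × ℝ)} {B : ℝ × ℝ → Prop} {c r : ℝ × ℝ} {f : Prop}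
    (h : IsCut P B c r f) : B c :=
  (h.c_iff c h.c_mem).2 le_rfl

theorem IsCut.r_not {P : Set (ℝ × ℝ)} {B : ℝ × ℝ → Prop} {c r : ℝ × ℝ} {f : Prop}
    (h : IsCut P B c r f) (hf : f) : ¬ B r :=
  (h.r_iff hf r (h.r_mem hf)).2 le_rfl

theorem IsCut.lt {P : Set (ℝ × ℝ)} {B : ℝ × ℝ → Prop} {c r : ℝ × ℝ} {f : Prop}
    (h : IsCut P B c r f) (hf : f) : c.1 < r.1 :=
  lt_of_not_ge fun hle => h.r_not hf ((h.c_iff r (h.r_mem hf)).2 hle)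

/-- The points whose squared distance from `l` is at most `μ`, together with those to the left. -/
def Near (l : ℝ × ℝ) (μ : ℝ) (v : ℝ × ℝ) : Prop := v.1 ≤ l.1 ∨ sqDist l v ≤ μ

/-- A dominated point `v` to the right of `l` is also not above `l`, so moving from `u` back to `v`
along the staircase only approaches `l`. -/
theorem Near.leftwardOn {P : Set (ℝ × ℝ)} {l : ℝ × ℝ} (hl : l ∈ Sky P) (μ : ℝ) :
    LeftwardOn P (Near l μ) := by
  rintro u v - ⟨s, hs, hvs⟩ hu hvu
  by_cases hv : v.1 ≤ l.1
  · exact .inl hv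
  push Not at hv
  obtain hu | hu := hu
  · exact .inl (hvu.1.trans hu)
  · exact .inr ((sqDist_le_left ⟨hv.le, hvs.2.trans
      (Sky.before hl hs (hv.le.trans hvs.1)).2⟩ hvu).trans hu)

theorem leftwardOn_fst_le (P : Set (ℝ × ℝ)) (X : ℝ) : LeftwardOn P fun v => v.1 ≤ X :=
  fun _ _ _ _ hu h => h.1.trans hu

/-- The points that are at least as close to `L` as to `R`. -/
def Closer (L R : ℝ × ℝ) (v : ℝ × ℝ) : Prop := sqDist L v ≤ sqDist R v

/-- The difference of the two squared distances is affine in `v` with gradient `2 (R - L)`, which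
points right and down; moving left and up decreases it. -/
theorem Closer.leftwardOn (P : Set (ℝ × ℝ)) {L R : ℝ × ℝ} (h : Before L R) :
    LeftwardOn P (Closer L R) := by
  rintro u v - - hu ⟨h1, h2⟩
  obtain ⟨h3, h4⟩ := h
  unfold Closer sqDist at *
  nlinarith

/-- The skyline of `P` is covered by `k` of its points within the squared distance `μ`. -/
def Cov (P : Set (ℝ × ℝ)) (k : ℕ) (μ : ℝ) : Prop :=
  ∃ Q : Finset (ℝ × ℝ), ↑Q ⊆ Sky P ∧ Q.card ≤ k ∧ ∀ s ∈ Sky P, ∃ q ∈ Q, sqDist q s ≤ μ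

theorem Cov.nonneg {P : Set (ℝ × ℝ)} {k : ℕ} {μ : ℝ} (h : Cov P k μ) (hS : (Sky P).Nonempty) :
    0 ≤ μ := by
  obtain ⟨Q, -, -, hQ⟩ := h
  obtain ⟨s, hs⟩ := hS
  obtain ⟨q, -, h⟩ := hQ s hs
  exact (sqDist_nonneg q s).trans h

/-- With at least as many centers as skyline points, every skyline point can be its own center. This
permits capping `k` at `n`. -/
theorem Cov.min {P : Set (ℝ × ℝ)} {n k : ℕ} {μ : ℝ} (hS : (Sky P).Nonempty)
    (hfin : (Sky P).Finite) (hn : (Sky P).ncard ≤ n) (h : Cov P k μ) : Cov P (min k n) μ := by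
  have hμ := h.nonneg hS
  obtain ⟨Q, hQ, hk, hc⟩ := h
  obtain hkn | hkn := le_total k n
  · exact ⟨Q, hQ, by simp [hkn, hk], hc⟩
  · refine ⟨hfin.toFinset, by simp, ?_, fun s hs => ⟨s, by simpa using hs, by simpa using hμ⟩⟩
    rw [← Set.ncard_eq_toFinset_card _ hfin]
    simp [hkn, hn]

/-- A set of more than `k` skyline points with pairwise large distances shows that `k` points do not
suffice. -/
theorem Cov.le_four_mul {P : Set (ℝ × ℝ)} {k : ℕ} {μ δ : ℝ} (h : Cov P k μ)
    {W : Finset (ℝ × ℝ)} (hW : ↑W ⊆ Sky P) (hk : k < W.card)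
    (hd : ∀ u ∈ W, ∀ v ∈ W, u ≠ v → δ ≤ sqDist u v) : δ ≤ 4 * μ := by
  obtain ⟨Q, hQ, hQk, hc⟩ := h
  choose! f hf using hc
  obtain ⟨u, hu, v, hv, hne, he⟩ := Finset.exists_ne_map_eq_of_card_lt_of_maps_to
    (hQk.trans_lt hk) (f := f) (fun w hw => (hf w (hW hw)).1)
  exact (hd u hu v hv hne).trans
    (sqDist_le_four_mul (hf u (hW hu)).2 (he ▸ (hf v (hW hv)).2))

/-- Every cover within `μ` has `m` centers that cover no skyline point from `l` on. -/
def NeedsBefore (P : Set (ℝ × ℝ)) (μ : ℝ) (l : ℝ × ℝ) (m : ℕ) : Prop :=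
  ∀ Q : Finset (ℝ × ℝ), ↑Q ⊆ Sky P → (∀ s ∈ Sky P, ∃ q ∈ Q, sqDist q s ≤ μ) →
    ∃ Q' ⊆ Q, m ≤ Q'.card ∧ ∀ q ∈ Q', ∀ s ∈ Sky P, l.1 ≤ s.1 → μ < sqDist q s

theorem NeedsBefore.zero (P : Set (ℝ × ℝ)) (μ : ℝ) (l : ℝ × ℝ) : NeedsBefore P μ l 0 :=
  fun _ _ _ => ⟨∅, by simp⟩

/-- The `k` centers that reach nothing from `l` on would be all of them, but some center covers `l`.
-/
theorem NeedsBefore.not_cov {P : Set (ℝ × ℝ)} {μ : ℝ} {l : ℝ × ℝ} {k : ℕ}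
    (h : NeedsBefore P μ l k) (hl : l ∈ Sky P) : ¬ Cov P k μ := by
  rintro ⟨Q, hQ, hk, hc⟩
  obtain ⟨Q', hsub, hm, hQ'⟩ := h Q hQ hc
  obtain ⟨q, hq, hql⟩ := hc l hl
  have heq := Finset.eq_of_subset_of_card_le hsub (hk.trans hm)
  exact absurd (hQ' q (heq ▸ hq) l hl le_rfl) (not_lt.2 hql)

section GreedyStep

variable {P : Set (ℝ × ℝ)} {μ : ℝ} {l c r c' r' : ℝ × ℝ} {f f' : Prop}

theorem IsCut.le_near (hl : l ∈ Sky P) (h : IsCut P (Near l μ) c r f) : l.1 ≤ c.1 :=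
  (h.c_iff l hl).1 (.inl le_rfl)

/-- The center covering `l` is new, since the earlier ones reach nothing from `l` on. It is not
beyond `c`, the last point within reach of `l`, so it reaches no further to the right than `c`, and
in particular not to `r'`. -/
theorem NeedsBefore.succ {m : ℕ} (hl : l ∈ Sky P) (h : IsCut P (Near l μ) c r f)
    (h' : IsCut P (Near c μ) c' r' f') (hf : f') (hm : NeedsBefore P μ l m) :
    NeedsBefore P μ r' (m + 1) := by
  intro Q hQ hc
  obtain ⟨Q', hsub, hcard, hQ'⟩ := hm Q hQ hc
  obtain ⟨q, hq, hql⟩ := hc l hl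
  have hlc := h.le_near hl
  have hlr : l.1 ≤ r'.1 := (hlc.trans (h'.le_near h.c_mem)).trans (h'.lt hf).le
  have hnot : q ∉ Q' := fun hq' => absurd (hQ' q hq' l hl le_rfl) (not_lt.2 hql)
  refine ⟨insert q Q', Finset.insert_subset hq hsub, ?_, ?_⟩
  · rw [Finset.card_insert_of_notMem hnot]
    omega
  · intro p hp s hs hrs
    obtain rfl | hp := Finset.mem_insert.1 hp
    · have hps : p ∈ Sky P := hQ hq
      have hpc : p.1 ≤ c.1 := (h.c_iff p hps).1 (.inr (sqDist_comm p l ▸ hql))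
      have hns := (h'.r_iff hf s hs).2 hrs
      simp only [Near, not_or, not_le] at hns
      exact hns.2.trans_le (sqDist_le_right (Sky.before hps h.c_mem hpc)
        (Sky.before h.c_mem hs hns.1.le))
    · exact hQ' p hp s hs (hlr.trans hrs)

/-- Between `l` and `c` the distance to `c` is at most that from `l` to `c`, which is within the
radius by the choice of `c`. -/
theorem IsCut.covers (hμ : 0 ≤ μ) (hl : l ∈ Sky P) (h : IsCut P (Near l μ) c r f)
    {s : ℝ × ℝ} (hs : s ∈ Sky P) (hls : l.1 ≤ s.1) (hn : Near c μ s) : sqDist c s ≤ μ := by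
  obtain hsc | hn := hn
  · have h1 := Sky.before hl hs hls
    have h2 := Sky.before hs h.c_mem hsc
    rw [sqDist_comm]
    refine (sqDist_le_right h1 h2).trans ?_
    obtain hc | hc := h.c_holds
    · obtain rfl := Sky.ext_fst h.c_mem hl (le_antisymm hc (h.le_near hl))
      simpa using hμ
    · exact hc
  · exact hn

end GreedyStep

end RepSkyline

/-! ### Cutting the skyline at a monotone predicate by binary search in every block -/

namespace RealRAM

open RepSkyline

/-- Halving shortens the binary representation, so the bit length of the remaining interval is a
potential for binary search. -/
theorem _root_.Nat.log2_measure {d e : ℕ} (h : e ≤ d / 2) (hd : 0 < d) : e.size + 1 ≤ d.size := by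
  have h1 : d < 2 ^ d.size := Nat.lt_size_self d
  obtain ⟨m, hm⟩ : ∃ m, d.size = m + 1 := Nat.exists_eq_succ_of_ne_zero (by
    intro h0; rw [h0] at h1; omega)
  rw [hm] at h1 ⊢
  have : e.size ≤ m := Nat.size_le.2 (by rw [pow_succ] at h1; omega)
  omega

/-- Binary search with the test `b` of the index in variable `18`, from the value of variable `15`
up to the value of variable `21`; the boundary is returned in variable `16`. -/
def bisection (b : Test) : Program :=
  block [.setNat 16 (.var 15), .setNat 17 (.var 21),
    .while (.natLe (.add (.var 16) (.const 1)) (.var 17))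
      (block [.setNat 18 (.half (.add (.var 16) (.var 17))),
        .ite b (.setNat 16 (.add (.var 18) (.const 1))) (.setNat 17 (.var 18))])]

theorem bisection_spec {b : Test} {s : State} (B : ℕ → Prop) (hae : s.nvar 15 ≤ s.nvar 21)
    (hb : ∀ s', Frame (bisection b) s s' → s'.nvar 18 < s.nvar 21 →
      (b.Holds s' ↔ B (s'.nvar 18)))
    (hB : ∀ i j, s.nvar 15 ≤ i → i ≤ j → j < s.nvar 21 → B j → B i) {w : ℕ}
    (hw : s.nvar 21 - s.nvar 15 ≤ 2 ^ w) :
    (bisection b).wp s fun s' t =>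
      s.nvar 15 ≤ s'.nvar 16 ∧ s'.nvar 16 ≤ s.nvar 21 ∧
      (∀ i, s.nvar 15 ≤ i → i < s'.nvar 16 → B i) ∧
      (∀ i, s'.nvar 16 ≤ i → i < s.nvar 21 → ¬ B i) ∧
      t ≤ (w + 1) * (b.cost + 30) + 30 := by
  simp only [bisection, wp_block_cons, wp_setNat, NatExpr.eval, State.setN_nvar]
  refine (wp_while (fun s₁ => s.nvar 15 ≤ s₁.nvar 16 ∧ s₁.nvar 16 ≤ s₁.nvar 17 ∧
      s₁.nvar 17 ≤ s.nvar 21 ∧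
      (∀ i, s.nvar 15 ≤ i → i < s₁.nvar 16 → B i) ∧
      (∀ i, s₁.nvar 17 ≤ i → i < s.nvar 21 → ¬ B i))
    (fun s₁ => (s₁.nvar 17 - s₁.nvar 16).size * (b.cost + 30)) ?_ ?_).imp ?_
  · simp only [State.setN_nvar]
    simp
    refine ⟨hae, ?_, ?_⟩ <;> intros <;> omega
  · rintro s₁ hf ⟨h1, h2, h3, h4, h5⟩ hlt
    simp only [Test.Holds, NatExpr.eval] at hlt
    have hmid := hb (s₁.setN 18 ((s₁.nvar 16 + s₁.nvar 17) / 2)) (by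
        refine ⟨fun x hx => ?_, hf.rvar, hf.rarr⟩
        simp [bisection, block, Program.natVars] at hx
        simp [hx, hf.nvar x (by simp [block, Program.natVars, hx])])
        (by simp; omega)
    simp only [State.setN_nvar, if_true] at hmid
    simp only [wp_block_cons, wp_setNat, wp_ite, NatExpr.eval, wp_block_nil, hmid]
    simp
    refine ⟨fun hh => ⟨⟨by omega, by omega, h3, ?_, h5⟩, ?_⟩,
      fun hh => ⟨⟨by omega, by omega, by omega, h4, ?_⟩, ?_⟩⟩
    · intro i hi hi'
      exact hB i _ hi (by omega) (by omega) hh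
    · have := Nat.log2_measure (d := s₁.nvar 17 - s₁.nvar 16)
        (e := s₁.nvar 17 - ((s₁.nvar 16 + s₁.nvar 17) / 2 + 1)) (by omega) (by omega)
      have := Nat.mul_le_mul_right (b.cost + 30) this
      rw [add_mul, one_mul] at this
      omega
    · intro i hi hi' hBi
      exact hh (hB _ i (by omega) hi hi' hBi)
    · have := Nat.log2_measure (d := s₁.nvar 17 - s₁.nvar 16)
        (e := (s₁.nvar 16 + s₁.nvar 17) / 2 - s₁.nvar 16) (by omega) (by omega)
      have := Nat.mul_le_mul_right (b.cost + 30) this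
      rw [add_mul, one_mul] at this
      omega
  · rintro s' t hf ⟨⟨h1, h2, h3, h4, h5⟩, hlt, ht⟩
    simp only [Test.Holds, NatExpr.eval] at hlt
    refine wp_block_nil.2 ⟨h1, by omega, h4, fun i hi => h5 i (by omega), ?_⟩
    simp at ht ⊢
    have : (s.nvar 21 - s.nvar 15).size ≤ w + 1 :=
      Nat.size_le.2 (hw.trans_lt (Nat.pow_lt_pow_right (by norm_num) (by omega)))
    have := Nat.mul_le_mul_right (b.cost + 30) this
    omega

/-- If `flag` is zero, then no `i < m` has `B`; otherwise `v` is the largest `f i` of those. -/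
structure Best (f : ℕ → ℝ) (B : ℕ → Prop) (m flag : ℕ) (v : ℝ) : Prop where
  none : flag = 0 → ∀ i < m, ¬ B i
  some : flag ≠ 0 → ∃ i < m, B i ∧ f i = v
  le : flag ≠ 0 → ∀ i < m, B i → f i ≤ v

/-- Unless the test `b` holds, make the variable `reg` the maximum of itself and `e`; the variable
`flag` says whether it has a value already. -/
def record (flag reg : ℕ) (b : Test) (e : RealExpr) : Program :=
  .ite b .skip
    (.ite (.or (.natLe (.var flag) (.const 0)) (.realLe (.var reg) e))
      (block [.setReal reg e, .setNat flag (.const 1)]) .skip)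

/-- The indices from `a` to `m` form one block. It either contains no candidate or has an extreme
candidate `t` at the search boundary, so a single comparison extends the maximum over all candidates
to this block. -/
theorem record_spec {flag reg : ℕ} {b : Test} {e : RealExpr} {s : State} {f : ℕ → ℝ}
    {B : ℕ → Prop} {a m : ℕ} (hs : Best f B a (s.nvar flag) (s.rvar reg)) (ham : a ≤ m)
    (h : (b.Holds s ∧ ∀ i, a ≤ i → i < m → ¬ B i) ∨ (¬ b.Holds s ∧ ∃ t, a ≤ t ∧ t < m ∧ B t ∧
      e.eval s = f t ∧ ∀ i, a ≤ i → i < m → B i → f i ≤ f t)) :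
    (record flag reg b e).wp s fun s' t =>
      Best f B m (s'.nvar flag) (s'.rvar reg) ∧ t ≤ b.cost + 2 * e.cost + 20 := by
  simp only [record, wp_ite, wp_skip, wp_block_cons, wp_setReal, wp_setNat, wp_block_nil]
  refine ⟨fun hb => ⟨⟨fun h0 i hi hBi => ?_, fun h0 => ?_, fun h0 i hi hBi => ?_⟩, by omega⟩,
    fun hb => ?_⟩
  · obtain ⟨-, h⟩ | ⟨h, -⟩ := h
    · by_cases hia : i < a
      · exact hs.none h0 i hia hBi
      · exact h i (by omega) hi hBi
    · exact h hb
  · obtain ⟨i, hi, h⟩ := hs.some h0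
    exact ⟨i, by omega, h⟩
  · obtain ⟨-, h⟩ | ⟨h, -⟩ := h
    · by_cases hia : i < a
      · exact hs.le h0 i hia hBi
      · exact absurd hBi (h i (by omega) hi)
    · exact absurd hb h
  · obtain ⟨h, -⟩ | ⟨-, t, hat, htm, hBt, he, h⟩ := h
    · exact absurd h hb
    simp only [Test.Holds, NatExpr.eval, RealExpr.eval, he, Nat.le_zero, State.setN_nvar,
      State.setN_rvar, State.setR_rvar, if_true, NatExpr.cost, RealExpr.cost, Test.cost]
    refine ⟨fun hor => ⟨⟨by simp, fun _ => ⟨t, htm, hBt, rfl⟩, fun _ i hi hBi => ?_⟩, by omega⟩,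
      fun hor => ⟨⟨fun h0 => absurd (.inl h0) hor, fun h0 => ?_, fun h0 i hi hBi => ?_⟩,
        by omega⟩⟩
    · by_cases hia : i < a
      · obtain h0 | hle := hor
        · exact absurd hBi (hs.none h0 i hia)
        · by_cases h0 : s.nvar flag = 0
          · exact absurd hBi (hs.none h0 i hia)
          · exact (hs.le h0 i hia hBi).trans hle
      · exact h i (by omega) hi hBi
    · obtain ⟨i, hi, h⟩ := hs.some h0
      exact ⟨i, by omega, h⟩
    · by_cases hia : i < a
      · exact hs.le h0 i hia hBi
      · simp only [not_or, not_le] at hor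
        exact (h i (by omega) hi hBi).trans hor.2.le

/-- The point with the number `i` of the working arrays. -/
def State.pt (s : State) (i : ℕ) : ℝ × ℝ := (s.rarr 2 i, s.rarr 3 i)

/-- In each aligned block of length `b`, the points descend from the left to the right. -/
def Stair (b n : ℕ) (V : ℕ → ℝ × ℝ) : Prop :=
  ∀ a i j, b ∣ a → a ≤ i → i ≤ j → j < a + b → j < n → Before (V i) (V j)

/-- The working arrays carry the skyline of `P` in staircases of length `2 ^ w`. -/
structure Ready (P : Set (ℝ × ℝ)) (w : ℕ) (s : State) : Prop where
  size : s.nvar 2 = 2 ^ w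
  carries : Carries P (s.nvar 0) s.pt
  stair : Stair (2 ^ w) (s.nvar 0) s.pt

theorem Ready.congr {P : Set (ℝ × ℝ)} {w : ℕ} {s s' : State} (h : Ready P w s)
    (h0 : s'.nvar 0 = s.nvar 0) (h2 : s'.nvar 2 = s.nvar 2) (ha : s'.rarr 2 = s.rarr 2)
    (hb : s'.rarr 3 = s.rarr 3) : Ready P w s' := by
  have : s'.pt = s.pt := by funext i; simp [State.pt, ha, hb]
  exact ⟨h2.trans h.size, by rw [h0, this]; exact h.carries, by rw [h0, this]; exact h.stair⟩

/-- Find the maximum of the `x`-coordinates of the points with `b` (variable `2`, flag `19`) and of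
the `y`-coordinates of those without `b` (variable `3`, flag `20`). The test `b` is about the point
whose number is in variable `18`. -/
def search (b : Test) : Program :=
  block [.setNat 19 (.const 0), .setNat 20 (.const 0), .setNat 15 (.const 0),
    .while (.natLe (.add (.var 15) (.const 1)) (.var 0))
      (block [
        .setNat 21 (.sub (.add (.var 15) (.var 2)) (.sub (.add (.var 15) (.var 2)) (.var 0))),
        bisection b,
        record 19 2 (.natLe (.var 16) (.var 15)) (.get 2 (.sub (.var 16) (.const 1))),
        record 20 3 (.natLe (.var 21) (.var 16)) (.get 3 (.var 16)),
        .setNat 15 (.add (.var 15) (.var 2))])]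

theorem search_natVars (b : Test) :
    (search b).natVars = [19, 20, 15, 21, 16, 17, 18, 16, 17, 19, 20, 15] := rfl

theorem search_realVars (b : Test) : (search b).realVars = [2, 3] := rfl

theorem search_realArrs (b : Test) : (search b).realArrs = [] := rfl

theorem bisection_natVars (b : Test) : (bisection b).natVars = [16, 17, 18, 16, 17] := rfl

theorem bisection_realVars (b : Test) : (bisection b).realVars = [] := rfl

theorem bisection_realArrs (b : Test) : (bisection b).realArrs = [] := rfl

/-- In a block, `B` holds up to the boundary found by bisection. The last point before the boundary
is rightmost among those with `B`, and the first one after it is highest among those without `B`, as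
the block descends. -/
theorem search_spec {P : Set (ℝ × ℝ)} {w : ℕ} {b : Test} {s : State} (hs : Ready P w s)
    (B : ℕ → Prop) (hcost : b.cost ≤ 40)
    (hb : ∀ s', Frame (search b) s s' → s'.nvar 18 < s.nvar 0 → (b.Holds s' ↔ B (s'.nvar 18)))
    (hB : ∀ i j, i < s.nvar 0 → j < s.nvar 0 → Before (s.pt i) (s.pt j) → B j → B i) :
    (search b).wp s fun s' t =>
      Best (fun i => (s.pt i).1) B (s.nvar 0) (s'.nvar 19) (s'.rvar 2) ∧
      Best (fun i => (s.pt i).2) (fun i => ¬ B i) (s.nvar 0) (s'.nvar 20) (s'.rvar 3) ∧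
      t ≤ 300 * ((s.nvar 0 / 2 ^ w + 1) * (w + 1)) := by
  have hw : 0 < 2 ^ w := by positivity
  simp only [search, wp_block_cons, wp_setNat, NatExpr.eval]
  refine (wp_while (fun s₁ => 2 ^ w ∣ s₁.nvar 15 ∧
      Best (fun i => (s.pt i).1) B (min (s₁.nvar 15) (s.nvar 0)) (s₁.nvar 19) (s₁.rvar 2) ∧
      Best (fun i => (s.pt i).2) (fun i => ¬ B i) (min (s₁.nvar 15) (s.nvar 0))
        (s₁.nvar 20) (s₁.rvar 3))
    -- The number of blocks still to search, rounded up because the last block may be incomplete.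
    (fun s₁ => ((s.nvar 0 + 2 ^ w - 1 - s₁.nvar 15) / 2 ^ w) * ((w + 1) * 200)) ?_ ?_).imp ?_
  · simp
    exact ⟨⟨by simp, by simp, by simp⟩, ⟨by simp, by simp, by simp⟩⟩
  · rintro s₁ hf ⟨h1, h2, h3⟩ hlt
    have hf₁ : Frame (search b) s s₁ := by
      refine ⟨fun x hx => ?_, hf.rvar, hf.rarr⟩
      simp [search_natVars] at hx
      rw [hf.nvar x (by simp [block, record, Program.natVars, bisection_natVars, hx])]
      simp [hx]
    have h0 : s₁.nvar 0 = s.nvar 0 := hf₁.nvar 0 (by simp [search_natVars])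
    have hsz : s₁.nvar 2 = 2 ^ w := (hf₁.nvar 2 (by simp [search_natVars])).trans hs.size
    have ha2 : s₁.rarr 2 = s.rarr 2 := hf₁.rarr 2 (by simp [search_realArrs])
    have ha3 : s₁.rarr 3 = s.rarr 3 := hf₁.rarr 3 (by simp [search_realArrs])
    simp only [Test.Holds, NatExpr.eval, h0] at hlt
    obtain ⟨a, ha⟩ : ∃ a, s₁.nvar 15 = a := ⟨_, rfl⟩
    -- Truncated subtraction computes the minimum: `e` is the smaller of `a + 2 ^ w` and `n`.
    obtain ⟨e, he⟩ : ∃ e, a + 2 ^ w - (a + 2 ^ w - s.nvar 0) = e := ⟨_, rfl⟩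
    rw [ha] at h1 h2 h3 hlt
    simp only [wp_block_cons, wp_setNat, NatExpr.eval, h0, hsz, ha, he]
    have hst : ∀ i j, a ≤ i → i ≤ j → j < e → Before (s.pt i) (s.pt j) := fun i j hi hij hj =>
      hs.stair a i j h1 hi hij (by omega) (by omega)
    rw [min_eq_left (by omega)] at h2 h3
    refine (bisection_spec (w := w) B (by simp [ha]; omega) ?_ ?_
      (by simp [ha]; omega)).imp ?_
    · intro s' hf' hlt'
      refine hb s' ((hf₁.setN (x := 21) (by simp [search_natVars]) e).trans
        (hf'.mono ?_ ?_ ?_)) (lt_of_lt_of_le hlt' (by simp; omega))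
      · rw [bisection_natVars, search_natVars]; simp
      · simp [bisection_realVars]
      · simp [bisection_realArrs]
    · simp [ha]
      exact fun i j hi hij hj => hB i j (by omega) (by omega) (hst i j hi hij hj)
    rintro s₂ t₂ hf₂ ⟨hlo, hhi, hT, hF, ht₂⟩
    simp [ha] at hlo hhi hT hF
    have h15 := hf₂.nvar 15 (by simp [bisection_natVars])
    have h19 := hf₂.nvar 19 (by simp [bisection_natVars])
    have h20 := hf₂.nvar 20 (by simp [bisection_natVars])
    have h21 := hf₂.nvar 21 (by simp [bisection_natVars])
    have hr2 := hf₂.rvar 2 (by simp [bisection_realVars])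
    have hr3 := hf₂.rvar 3 (by simp [bisection_realVars])
    have hA2 := hf₂.rarr 2 (by simp [bisection_realArrs])
    have hA3 := hf₂.rarr 3 (by simp [bisection_realArrs])
    have hN2 := hf₂.nvar 2 (by simp [bisection_natVars])
    simp [ha, ha2, ha3, hsz] at h15 h19 h20 h21 hr2 hr3 hA2 hA3 hN2
    refine (record_spec (a := a) (m := e) (by rw [h19, hr2]; exact h2) (by omega) ?_).imp ?_
    · simp only [Test.Holds, NatExpr.eval, RealExpr.eval, h15, hA2]
      by_cases hc : s₂.nvar 16 ≤ a
      · exact .inl ⟨hc, fun i hi hie => hF i (by omega) hie⟩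
      · refine .inr ⟨hc, s₂.nvar 16 - 1, by omega, by omega, hT _ (by omega) (by omega), rfl,
          fun i hi hie hBi => ?_⟩
        have : i < s₂.nvar 16 := by
          by_contra! hge
          exact hF i hge hie hBi
        exact (hst i _ hi (by omega) (by omega)).1
    rintro s₃ t₃ hf₃ ⟨hbest, ht₃⟩
    have g15 := hf₃.nvar 15 (by simp [record, block, Program.natVars])
    have g16 := hf₃.nvar 16 (by simp [record, block, Program.natVars])
    have g20 := hf₃.nvar 20 (by simp [record, block, Program.natVars])
    have g21 := hf₃.nvar 21 (by simp [record, block, Program.natVars])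
    have g2 := hf₃.nvar 2 (by simp [record, block, Program.natVars])
    have gr := hf₃.rvar 3 (by simp [record, block, Program.realVars])
    have gA := hf₃.rarr 3 (by simp [record, block, Program.realArrs])
    refine (record_spec (a := a) (m := e) (f := fun i => (s.pt i).2) (B := fun i => ¬ B i)
      (by rw [g20, gr, h20, hr3]; exact h3) (by omega) ?_).imp ?_
    · simp only [Test.Holds, NatExpr.eval, RealExpr.eval, g16, g21, h21, gA, hA3]
      by_cases hc : e ≤ s₂.nvar 16
      · exact .inl ⟨hc, fun i hi hie => not_not.2 (hT i hi (by omega))⟩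
      · refine .inr ⟨hc, s₂.nvar 16, by omega, by omega, hF _ le_rfl (by omega), rfl,
          fun i hi hie hBi => ?_⟩
        have : s₂.nvar 16 ≤ i := by
          by_contra! hge
          exact hBi (hT i hi hge)
        exact (hst _ i (by omega) this hie).2
    rintro s₄ t₄ hf₄ ⟨hbest', ht₄⟩
    have k15 := hf₄.nvar 15 (by simp [record, block, Program.natVars])
    have k19 := hf₄.nvar 19 (by simp [record, block, Program.natVars])
    have k2 := hf₄.nvar 2 (by simp [record, block, Program.natVars])
    have kr := hf₄.rvar 2 (by simp [record, block, Program.realVars])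
    have hmin : min (a + 2 ^ w) (s.nvar 0) = e := by omega
    simp [k15, g15, h15, k2, g2, hN2, k19, kr, hmin]
    refine ⟨⟨h1, hbest, hbest'⟩, ?_⟩
    have hdiv : (s.nvar 0 + 2 ^ w - 1 - a) / 2 ^ w =
        (s.nvar 0 + 2 ^ w - 1 - (a + 2 ^ w)) / 2 ^ w + 1 := by
      rw [← Nat.add_div_right _ hw]
      congr 1
      omega
    rw [hdiv, add_one_mul ((_ : ℕ) / _)]
    simp at ht₃ ht₄
    have : (w + 1) * (b.cost + 30) ≤ (w + 1) * 70 := Nat.mul_le_mul_left _ (by omega)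
    omega
  · rintro s' t hf ⟨⟨h1, h2, h3⟩, hlt, ht⟩
    have h0 : s'.nvar 0 = s.nvar 0 := hf.nvar 0 (by simp [block, record, Program.natVars, bisection_natVars])
    simp only [Test.Holds, NatExpr.eval, h0] at hlt
    rw [min_eq_right (by omega)] at h2 h3
    simp at ht ⊢
    refine ⟨h2, h3, ?_⟩
    have h4 : (s.nvar 0 + 2 ^ w - 1) / 2 ^ w ≤ s.nvar 0 / 2 ^ w + 1 := by
      rw [← Nat.add_div_right _ hw]
      exact Nat.div_le_div_right (by omega)
    have h5 : (s.nvar 0 + 2 ^ w - 1) / 2 ^ w * ((w + 1) * 200) ≤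
        200 * ((s.nvar 0 / 2 ^ w + 1) * (w + 1)) :=
      (Nat.mul_le_mul_right _ h4).trans_eq (by ring)
    have h6 : 1 ≤ (s.nvar 0 / 2 ^ w + 1) * (w + 1) := Nat.succ_le_of_lt (by positivity)
    omega

/-- The last skyline point with `b` goes to the variables `7`, `8`, the first one without `b` to the
variables `5`, `6`; variable `22` says whether the latter exists. -/
def cut (b : Test) : Program :=
  block [search b, .setReal 4 (.var 2),
    search (.realLe (.get 2 (.var 18)) (.var 4)), .setNat 22 (.var 20), .setReal 6 (.var 3),
    .ite (.natLe (.var 22) (.const 0)) (.setReal 7 (.var 4))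
      (block [search (.not (.realLe (.get 3 (.var 18)) (.var 6))), .setReal 7 (.var 2),
        search (.realLe (.var 6) (.get 3 (.var 18))), .setReal 5 (.var 2)]),
    search (.not (.realLe (.var 7) (.get 2 (.var 18)))), .setReal 8 (.var 3)]

theorem cut_natVars (b : Test) : (cut b).natVars =
    (search b).natVars ++ ((search b).natVars ++ (22 :: ((search b).natVars ++
      (search b).natVars) ++ (search b).natVars)) := rfl

theorem cut_realVars (b : Test) :
    (cut b).realVars = [2, 3, 4, 2, 3, 6, 7, 2, 3, 7, 2, 3, 5, 2, 3, 8] := rfl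

theorem cut_realArrs (b : Test) : (cut b).realArrs = [] := rfl

theorem Frame.search_cut {b c : Test} {s s' : State} (h : Frame (search c) s s') :
    Frame (cut b) s s' := by
  refine h.mono ?_ ?_ ?_
  · simp [cut_natVars, search_natVars]
  · simp [cut_realVars, search_realVars]
  · simp [search_realArrs]

theorem Frame.setR {c : Program} {s s' : State} (h : Frame c s s') {x : ℕ}
    (hx : x ∈ c.realVars) (v : ℝ) : Frame c s (s'.setR x v) :=
  ⟨h.nvar, fun y hy => by
    have : y ≠ x := fun h => hy (h ▸ hx)
    simp [this, h.rvar y hy], h.rarr⟩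

/-- A single search gives one coordinate of a possibly fictitious point, so the cut takes up to
five. The largest abscissa `X` with `B` separates the skyline points; the largest ordinate beyond
`X` is that of `r`; the largest abscissa strictly above `r` is that of `c`; the remaining abscissa
of `r` and ordinate of `c` follow from their other coordinates. -/
theorem cut_spec {P : Set (ℝ × ℝ)} {w : ℕ} {b : Test} {s : State} (hs : Ready P w s)
    (B : ℝ × ℝ → Prop) (hB : LeftwardOn P B) (hl : ∃ l ∈ Sky P, B l) (hcost : b.cost ≤ 40)
    (hb : ∀ s', Frame (search b) s s' → (b.Holds s' ↔ B (s.pt (s'.nvar 18)))) :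
    (cut b).wp s fun s' t =>
      IsCut P B (s'.rvar 7, s'.rvar 8) (s'.rvar 5, s'.rvar 6) (s'.nvar 22 ≠ 0) ∧
      t ≤ 1600 * ((s.nvar 0 / 2 ^ w + 1) * (w + 1)) := by
  obtain ⟨n, hn⟩ : ∃ n, s.nvar 0 = n := ⟨_, rfl⟩
  obtain ⟨U, hU⟩ : ∃ U, (n / 2 ^ w + 1) * (w + 1) = U := ⟨_, rfl⟩
  have hU1 : 1 ≤ U := hU ▸ Nat.succ_le_of_lt (by positivity)
  have hc := hs.carries
  obtain ⟨l, hl, hBl⟩ := hl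
  have next : ∀ {c : Test} {s₁ : State} (C : ℝ × ℝ → Prop), Frame (cut b) s s₁ → c.cost ≤ 40 →
      (∀ s', Frame (search c) s₁ s' → (c.Holds s' ↔ C (s.pt (s'.nvar 18)))) →
      (∀ u v, (∃ s ∈ Sky P, u ≤ s) → (∃ s ∈ Sky P, v ≤ s) → C u → Before v u → C v) →
      (search c).wp s₁ fun s' t =>
        Best (fun i => (s.pt i).1) (fun i => C (s.pt i)) n (s'.nvar 19) (s'.rvar 2) ∧
        Best (fun i => (s.pt i).2) (fun i => ¬ C (s.pt i)) n (s'.nvar 20) (s'.rvar 3) ∧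
        t ≤ 300 * U := by
    intro c s₁ C hf hcost hc' hC
    have h0 : s₁.nvar 0 = s.nvar 0 := hf.nvar 0 (by simp [cut_natVars, search_natVars])
    have h2 : s₁.nvar 2 = s.nvar 2 := hf.nvar 2 (by simp [cut_natVars, search_natVars])
    have ha := hf.rarr 2 (by simp [cut_realArrs])
    have ha' := hf.rarr 3 (by simp [cut_realArrs])
    have hpt : s₁.pt = s.pt := by funext i; simp [State.pt, ha, ha']
    have := search_spec (hs.congr h0 h2 ha ha') (b := c) (fun i => C (s.pt i)) hcost
      (fun s' hf' _ => hc' s' hf') (fun i j hi hj hij hCj => by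
        rw [h0] at hi hj
        rw [hpt] at hij
        exact hC _ _ (hc.le j hj) (hc.le i hi) hCj hij)
    simpa only [hpt, h0, hn, hU] using this
  rw [hn, hU]
  simp only [cut, wp_block_cons]
  refine (next B (Frame.refl _ _) hcost hb hB).imp ?_
  rintro s₁ t₁ hf₁ ⟨hX, -, ht₁⟩
  have h19 : s₁.nvar 19 ≠ 0 := fun h0 => by
    obtain ⟨i, hi, rfl⟩ := hc.mem l hl
    exact hX.none h0 i (hn ▸ hi) hBl
  obtain ⟨X, hXeq⟩ : ∃ X, s₁.rvar 2 = X := ⟨_, rfl⟩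
  rw [hXeq] at hX
  have hiff : ∀ p ∈ Sky P, B p ↔ p.1 ≤ X := fun p hp =>
    hc.iff_fst_le hB (hn ▸ hX.some h19) (hn ▸ hX.le h19) hp
  have F₁ : Frame (cut b) s s₁ := hf₁.search_cut
  simp only [wp_setReal, RealExpr.eval, hXeq]
  have F₁' := F₁.setR (x := 4) (by simp [cut_realVars]) X
  refine (next (fun v => v.1 ≤ X) F₁' (by simp) ?_ (leftwardOn_fst_le P X)).imp ?_
  · intro s' hf'
    have e4 := hf'.rvar 4 (by simp [search_realVars])
    have ea := (F₁'.trans hf'.search_cut).rarr 2 (by simp [cut_realArrs])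
    simp at e4
    simp [e4, ea, State.pt]
  rintro s₂ t₂ hf₂ ⟨hT, hF, ht₂⟩
  have F₂ := F₁'.trans hf₂.search_cut
  have e4 := hf₂.rvar 4 (by simp [search_realVars])
  simp at e4
  simp only [not_le] at hF
  obtain ⟨y, hy⟩ : ∃ y, s₂.rvar 3 = y := ⟨_, rfl⟩
  obtain ⟨f, hfl⟩ : ∃ f, s₂.nvar 20 = f := ⟨_, rfl⟩
  rw [hy, hfl] at hF
  simp only [wp_setNat, NatExpr.eval, State.setN_rvar, hy, hfl]
  have F₂' := (F₂.setN (x := 22) (by simp [cut_natVars]) f).setR (x := 6)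
    (by simp [cut_realVars]) y
  have last : ∀ (s₃ : State) (c : ℝ × ℝ), Frame (cut b) s s₃ → c ∈ Sky P → s₃.rvar 7 = c.1 →
      (search (.not (.realLe (.var 7) (.get 2 (.var 18))))).wp s₃ fun s' t =>
        s'.rvar 3 = c.2 ∧ t ≤ 300 * U := by
    intro s₃ c F₃ hcS h7
    refine (next (fun v => ¬ c.1 ≤ v.1) F₃ (by simp) ?_ ?_).imp ?_
    · intro s' hf'
      have e7 := hf'.rvar 7 (by simp [search_realVars])
      have ea := (F₃.trans hf'.search_cut).rarr 2 (by simp [cut_realArrs])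
      simp [e7, h7, ea, State.pt]
    · exact fun u v _ _ hu hvu hv => hu (hv.trans hvu.1)
    · rintro s' t - ⟨-, hY, ht⟩
      simp only [not_not] at hY
      have h20 : s'.nvar 20 ≠ 0 := fun h0 => by
        obtain ⟨i, hi, rfl⟩ := hc.mem c hcS
        exact hY.none h0 i (hn ▸ hi) le_rfl
      exact ⟨hc.snd_eq hcS (hn ▸ hY.some h20) (hn ▸ hY.le h20), ht⟩
  simp only [wp_ite, Test.Holds, NatExpr.eval, Nat.le_zero, wp_setReal, RealExpr.eval,
    State.setR_nvar, State.setR_rvar, State.setN_nvar, State.setN_rvar, if_true, e4]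
  refine ⟨fun hf0 => ?_, fun hf0 => ?_⟩
  · have hmax : ∀ p ∈ Sky P, p.1 ≤ X := fun p hp => by
      obtain ⟨i, hi, rfl⟩ := hc.mem p hp
      exact not_lt.1 (hF.none hf0 i (hn ▸ hi))
    -- Nothing lies to the right of `X`, so the skyline point that dominates the point attaining `X`
    -- has abscissa exactly `X`.
    obtain ⟨c, hcS, hcX⟩ : ∃ c ∈ Sky P, c.1 = X := by
      obtain ⟨i, hi, -, hiX⟩ := hX.some h19
      obtain ⟨c, hcS, hle⟩ := hc.le i (hn ▸ hi)
      exact ⟨c, hcS, le_antisymm (hmax c hcS) (hiX ▸ hle.1)⟩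
    refine (last _ c (F₂'.setR (x := 7) (by simp [cut_realVars]) X) hcS (by simp [hcX])).imp ?_
    rintro s₃ t₃ hf₃ ⟨h3, ht₃⟩
    have e7 := hf₃.rvar 7 (by simp [search_realVars])
    have e22 := hf₃.nvar 22 (by simp [search_natVars])
    simp at e7 e22
    have hce : (X, c.2) = c := by rw [← hcX]
    simp [e7, e22, hf0, h3, hce]
    refine ⟨⟨hcS, fun p hp => by rw [hiff p hp, hcX], by simp, by simp,
      fun _ p hp => (hiff p hp).2 (hmax p hp)⟩, by omega⟩
  · obtain ⟨r, hr, rfl, hXr, hrmin⟩ := hc.exists_next (hn ▸ hF.some hf0) (hn ▸ hF.le hf0)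
    simp only [wp_block_cons]
    refine (next (fun v => ¬ v.2 ≤ r.2) F₂' (by simp) ?_ ?_).imp ?_
    · intro s' hf'
      have e6 := hf'.rvar 6 (by simp [search_realVars])
      have ea := (F₂'.trans hf'.search_cut).rarr 3 (by simp [cut_realArrs])
      simp at e6
      simp [e6, ea, State.pt]
    · exact fun u v _ _ hu hvu hv => hu (hvu.2.trans hv)
    rintro s₃ t₃ hf₃ ⟨hP, -, ht₃⟩
    simp only [not_le] at hP
    have h19' : s₃.nvar 19 ≠ 0 := fun h0 => by
      obtain ⟨i, hi, rfl⟩ := hc.mem l hl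
      exact hP.none h0 i (hn ▸ hi) (Sky.snd_lt hl hr (((hiff _ hl).1 hBl).trans_lt hXr))
    obtain ⟨c, hcS, hcx, hcr, hcmax⟩ := hc.exists_prev (hn ▸ hP.some h19') (hn ▸ hP.le h19')
    have F₃ := F₂'.trans hf₃.search_cut
    simp only [wp_setReal, RealExpr.eval, ← hcx]
    have F₃' := F₃.setR (x := 7) (by simp [cut_realVars]) c.1
    have e6 := hf₃.rvar 6 (by simp [search_realVars])
    have e22 := hf₃.nvar 22 (by simp [search_natVars])
    simp at e6 e22
    refine (next (fun v => r.2 ≤ v.2) F₃' (by simp) ?_ ?_).imp ?_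
    · intro s' hf'
      have e6' := hf'.rvar 6 (by simp [search_realVars])
      have ea := (F₃'.trans hf'.search_cut).rarr 3 (by simp [cut_realArrs])
      simp [e6] at e6'
      simp [e6', ea, State.pt]
    · exact fun u v _ _ hu hvu => hu.trans hvu.2
    rintro s₄ t₄ hf₄ ⟨hR, -, ht₄⟩
    have h19'' : s₄.nvar 19 ≠ 0 := fun h0 => by
      obtain ⟨i, hi, rfl⟩ := hc.mem r hr
      exact hR.none h0 i (hn ▸ hi) le_rfl
    have hrx := hc.fst_eq hr (hn ▸ hR.some h19'') (hn ▸ hR.le h19'')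
    have F₄ := F₃'.trans hf₄.search_cut
    have k6 := hf₄.rvar 6 (by simp [search_realVars])
    have k7 := hf₄.rvar 7 (by simp [search_realVars])
    have k22 := hf₄.nvar 22 (by simp [search_natVars])
    simp [e6, e22] at k6 k7 k22
    simp only [wp_block_nil, hrx]
    refine (last _ c (F₄.setR (x := 5) (by simp [cut_realVars]) r.1) hcS (by simp [k7])).imp ?_
    rintro s₅ t₅ hf₅ ⟨h3, ht₅⟩
    have m5 := hf₅.rvar 5 (by simp [search_realVars])
    have m6 := hf₅.rvar 6 (by simp [search_realVars])
    have m7 := hf₅.rvar 7 (by simp [search_realVars])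
    have m22 := hf₅.nvar 22 (by simp [search_natVars])
    simp [k6, k7, k22] at m5 m6 m7 m22
    simp [m5, m6, m7, m22, h3]
    have hcX : ∀ p ∈ Sky P, p.1 ≤ X ↔ p.1 ≤ c.1 := fun p hp =>
      ⟨fun h => hcmax p hp (Sky.snd_lt hp hr (h.trans_lt hXr)), fun h => by
        by_contra! hlt
        exact absurd (Sky.fst_lt hcS hr hcr) (not_lt.2 ((hrmin p hp hlt).trans h))⟩
    refine ⟨⟨hcS, fun p hp => (hiff p hp).trans (hcX p hp), fun _ => hr, fun _ p hp => ?_,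
      fun h => absurd hf0 h⟩, by omega⟩
    rw [hiff p hp, not_le]
    exact ⟨hrmin p hp, fun h => hXr.trans_le h⟩

end RealRAM

namespace RealRAM

open RepSkyline

/-! ### Merging staircases -/

/-- The outputs `O p` with `a ≤ p < o` are the merged staircase of the points `V t` with `a ≤ t < i`
and `m ≤ t < j`, and come before the other points of `V` between `a` and `e`. -/
structure Merging (V O : ℕ → ℝ × ℝ) (a m e i j o : ℕ) : Prop where
  le_i : a ≤ i
  i_le : i ≤ m
  le_j : m ≤ j
  j_le : j ≤ e
  sum : o + m = i + j
  chain : ∀ p q, a ≤ p → p ≤ q → q < o → Before (O p) (O q)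
  ahead : ∀ p, a ≤ p → p < o → ∀ t, (i ≤ t ∧ t < m) ∨ (j ≤ t ∧ t < e) → Before (O p) (V t)
  sound : ∀ p, a ≤ p → p < o → ∃ t, t < e ∧ O p ≤ V t
  complete : ∀ t, (a ≤ t ∧ t < i) ∨ (m ≤ t ∧ t < j) → ∃ p, p < o ∧ V t ≤ O p

/-- `h₁` and `h₂` make the new output the greatest lower bound, in the order `Before`, of all
remaining points. Earlier outputs precede these points, hence also the new output. -/
theorem Merging.step {V O O' : ℕ → ℝ × ℝ} {a m e i j o i' j' : ℕ} (h : Merging V O a m e i j o)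
    (hO : ∀ p, p < o → O' p = O p) (hi : i' ≤ m) (hj : j' ≤ e) {t₀ : ℕ}
    (hij : (i' = i + 1 ∧ j' = j ∧ t₀ = i) ∨ (i' = i ∧ j' = j + 1 ∧ t₀ = j))
    (h₁ : ∀ t, (i ≤ t ∧ t < m) ∨ (j ≤ t ∧ t < e) → Before (O' o) (V t))
    (h₂ : ∀ u, (∀ t, (i ≤ t ∧ t < m) ∨ (j ≤ t ∧ t < e) → Before u (V t)) → Before u (O' o))
    (h₃ : ∃ t, t < e ∧ O' o ≤ V t) (h₄ : V t₀ ≤ O' o) :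
    Merging V O' a m e i' j' (o + 1) := by
  have := h.le_i
  have := h.i_le
  have := h.le_j
  have := h.sum
  refine ⟨by omega, hi, by omega, hj, by omega, fun p q hp hpq hq => ?_, fun p hp hpo t ht => ?_,
    fun p hp hpo => ?_, fun t ht => ?_⟩
  · obtain hq | rfl := Nat.lt_succ_iff_lt_or_eq.1 hq
    · rw [hO p (by omega), hO q hq]
      exact h.chain p q hp hpq hq
    · obtain hpq | rfl := hpq.lt_or_eq
      · rw [hO p hpq]
        exact h₂ _ (h.ahead p hp hpq)
      · exact .refl _
  · obtain hpo | rfl := Nat.lt_succ_iff_lt_or_eq.1 hpo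
    · rw [hO p hpo]
      exact h.ahead p hp hpo t (by omega)
    · exact h₁ t (by omega)
  · obtain hpo | rfl := Nat.lt_succ_iff_lt_or_eq.1 hpo
    · rw [hO p hpo]
      exact h.sound p hp hpo
    · exact h₃
  · by_cases ht₀ : t = t₀
    · exact ⟨o, by omega, ht₀ ▸ h₄⟩
    · obtain ⟨p, hp, hle⟩ := h.complete t (by omega)
      exact ⟨p, by omega, by rwa [hO p hp]⟩

/-- The point with the number `i` of the arrays that receive the output of a merge. -/
def State.out (s : State) (i : ℕ) : ℝ × ℝ := (s.rarr 4 i, s.rarr 5 i)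

/-- Merge the staircases from variable `8` to `12` and from `12` to `13`. -/
def mergeRuns : Program :=
  block [.setNat 10 (.var 8), .setNat 11 (.var 12), .setNat 9 (.var 8),
    .while (.natLe (.add (.var 9) (.const 1)) (.var 13)) (block [
      .ite (.natLe (.var 13) (.var 11))
        (block [.setReal 24 (.get 2 (.var 10)), .setReal 25 (.get 3 (.var 10)),
          .setNat 10 (.add (.var 10) (.const 1))])
        (.ite (.natLe (.var 12) (.var 10))
          (block [.setReal 24 (.get 2 (.var 11)), .setReal 25 (.get 3 (.var 11)),
            .setNat 11 (.add (.var 11) (.const 1))])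
          (block [
            .ite (.realLe (.get 3 (.var 10)) (.get 3 (.var 11)))
              (.setReal 25 (.get 3 (.var 11))) (.setReal 25 (.get 3 (.var 10))),
            .ite (.realLe (.get 2 (.var 10)) (.get 2 (.var 11)))
              (block [.setReal 24 (.get 2 (.var 10)), .setNat 10 (.add (.var 10) (.const 1))])
              (block [.setReal 24 (.get 2 (.var 11)),
                .setNat 11 (.add (.var 11) (.const 1))])])),
      .storeReal 4 (.var 9) (.var 24), .storeReal 5 (.var 9) (.var 25),
      .setNat 9 (.add (.var 9) (.const 1))])]

/-- With the heads `i` and `j` the output is (smaller `x`, larger `y`). It dominates the head with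
the smaller `x`, which is consumed, and is dominated by the head with the larger `y`. So lengths add
up exactly and block boundaries stay aligned, although dominated points are never removed. -/
theorem mergeRuns_spec {s : State} {a m e : ℕ} (ha : s.nvar 8 = a) (hm : s.nvar 12 = m)
    (he : s.nvar 13 = e) (ham : a ≤ m) (hme : m ≤ e)
    (h₁ : ∀ i j, a ≤ i → i ≤ j → j < m → Before (s.pt i) (s.pt j))
    (h₂ : ∀ i j, m ≤ i → i ≤ j → j < e → Before (s.pt i) (s.pt j)) :
    mergeRuns.wp s fun s' t =>
      (∃ i j, Merging s.pt s'.out a m e i j e) ∧ (∀ p < a, s'.out p = s.out p) ∧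
        t ≤ (e - a) * 100 + 50 := by
  simp only [mergeRuns, wp_block_cons, wp_setNat, NatExpr.eval, ha, hm, State.setN_nvar]
  refine (wp_while (fun s₁ => Merging s.pt s₁.out a m e (s₁.nvar 10) (s₁.nvar 11) (s₁.nvar 9) ∧
    s₁.nvar 9 ≤ e ∧ a ≤ s₁.nvar 9 ∧ ∀ p < a, s₁.out p = s.out p)
    (fun s₁ => (e - s₁.nvar 9) * 100) ?_ ?_).imp ?_
  · simp
    refine ⟨⟨le_rfl, ham, le_rfl, hme, by omega, ?_, ?_, ?_, ?_⟩, by omega, ?_⟩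
    · intros; omega
    · intros; omega
    · intros; omega
    · intros; omega
    · exact fun p hp => rfl
  · rintro s₁ hf ⟨hM, hoe, hao, hout⟩ hlt
    have e12 := hf.nvar 12 (by simp [block, Program.natVars])
    have e13 := hf.nvar 13 (by simp [block, Program.natVars])
    have a2 := hf.rarr 2 (by simp [block, Program.realArrs])
    have a3 := hf.rarr 3 (by simp [block, Program.realArrs])
    simp [hm, he] at e12 e13 a2 a3
    obtain ⟨i, hi⟩ : ∃ i, s₁.nvar 10 = i := ⟨_, rfl⟩
    obtain ⟨j, hj⟩ : ∃ j, s₁.nvar 11 = j := ⟨_, rfl⟩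
    obtain ⟨o, ho⟩ : ∃ o, s₁.nvar 9 = o := ⟨_, rfl⟩
    rw [hi, hj, ho] at hM
    rw [ho] at hoe hao
    simp only [Test.Holds, NatExpr.eval, ho, e13] at hlt
    have c1 := hM.le_i
    have c2 := hM.i_le
    have c3 := hM.le_j
    have c4 := hM.j_le
    have c5 := hM.sum
    have hout' : ∀ p < a, p ≠ o := fun p hp => by omega
    simp [e12, e13, a2, a3, hi, hj, ho]
    refine ⟨fun hje => ?_, fun hje => ⟨fun hmi => ?_, fun hmi => ?_⟩⟩
    · refine ⟨⟨hM.step (t₀ := i) ?_ (by omega) (by omega) (.inl ⟨rfl, rfl, rfl⟩) ?_ ?_ ?_ ?_,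
        by omega, by omega, ?_⟩, by omega⟩
      · intro p hp
        simp [State.out, hp.ne]
      · intro t ht
        simp only [State.out, State.setN_rarr, State.setA_rarr]
        simpa [State.pt] using h₁ i t (by omega) (by omega) (by omega)
      · intro u hu
        simpa [State.out, State.pt] using hu i (by omega)
      · exact ⟨i, by omega, by simp [State.out, State.pt]⟩
      · simp [State.out, State.pt]
      · intro p hp
        simpa [State.out, hout' p hp] using hout p hp
    · refine ⟨⟨hM.step (t₀ := j) ?_ (by omega) (by omega) (.inr ⟨rfl, rfl, rfl⟩) ?_ ?_ ?_ ?_,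
        by omega, by omega, ?_⟩, by omega⟩
      · intro p hp
        simp [State.out, hp.ne]
      · intro t ht
        simpa [State.out, State.pt] using h₂ j t (by omega) (by omega) (by omega)
      · intro u hu
        simpa [State.out, State.pt] using hu j (by omega)
      · exact ⟨j, by omega, by simp [State.out, State.pt]⟩
      · simp [State.out, State.pt]
      · intro p hp
        simpa [State.out, hout' p hp] using hout p hp
    · have key : ∀ (O' : ℕ → ℝ × ℝ) (x y : ℝ), O' o = (x, y) →
          x = min (s.rarr 2 i) (s.rarr 2 j) → y = max (s.rarr 3 i) (s.rarr 3 j) →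
          (∀ t, (i ≤ t ∧ t < m) ∨ (j ≤ t ∧ t < e) → Before (O' o) (s.pt t)) ∧
          (∀ u, (∀ t, (i ≤ t ∧ t < m) ∨ (j ≤ t ∧ t < e) → Before u (s.pt t)) →
            Before u (O' o)) := by
        rintro O' x y h rfl rfl
        rw [h]
        refine ⟨fun t ht => ?_, fun u hu => ?_⟩
        · obtain ht | ht := ht
          · have := h₁ i t (by omega) ht.1 ht.2
            exact ⟨(min_le_left _ _).trans this.1, this.2.trans (le_max_left _ _)⟩
          · have := h₂ j t (by omega) ht.1 ht.2
            exact ⟨(min_le_right _ _).trans this.1, this.2.trans (le_max_right _ _)⟩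
        · have hui := hu i (by omega)
          have huj := hu j (by omega)
          exact ⟨le_min hui.1 huj.1, max_le hui.2 huj.2⟩
      have left : ∀ (O' : ℕ → ℝ × ℝ) (y : ℝ), (∀ p < o, O' p = s₁.out p) →
          O' o = (s.rarr 2 i, y) → s.rarr 2 i ≤ s.rarr 2 j →
          y = max (s.rarr 3 i) (s.rarr 3 j) → Merging s.pt O' a m e (i + 1) j (o + 1) := by
        intro O' y hO ho hx hy
        obtain ⟨k1, k2⟩ := key O' _ y ho (min_eq_left hx).symm hy
        refine hM.step (t₀ := i) hO (by omega) (by omega) (.inl ⟨rfl, rfl, rfl⟩) k1 k2 ?_ ?_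
        · rw [ho, hy]
          obtain h | h := le_total (s.rarr 3 i) (s.rarr 3 j)
          · exact ⟨j, by omega, hx, by simp [h, State.pt]⟩
          · exact ⟨i, by omega, le_rfl, by simp [h, State.pt]⟩
        · rw [ho, hy]
          exact ⟨le_rfl, le_max_left _ _⟩
      have right : ∀ (O' : ℕ → ℝ × ℝ) (y : ℝ), (∀ p < o, O' p = s₁.out p) →
          O' o = (s.rarr 2 j, y) → s.rarr 2 j < s.rarr 2 i →
          y = max (s.rarr 3 i) (s.rarr 3 j) → Merging s.pt O' a m e i (j + 1) (o + 1) := by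
        intro O' y hO ho hx hy
        obtain ⟨k1, k2⟩ := key O' _ y ho (min_eq_right hx.le).symm hy
        refine hM.step (t₀ := j) hO (by omega) (by omega) (.inr ⟨rfl, rfl, rfl⟩) k1 k2 ?_ ?_
        · rw [ho, hy]
          obtain h | h := le_total (s.rarr 3 i) (s.rarr 3 j)
          · exact ⟨j, by omega, le_rfl, by simp [h, State.pt]⟩
          · exact ⟨i, by omega, hx.le, by simp [h, State.pt]⟩
        · rw [ho, hy]
          exact ⟨le_rfl, le_max_right _ _⟩
      refine ⟨fun hy => ⟨fun hx => ?_, fun hx => ?_⟩, fun hy => ⟨fun hx => ?_, fun hx => ?_⟩⟩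
      · refine ⟨⟨left _ (s.rarr 3 j) ?_ ?_ hx (max_eq_right hy).symm, by omega, by omega, ?_⟩,
          by omega⟩
        · exact fun p hp => by simp [State.out, hp.ne]
        · simp [State.out]
        · exact fun p hp => by simpa [State.out, hout' p hp] using hout p hp
      · refine ⟨⟨right _ (s.rarr 3 j) ?_ ?_ hx (max_eq_right hy).symm, by omega, by omega, ?_⟩,
          by omega⟩
        · exact fun p hp => by simp [State.out, hp.ne]
        · simp [State.out]
        · exact fun p hp => by simpa [State.out, hout' p hp] using hout p hp
      · refine ⟨⟨left _ (s.rarr 3 i) ?_ ?_ hx (max_eq_left hy.le).symm, by omega, by omega, ?_⟩,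
          by omega⟩
        · exact fun p hp => by simp [State.out, hp.ne]
        · simp [State.out]
        · exact fun p hp => by simpa [State.out, hout' p hp] using hout p hp
      · refine ⟨⟨right _ (s.rarr 3 i) ?_ ?_ hx (max_eq_left hy.le).symm, by omega, by omega, ?_⟩,
          by omega⟩
        · exact fun p hp => by simp [State.out, hp.ne]
        · simp [State.out]
        · exact fun p hp => by simpa [State.out, hout' p hp] using hout p hp
  · rintro s' t hf ⟨⟨hM, hoe, hao, hout⟩, hlt, ht⟩
    have e13 := hf.nvar 13 (by simp [block, Program.natVars])
    simp [he] at e13 hlt ht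
    rw [e13] at hlt
    have : s'.nvar 9 = e := by omega
    simp
    refine ⟨⟨_, _, this ▸ hM⟩, hout, by omega⟩

/-- Copy the first points of the arrays `a`, `b` to the arrays `c`, `d`. -/
def copyPoints (a b c d : ℕ) : Program :=
  forLoop 14 0 (block [.storeReal c (.var 14) (.get a (.var 14)),
    .storeReal d (.var 14) (.get b (.var 14))])

theorem copyPoints_spec {a b c d : ℕ} {s : State} (hac : a ≠ c) (had : a ≠ d) (hbc : b ≠ c)
    (hbd : b ≠ d) (hcd : c ≠ d) :
    (copyPoints a b c d).wp s fun s' t =>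
      (∀ i < s.nvar 0, s'.rarr c i = s.rarr a i ∧ s'.rarr d i = s.rarr b i) ∧
      t ≤ 30 * s.nvar 0 + 30 := by
  refine (wp_forLoop (fun j s' => ∀ i < j, s'.rarr c i = s.rarr a i ∧ s'.rarr d i = s.rarr b i)
    10 (by simp) (by simp [block, Program.natVars]) (by simp [block, Program.natVars])
    (by simp) ?_).imp ?_
  · intro j s₁ hf hj hn hlt hI
    have e1 := hf.rarr a (by simp [forLoop, block, Program.realArrs, hac, had])
    have e2 := hf.rarr b (by simp [forLoop, block, Program.realArrs, hbc, hbd])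
    simp [hj, hcd, hcd.symm, hbc, e1, e2]
    intro i hi
    by_cases hij : i = j
    · simp [hij]
    · simpa [hij] using hI i (by omega)
  · rintro s' t - ⟨h, ht⟩
    exact ⟨h, by omega⟩

/-- The first `n` points of `V` and of `O` dominate each other. -/
structure Equi (n : ℕ) (V O : ℕ → ℝ × ℝ) : Prop where
  sound : ∀ p < n, ∃ t < n, O p ≤ V t
  complete : ∀ t < n, ∃ p < n, V t ≤ O p

/-- Something in `O` dominates each skyline point and is itself dominated by a skyline point;
maximality forces all three to coincide. -/
theorem _root_.RepSkyline.Carries.equi {P : Set (ℝ × ℝ)} {n : ℕ} {V O : ℕ → ℝ × ℝ}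
    (h : Carries P n V) (h' : Equi n V O) : Carries P n O := by
  have le : ∀ i < n, ∃ s ∈ Sky P, O i ≤ s := fun i hi => by
    obtain ⟨t, ht, hle⟩ := h'.sound i hi
    obtain ⟨s, hs, hle'⟩ := h.le t ht
    exact ⟨s, hs, hle.trans hle'⟩
  refine ⟨le, fun s hs => ?_⟩
  obtain ⟨i, hi, rfl⟩ := h.mem s hs
  obtain ⟨p, hp, hle⟩ := h'.complete i hi
  obtain ⟨s', hs', hle'⟩ := le p hp
  have := Sky.eq_of_le hs hs' (hle.trans hle')
  exact ⟨p, hp, le_antisymm (this ▸ hle') hle⟩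

theorem Stair.append {b a n : ℕ} {V : ℕ → ℝ × ℝ} (ha : b ∣ a) (h : Stair b a V)
    (h' : ∀ i j, a ≤ i → i ≤ j → j < min (a + b) n → Before (V i) (V j)) :
    Stair b (min (a + b) n) V := by
  intro a' i j ha' hi hij hj hjn
  by_cases hja : j < a
  · exact h a' i j ha' hi hij hj hja
  -- Both are multiples of `b`, and they are less than `b` apart because the block of `a'` meets the
  -- block of `a`.
  · have : a' = a := by
      obtain ⟨x, rfl⟩ := ha
      obtain ⟨y, rfl⟩ := ha'
      have h1 : b * x < b * (y + 1) := by rw [mul_add_one]; omega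
      have h2 : b * y < b * (x + 1) := by rw [mul_add_one]; omega
      have h3 := Nat.lt_of_mul_lt_mul_left h1
      have h4 := Nat.lt_of_mul_lt_mul_left h2
      rw [show y = x by omega]
    exact h' i j (by omega) hij hjn

/-- Merge the staircases of the working arrays pairwise; their length is in variable `2`. -/
def mergePass : Program :=
  block [.setNat 8 (.const 0),
    .while (.natLe (.add (.var 8) (.const 1)) (.var 0)) (block [
      .setNat 12 (.sub (.add (.var 8) (.var 2)) (.sub (.add (.var 8) (.var 2)) (.var 0))),
      .setNat 13 (.sub (.add (.var 8) (.add (.var 2) (.var 2)))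
        (.sub (.add (.var 8) (.add (.var 2) (.var 2))) (.var 0))),
      mergeRuns,
      .setNat 8 (.add (.var 8) (.add (.var 2) (.var 2)))]),
    copyPoints 4 5 2 3]

theorem mergeRuns_natVars : mergeRuns.natVars = [10, 11, 9, 10, 11, 10, 11, 9] := rfl

theorem mergeRuns_realArrs : mergeRuns.realArrs = [4, 5] := rfl

theorem mergePass_spec {s : State} {b : ℕ} (hb : 0 < b) (h2 : s.nvar 2 = b)
    (hs : Stair b (s.nvar 0) s.pt) :
    mergePass.wp s fun s' t => Stair (b + b) (s.nvar 0) s'.pt ∧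
      Equi (s.nvar 0) s.pt s'.pt ∧ t ≤ 300 * s.nvar 0 + 100 := by
  obtain ⟨n, hn⟩ : ∃ n, s.nvar 0 = n := ⟨_, rfl⟩
  rw [hn] at hs ⊢
  simp only [mergePass, wp_block_cons, wp_setNat, NatExpr.eval]
  refine (wp_while (fun s₁ => b + b ∣ s₁.nvar 8 ∧ Stair (b + b) (min (s₁.nvar 8) n) s₁.out ∧
      (∀ p < min (s₁.nvar 8) n, ∃ t < n, s₁.out p ≤ s.pt t) ∧
      (∀ t < min (s₁.nvar 8) n, ∃ p < min (s₁.nvar 8) n, s.pt t ≤ s₁.out p))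
    (fun s₁ => (n - s₁.nvar 8) * 250) ?_ ?_).imp ?_
  · simp
    intro a' i j _ _ _ _ hj
    omega
  · rintro s₁ hf ⟨hdvd, hst, hso, hco⟩ hlt
    have e0 := hf.nvar 0 (by simp [block, Program.natVars, mergeRuns_natVars])
    have e2 := hf.nvar 2 (by simp [block, Program.natVars, mergeRuns_natVars])
    have a2 := hf.rarr 2 (by simp [block, Program.realArrs, mergeRuns_realArrs])
    have a3 := hf.rarr 3 (by simp [block, Program.realArrs, mergeRuns_realArrs])
    simp [hn, h2] at e0 e2 a2 a3
    have hpt : s₁.pt = s.pt := by funext i; simp [State.pt, a2, a3]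
    obtain ⟨a, ha⟩ : ∃ a, s₁.nvar 8 = a := ⟨_, rfl⟩
    obtain ⟨m, hm⟩ : ∃ m, a + b - (a + b - n) = m := ⟨_, rfl⟩
    obtain ⟨e, he⟩ : ∃ e, a + (b + b) - (a + (b + b) - n) = e := ⟨_, rfl⟩
    have hmin : min (a + (b + b)) n = e := by omega
    simp only [Test.Holds, NatExpr.eval, ha, e0] at hlt
    rw [ha] at hdvd hst hso hco
    rw [min_eq_left (by omega)] at hst hso hco
    simp only [wp_block_cons, wp_setNat, NatExpr.eval, ha, e0, e2, hm, State.setN_nvar]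
    have hdvd' : b ∣ a := (Dvd.intro_left 2 (two_mul b)).trans hdvd
    refine (mergeRuns_spec (a := a) (m := m) (e := e) (by simp [ha]) (by simp) (by simp [he])
      (by omega) (by omega) ?_ ?_).imp ?_
    · intro i j hi hij hj
      show Before (s₁.pt i) (s₁.pt j)
      rw [hpt]
      exact hs a i j hdvd' hi hij (by omega) (by omega)
    · intro i j hi hij hj
      show Before (s₁.pt i) (s₁.pt j)
      rw [hpt]
      exact hs (a + b) i j (Dvd.dvd.add hdvd' dvd_rfl) (by omega) hij (by omega) (by omega)
    rintro s₂ t₂ hf₂ ⟨⟨i, j, hM⟩, hout, ht₂⟩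
    have k2 := hf₂.nvar 2 (by simp [mergeRuns_natVars])
    have k8 := hf₂.nvar 8 (by simp [mergeRuns_natVars])
    simp [e2, ha] at k2 k8
    replace hM : Merging s.pt s₂.out a m e i j e := hpt ▸ hM
    replace hout : ∀ p < a, s₂.out p = s₁.out p := hout
    have := hM.le_i
    have := hM.i_le
    have := hM.le_j
    have := hM.j_le
    have := hM.sum
    simp only [wp_block_nil, k2, k8, State.setN_nvar, if_true, hmin]
    refine ⟨⟨Dvd.dvd.add hdvd dvd_rfl, ?_, ?_, ?_⟩, ?_⟩
    · rw [← hmin]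
      refine Stair.append hdvd ?_ ?_
      · intro a' i j ha' hi hij hj hja
        show Before (s₂.out i) (s₂.out j)
        rw [hout i (by omega), hout j hja]
        exact hst a' i j ha' hi hij hj hja
      · intro i j hi hij hj
        exact hM.chain i j hi hij (by omega)
    · intro p hp
      by_cases hpa : p < a
      · obtain ⟨t, ht, hle⟩ := hso p hpa
        exact ⟨t, ht, by rw [← hout p hpa] at hle; exact hle⟩
      · obtain ⟨t, ht, hle⟩ := hM.sound p (by omega) hp
        exact ⟨t, by omega, hle⟩
    · intro t ht
      by_cases hta : t < a
      · obtain ⟨p, hp, hle⟩ := hco t hta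
        exact ⟨p, by omega, by rw [← hout p hp] at hle; exact hle⟩
      · obtain ⟨p, hp, hle⟩ := hM.complete t (by omega)
        exact ⟨p, hp, hle⟩
    · simp
      omega
  · rintro s₁ t hf ⟨⟨hdvd, hst, hso, hco⟩, hlt, ht⟩
    have e0 := hf.nvar 0 (by simp [block, Program.natVars, mergeRuns_natVars])
    simp [hn] at e0
    simp [e0] at hlt ht
    rw [min_eq_right (by omega)] at hst hso hco
    refine (copyPoints_spec (by simp) (by simp) (by simp) (by simp) (by simp)).imp ?_
    rintro s₂ t₂ hf₂ ⟨hcopy, ht₂⟩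
    rw [e0] at hcopy ht₂
    have hpt : ∀ i < n, s₂.pt i = s₁.out i := fun i hi => by
      simp [State.pt, State.out, hcopy i hi]
    simp
    refine ⟨?_, ⟨fun p hp => ?_, fun t ht => ?_⟩, by omega⟩
    · intro a' i j ha' hi hij hj hjn
      rw [hpt i (by omega), hpt j hjn]
      exact hst a' i j ha' hi hij hj hjn
    · rw [hpt p hp]
      exact hso p hp
    · obtain ⟨p, hp, hle⟩ := hco t ht
      exact ⟨p, hp, by rwa [hpt p hp]⟩

/-- Turn the points of the working arrays into staircases of length `2 ^ w`, where `w` is in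
variable `3`. -/
def buildStairs : Program :=
  block [.setNat 2 (.const 1), forLoop 7 3 (block [mergePass, .setNat 2 (.add (.var 2) (.var 2))])]

theorem mergePass_natVars :
    mergePass.natVars = [8, 12, 13, 10, 11, 9, 10, 11, 10, 11, 9, 8, 14, 14] := rfl

theorem buildStairs_spec {P : Set (ℝ × ℝ)} {s : State} {w : ℕ} (hw : s.nvar 3 = w)
    (hs : Carries P (s.nvar 0) s.pt) :
    buildStairs.wp s fun s' t => Ready P w s' ∧ t ≤ w * (300 * s.nvar 0 + 150) + 50 := by
  obtain ⟨n, hn⟩ : ∃ n, s.nvar 0 = n := ⟨_, rfl⟩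
  rw [hn] at hs ⊢
  simp only [buildStairs, wp_block_cons, wp_setNat, NatExpr.eval]
  refine (wp_forLoop (fun j s' => Carries P n s'.pt ∧ Stair (2 ^ j) n s'.pt ∧ s'.nvar 2 = 2 ^ j)
    (300 * n + 120) (by simp) (by simp [block, Program.natVars, mergePass_natVars])
    (by simp [block, Program.natVars, mergePass_natVars]) ?_ ?_).imp ?_
  · simp
    refine ⟨hs, fun a i j _ hi hij hj _ => ?_⟩
    rw [show i = j by omega]
    exact .refl _
  · rintro j s₁ hf hj h3 hlt ⟨hC, hS, h2⟩
    have e0 := hf.nvar 0 (by simp [forLoop, block, Program.natVars, mergePass_natVars])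
    simp [hn] at e0
    simp only [wp_block_cons]
    refine (mergePass_spec (by positivity) h2 (by rwa [e0])).imp ?_
    rintro s₂ t₂ hf₂ ⟨hS₂, hE, ht₂⟩
    have e2 := hf₂.nvar 2 (by simp [mergePass_natVars])
    rw [e0] at hS₂ hE ht₂
    have hpow : 2 ^ j + 2 ^ j = 2 ^ (j + 1) := by ring
    simp only [wp_setNat, wp_block_nil, NatExpr.eval, e2, h2, hpow]
    refine ⟨⟨?_, ?_, by simp⟩, by simp; omega⟩
    · exact hC.equi hE
    · exact hpow ▸ hS₂
  · rintro s₁ t hf ⟨⟨hC, hS, h2⟩, ht⟩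
    have e0 := hf.nvar 0 (by simp [forLoop, block, Program.natVars, mergePass_natVars])
    simp [hn] at e0
    simp [hw] at hS h2 ht ⊢
    refine ⟨⟨h2, e0.symm ▸ hC, e0.symm ▸ hS⟩, ?_⟩
    have : w * (300 * n + 120 + 20) ≤ w * (300 * n + 150) := Nat.mul_le_mul_left _ (by omega)
    omega

end RealRAM

namespace RealRAM

open RepSkyline

/-! ### The greedy decision procedure -/

/-- The squared distance between the points `(a, b)` and `(c, d)`. -/
def sqDistExpr (a b c d : RealExpr) : RealExpr :=
  .add (.mul (.sub a c) (.sub a c)) (.mul (.sub b d) (.sub b d))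

@[simp] theorem sqDistExpr_eval (s : State) (a b c d : RealExpr) :
    (sqDistExpr a b c d).eval s = sqDist (a.eval s, b.eval s) (c.eval s, d.eval s) := by
  simp [sqDistExpr, sqDist, sq]

@[simp] theorem sqDistExpr_cost (a b c d : RealExpr) :
    (sqDistExpr a b c d).cost = 2 * (a.cost + b.cost + c.cost + d.cost) + 7 := by
  simp [sqDistExpr]
  omega

/-- Is the point with the number in variable `18` `Near` the point in the variables `11`, `12`? -/
def near : Test :=
  .or (.realLe (.get 2 (.var 18)) (.var 11))
    (.realLe (sqDistExpr (.var 11) (.var 12) (.get 2 (.var 18)) (.get 3 (.var 18))) (.var 13))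

theorem near_holds (s : State) : near.Holds s ↔
    Near (s.rvar 11, s.rvar 12) (s.rvar 13) (s.pt (s.nvar 18)) := by
  simp [near, Near, State.pt]

theorem cut_near_spec {P : Set (ℝ × ℝ)} {w : ℕ} {s : State} (hs : Ready P w s) {l : ℝ × ℝ}
    (hl : l ∈ Sky P) (h₁ : s.rvar 11 = l.1) (h₂ : s.rvar 12 = l.2) :
    (cut near).wp s fun s' t =>
      IsCut P (Near l (s.rvar 13)) (s'.rvar 7, s'.rvar 8) (s'.rvar 5, s'.rvar 6)
        (s'.nvar 22 ≠ 0) ∧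
      t ≤ 1600 * ((s.nvar 0 / 2 ^ w + 1) * (w + 1)) := by
  refine cut_spec hs _ (Near.leftwardOn hl _) ⟨l, hl, .inl le_rfl⟩ (by simp [near]) ?_
  intro s' hf
  have e11 := hf.rvar 11 (by simp [search_realVars])
  have e12 := hf.rvar 12 (by simp [search_realVars])
  have e13 := hf.rvar 13 (by simp [search_realVars])
  have a2 := hf.rarr 2 (by simp [search_realArrs])
  have a3 := hf.rarr 3 (by simp [search_realArrs])
  rw [near_holds, e11, e12, e13, h₁, h₂]
  simp [State.pt, a2, a3]

/-- Cover the skyline from the left to the right by balls whose squared radius is in the real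
variable `13`. The number of centers goes to variable `23`, the centers to the arrays `0` and `1`,
and variable `24` is zero at the end if the whole skyline is covered. -/
def greedy : Program :=
  block [.setNat 23 (.const 0), .setNat 24 (.const 1), .setReal 11 (.var 9), .setReal 12 (.var 10),
    .while (.and (.natLe (.const 1) (.var 24)) (.natLe (.add (.var 23) (.const 1)) (.var 1)))
      (block [cut near, .setReal 11 (.var 7), .setReal 12 (.var 8),
        .storeReal 0 (.var 23) (.var 7), .storeReal 1 (.var 23) (.var 8),
        .setNat 23 (.add (.var 23) (.const 1)),
        cut near, .setNat 24 (.var 22), .setReal 11 (.var 5), .setReal 12 (.var 6)])]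

/-- The chosen points. -/
def State.center (s : State) (i : ℕ) : ℝ × ℝ := (s.rarr 0 i, s.rarr 1 i)

@[simp] theorem State.setN_center (s : State) (x m : ℕ) : (s.setN x m).center = s.center := rfl

/-- The variables `9`, `10` hold the first point of the skyline. -/
structure HasFirst (P : Set (ℝ × ℝ)) (s : State) : Prop where
  mem : (s.rvar 9, s.rvar 10) ∈ Sky P
  le : ∀ p ∈ Sky P, s.rvar 9 ≤ p.1

theorem HasFirst.congr {P : Set (ℝ × ℝ)} {s s' : State} (h : HasFirst P s)
    (h9 : s'.rvar 9 = s.rvar 9) (h10 : s'.rvar 10 = s.rvar 10) : HasFirst P s' :=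
  ⟨by rw [h9, h10]; exact h.mem, by rw [h9]; exact h.le⟩

theorem cut_near_natVars : (cut near).natVars =
    [19, 20, 15, 21, 16, 17, 18, 16, 17, 19, 20, 15, 19, 20, 15, 21, 16, 17, 18, 16, 17, 19, 20, 15,
    22, 19, 20, 15, 21, 16, 17, 18, 16, 17, 19, 20, 15, 19, 20, 15, 21, 16, 17, 18, 16, 17, 19, 20,
    15, 19, 20, 15, 21, 16, 17, 18, 16, 17, 19, 20, 15] := rfl

/-- While the search goes on, the variables `11`, `12` hold the first uncovered skyline point,
everything before it is covered, and `NeedsBefore` certifies that the centers used so far are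
necessary. Each center takes two cuts: one to place it, one to find where its reach ends. -/
theorem greedy_spec {P : Set (ℝ × ℝ)} {w : ℕ} {s : State} (hs : Ready P w s) (hf : HasFirst P s)
    (hμ : 0 ≤ s.rvar 13) :
    greedy.wp s fun s' t =>
      s'.nvar 23 ≤ s.nvar 1 ∧ (∀ i < s'.nvar 23, s'.center i ∈ Sky P) ∧
      (s'.nvar 24 = 0 → ∀ p ∈ Sky P, ∃ i < s'.nvar 23, sqDist (s'.center i) p ≤ s.rvar 13) ∧
      (s'.nvar 24 ≠ 0 → ¬ Cov P (s.nvar 1) (s.rvar 13)) ∧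
      t ≤ s.nvar 1 * (3300 * ((s.nvar 0 / 2 ^ w + 1) * (w + 1))) + 50 := by
  obtain ⟨U, hU⟩ : ∃ U, (s.nvar 0 / 2 ^ w + 1) * (w + 1) = U := ⟨_, rfl⟩
  have hU1 : 1 ≤ U := hU ▸ Nat.succ_le_of_lt (by positivity)
  obtain ⟨k, hk⟩ : ∃ k, s.nvar 1 = k := ⟨_, rfl⟩
  obtain ⟨μ, hμe⟩ : ∃ μ, s.rvar 13 = μ := ⟨_, rfl⟩
  rw [hU, hk]
  rw [hμe] at hμ ⊢
  simp only [greedy, wp_block_cons, wp_setNat, wp_setReal, NatExpr.eval, RealExpr.eval]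
  refine (wp_while (fun s₁ => s₁.nvar 23 ≤ k ∧ (∀ i < s₁.nvar 23, s₁.center i ∈ Sky P) ∧
      (s₁.nvar 24 = 0 → ∀ p ∈ Sky P, ∃ i < s₁.nvar 23, sqDist (s₁.center i) p ≤ μ) ∧
      (s₁.nvar 24 ≠ 0 → (s₁.rvar 11, s₁.rvar 12) ∈ Sky P ∧
        NeedsBefore P μ (s₁.rvar 11, s₁.rvar 12) (s₁.nvar 23) ∧
        ∀ p ∈ Sky P, p.1 < s₁.rvar 11 → ∃ i < s₁.nvar 23, sqDist (s₁.center i) p ≤ μ))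
    (fun s₁ => (k - s₁.nvar 23) * (3300 * U)) ?_ ?_).imp ?_
  · simp [-Prod.forall]
    exact ⟨hf.mem, NeedsBefore.zero _ _ _, hf.le⟩
  · rintro s₁ hfr ⟨hck, hcen, -, hgo⟩ hlt
    have e0 := hfr.nvar 0 (by simp [block, Program.natVars, cut_near_natVars])
    have e1 := hfr.nvar 1 (by simp [block, Program.natVars, cut_near_natVars])
    have e2 := hfr.nvar 2 (by simp [block, Program.natVars, cut_near_natVars])
    have e13 := hfr.rvar 13 (by simp [block, Program.realVars, cut_realVars])
    have a2 := hfr.rarr 2 (by simp [block, Program.realArrs, cut_realArrs])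
    have a3 := hfr.rarr 3 (by simp [block, Program.realArrs, cut_realArrs])
    simp [hk, hμe] at e0 e1 e2 e13 a2 a3
    simp [e1] at hlt
    obtain ⟨hl, hneed, hcov⟩ := hgo (by omega)
    obtain ⟨m, hm⟩ : ∃ m, s₁.nvar 23 = m := ⟨_, rfl⟩
    obtain ⟨l, hle⟩ : ∃ l : ℝ × ℝ, (s₁.rvar 11, s₁.rvar 12) = l := ⟨_, rfl⟩
    rw [hle] at hl hneed
    rw [hm] at hck hcen hneed hcov hlt
    have l1 : s₁.rvar 11 = l.1 := by rw [← hle]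
    have l2 : s₁.rvar 12 = l.2 := by rw [← hle]
    have R₁ : Ready P w s₁ := hs.congr e0 e2 a2 a3
    simp only [wp_block_cons]
    refine (cut_near_spec R₁ hl l1 l2).imp ?_
    rintro s₂ t₂ hf₂ ⟨hcut, ht₂⟩
    rw [e13] at hcut
    rw [e0, hU] at ht₂
    have k0 := hf₂.nvar 0 (by simp [cut_near_natVars])
    have k2 := hf₂.nvar 2 (by simp [cut_near_natVars])
    have k23 := hf₂.nvar 23 (by simp [cut_near_natVars])
    have k13 := hf₂.rvar 13 (by simp [cut_realVars])
    have b0 := hf₂.rarr 0 (by simp [cut_realArrs])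
    have b1 := hf₂.rarr 1 (by simp [cut_realArrs])
    have b2 := hf₂.rarr 2 (by simp [cut_realArrs])
    have b3 := hf₂.rarr 3 (by simp [cut_realArrs])
    rw [e0] at k0
    rw [e2] at k2
    rw [hm] at k23
    rw [e13] at k13
    rw [a2] at b2
    rw [a3] at b3
    obtain ⟨c, hc⟩ : ∃ c : ℝ × ℝ, (s₂.rvar 7, s₂.rvar 8) = c := ⟨_, rfl⟩
    have c1 : s₂.rvar 7 = c.1 := by rw [← hc]
    have c2 : s₂.rvar 8 = c.2 := by rw [← hc]
    rw [hc] at hcut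
    simp only [wp_setReal, wp_storeReal, wp_setNat, NatExpr.eval, RealExpr.eval,
      State.setR_rvar, State.setR_nvar, State.setA_nvar, State.setA_rvar, k23, c1, c2]
    simp [-Prod.forall]
    have R₂ : Ready P w (((((s₂.setR 11 c.1).setR 12 c.2).setA 0 m c.1).setA 1 m c.2).setN 23
        (m + 1)) := by
      refine hs.congr (by simp [k0]) (by simp [k2]) ?_ ?_
      · funext i; simp [b2]
      · funext i; simp [b3]
    refine (cut_near_spec R₂ hcut.c_mem (by simp) (by simp)).imp ?_
    rintro s₃ t₃ hf₃ ⟨hcut', ht₃⟩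
    have j0 := hf₃.rarr 0 (by simp [cut_realArrs])
    have j1 := hf₃.rarr 1 (by simp [cut_realArrs])
    have j23 := hf₃.nvar 23 (by simp [cut_near_natVars])
    simp [k13] at hcut' j23
    simp [k0, hU] at ht₃
    have hcen₃ : ∀ i, s₃.center i = if i = m then c else s₁.center i := fun i => by
      by_cases him : i = m <;> simp [State.center, j0, j1, b0, b1, him]
    simp only [j23]
    have hcen' : ∀ i < m + 1, s₃.center i ∈ Sky P := fun i hi => by
      rw [hcen₃]
      split_ifs with him
      · exact hcut.c_mem
      · exact hcen i (by omega)
    have hcov' : ∀ p ∈ Sky P, Near c μ p → ∃ i < m + 1, sqDist (s₃.center i) p ≤ μ := by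
      intro p hp hpc
      by_cases hpl : p.1 < s₁.rvar 11
      · obtain ⟨i, hi, h⟩ := hcov p hp hpl
        exact ⟨i, by omega, by simpa [hcen₃, hi.ne] using h⟩
      · exact ⟨m, by omega, by
          simpa [hcen₃] using hcut.covers hμ hl hp (l1 ▸ not_lt.1 hpl) hpc⟩
    have hkm : k - m = (k - (m + 1)) + 1 := by omega
    simp only [hm, hkm, add_one_mul]
    refine ⟨⟨by omega, hcen', fun h0 p hp => hcov' p hp ?_, fun h0 => ⟨hcut'.r_mem h0, ?_, ?_⟩⟩,
      by omega⟩
    · exact hcut'.all (by simpa using h0) p hp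
    · exact hneed.succ hl hcut hcut' h0
    · intro p hp hpr
      refine hcov' p hp ?_
      by_contra hnot
      exact absurd ((hcut'.r_iff h0 p hp).1 hnot) (not_le.2 hpr)
  · rintro s₁ t hfr ⟨⟨hck, hcen, hall, hgo⟩, hlt, ht⟩
    have e1 := hfr.nvar 1 (by simp [block, Program.natVars, cut_near_natVars])
    simp [hk] at e1
    simp [-Prod.forall, e1] at hlt ht ⊢
    refine ⟨hck, hcen, hall, fun h0 => ?_, by omega⟩
    obtain ⟨h1, h2, -⟩ := hgo h0
    have : s₁.nvar 23 = k := by omega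
    exact (this ▸ h2).not_cov h1

end RealRAM

namespace RepSkyline

/-! ### Farthest-point insertion along the skyline -/

/-- A part of the skyline from `L` to `R`, with its farthest point `C` from `L` and `R`. -/
structure Gap where
  /-- the left end -/
  L : ℝ × ℝ
  /-- the right end -/
  R : ℝ × ℝ
  /-- the farthest point -/
  C : ℝ × ℝ
  /-- the squared distance from `C` to the closer end -/
  V : ℝ

/-- The data of the gap `g` are right. -/
structure Gap.Valid (P : Set (ℝ × ℝ)) (g : Gap) : Prop where
  L_mem : g.L ∈ Sky P
  R_mem : g.R ∈ Sky P
  C_mem : g.C ∈ Sky P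
  L_le : g.L.1 ≤ g.C.1
  le_R : g.C.1 ≤ g.R.1
  V_eq : g.V = min (sqDist g.L g.C) (sqDist g.R g.C)
  le_V : ∀ p ∈ Sky P, g.L.1 ≤ p.1 → p.1 ≤ g.R.1 → min (sqDist g.L p) (sqDist g.R p) ≤ g.V

section

variable {P : Set (ℝ × ℝ)} {L R c r : ℝ × ℝ} {f : Prop}

/-- If even `R` is at least as close to `L` as to itself, the two ends coincide and the gap is a
single point. -/
theorem Gap.valid_of_not (hL : L ∈ Sky P) (hR : R ∈ Sky P) (h : IsCut P (Closer L R) c r f)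
    (hf : ¬ f) : Gap.Valid P ⟨L, R, L, 0⟩ := by
  have hLR : L = R := sqDist_eq_zero (by simpa [Closer] using h.all hf R hR)
  subst hLR
  refine ⟨hL, hL, hL, le_rfl, le_rfl, by simp, fun p hp h1 h2 => ?_⟩
  obtain rfl := Sky.ext_fst hL hp (le_antisymm h1 h2)
  simp

theorem IsCut.closer_bounds (hL : L ∈ Sky P) (hR : R ∈ Sky P)
    (h : IsCut P (Closer L R) c r f) (hf : f) : L.1 ≤ c.1 ∧ r.1 ≤ R.1 := by
  refine ⟨(h.c_iff L hL).1 (by simp [Closer, sqDist_nonneg]), (h.r_iff hf R hR).1 fun hR => ?_⟩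
  have hLR : L = R := sqDist_eq_zero (by simpa [Closer] using hR)
  exact h.r_not hf (by simp [hLR, Closer])

/-- On the part closer to `L` the distance to `L` grows up to `c`; on the other part the distance to
`R` falls from `r` on. So the farthest point of a gap is one of the two skyline points next to the
bisector. -/
theorem IsCut.gap_bound (hL : L ∈ Sky P) (hR : R ∈ Sky P) (h : IsCut P (Closer L R) c r f)
    (hf : f) {p : ℝ × ℝ} (hp : p ∈ Sky P) (h1 : L.1 ≤ p.1) (h2 : p.1 ≤ R.1) :
    min (sqDist L p) (sqDist R p) ≤ max (sqDist L c) (sqDist R r) := by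
  by_cases hb : Closer L R p
  · refine (min_le_left _ _).trans (le_trans ?_ (le_max_left _ _))
    exact sqDist_le_left (Sky.before hL hp h1) (Sky.before hp h.c_mem ((h.c_iff p hp).1 hb))
  · refine (min_le_right _ _).trans (le_trans ?_ (le_max_right _ _))
    rw [sqDist_comm R p, sqDist_comm R r]
    exact sqDist_le_right (Sky.before (h.r_mem hf) hp ((h.r_iff hf p hp).1 hb))
      (Sky.before hp hR h2)

theorem Gap.valid_left (hL : L ∈ Sky P) (hR : R ∈ Sky P) (h : IsCut P (Closer L R) c r f)
    (hf : f) (hle : sqDist R r < sqDist L c) : Gap.Valid P ⟨L, R, c, sqDist L c⟩ := by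
  obtain ⟨h1, h2⟩ := h.closer_bounds hL hR hf
  refine ⟨hL, hR, h.c_mem, h1, (h.lt hf).le.trans h2, (min_eq_left h.c_holds).symm,
    fun p hp hp1 hp2 => ?_⟩
  exact (h.gap_bound hL hR hf hp hp1 hp2).trans_eq (max_eq_left hle.le)

theorem Gap.valid_right (hL : L ∈ Sky P) (hR : R ∈ Sky P) (h : IsCut P (Closer L R) c r f)
    (hf : f) (hle : sqDist L c ≤ sqDist R r) : Gap.Valid P ⟨L, R, r, sqDist R r⟩ := by
  obtain ⟨h1, h2⟩ := h.closer_bounds hL hR hf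
  refine ⟨hL, hR, h.r_mem hf, h1.trans (h.lt hf).le, h2,
    (min_eq_right (not_le.1 (h.r_not hf)).le).symm, fun p hp hp1 hp2 => ?_⟩
  exact (h.gap_bound hL hR hf hp hp1 hp2).trans_eq (max_eq_right hle)

end

/-- The state of farthest-point insertion with `m` gaps, where the last point was inserted at the
squared distance `δ`. -/
structure Inserted (P : Set (ℝ × ℝ)) (m : ℕ) (G : ℕ → Gap) (δ : ℝ) : Prop where
  valid : ∀ g < m, (G g).Valid P
  le : ∀ g < m, (G g).V ≤ δ
  cover : ∀ p ∈ Sky P, ∃ g < m, (G g).L.1 ≤ p.1 ∧ p.1 ≤ (G g).R.1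
  disj : ∀ g < m, ∀ h < m, g ≠ h → (G g).R.1 ≤ (G h).L.1 ∨ (G h).R.1 ≤ (G g).L.1
  ends : ∃ W : Finset (ℝ × ℝ), ↑W ⊆ Sky P ∧ W.card ≤ m + 1 ∧ (0 < δ → W.card = m + 1) ∧
    (∀ u ∈ W, ∀ v ∈ W, u ≠ v → δ ≤ sqDist u v) ∧ (∀ g < m, (G g).L ∈ W ∧ (G g).R ∈ W) ∧
    ∀ u ∈ W, ∀ g < m, u.1 ≤ (G g).L.1 ∨ (G g).R.1 ≤ u.1
  cov : Cov P m δ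

/-- For `δ > 0` there are `m + 1` skyline points at pairwise squared distance at least `δ`, and two
of them share a center. For `δ ≤ 0` the inserted points may coincide, but then the bound is trivial.
-/
theorem Inserted.le_four_mul {P : Set (ℝ × ℝ)} {m : ℕ} {G : ℕ → Gap} {δ μ : ℝ}
    (h : Inserted P m G δ) (hP : (Sky P).Nonempty) (hμ : Cov P m μ) : δ ≤ 4 * μ := by
  obtain hδ | hδ := le_or_gt δ 0
  · linarith [hμ.nonneg hP]
  · obtain ⟨W, hW, -, hcard, hd, -⟩ := h.ends
    exact hμ.le_four_mul hW (by rw [hcard hδ]; omega) hd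

theorem Inserted.start {P : Set (ℝ × ℝ)} {G : ℕ → Gap} (h : (G 0).Valid P)
    (hL : ∀ p ∈ Sky P, (G 0).L.1 ≤ p.1) (hR : ∀ p ∈ Sky P, p.1 ≤ (G 0).R.1) :
    Inserted P 1 G (sqDist (G 0).L (G 0).R) := by
  have hLR : ∀ p ∈ Sky P, sqDist (G 0).L p ≤ sqDist (G 0).L (G 0).R := fun p hp =>
    sqDist_le_left (Sky.before h.L_mem hp (hL p hp)) (Sky.before hp h.R_mem (hR p hp))
  refine ⟨fun g hg => ?_, fun g hg => ?_, fun p hp => ⟨0, by simp, hL p hp, hR p hp⟩,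
    fun g hg g' hg' hne => by omega, ⟨{(G 0).L, (G 0).R}, ?_, Finset.card_le_two, fun hδ => ?_,
    fun u hu v hv huv => ?_, fun g hg => ?_, fun u hu g hg => ?_⟩,
    ⟨{(G 0).L}, by simpa using h.L_mem, by simp, fun p hp => ⟨_, by simp, hLR p hp⟩⟩⟩
  · rwa [Nat.lt_one_iff.1 hg]
  · rw [Nat.lt_one_iff.1 hg, h.V_eq]
    exact (min_le_left _ _).trans (hLR _ h.C_mem)
  · intro u hu
    simp only [Finset.coe_insert, Finset.coe_singleton, Set.mem_insert_iff,
      Set.mem_singleton_iff] at hu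
    obtain rfl | rfl := hu
    exacts [h.L_mem, h.R_mem]
  · refine Finset.card_pair fun he => ?_
    simp [he] at hδ
  · simp only [Finset.mem_insert, Finset.mem_singleton] at hu hv
    obtain rfl | rfl := hu <;> obtain rfl | rfl := hv
    · exact absurd rfl huv
    · exact le_rfl
    · exact (sqDist_comm _ _).le
    · exact absurd rfl huv
  · simp [Nat.lt_one_iff.1 hg]
  · simp only [Finset.mem_insert, Finset.mem_singleton] at hu
    rw [Nat.lt_one_iff.1 hg]
    obtain rfl | rfl := hu <;> simp

/-- Replacing the right end `R` by the nearer `C` can only decrease the distance of the points left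
of `C` to the closer end. -/
theorem Gap.Valid.left_le {P : Set (ℝ × ℝ)} {g g' : Gap} (h : g.Valid P) (h' : g'.Valid P)
    (hL : g'.L = g.L) (hR : g'.R = g.C) : g'.V ≤ g.V := by
  have h1 := h'.L_le
  have h2 := h'.le_R
  rw [hL] at h1
  rw [hR] at h2
  refine le_trans ?_ (h.le_V g'.C h'.C_mem h1 (h2.trans h.le_R))
  rw [h'.V_eq, hL, hR, sqDist_comm g.C, sqDist_comm g.R]
  exact min_le_min le_rfl (sqDist_le_left (Sky.before h'.C_mem h.C_mem h2)
    (Sky.before h.C_mem h.R_mem h.le_R))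

theorem Gap.Valid.right_le {P : Set (ℝ × ℝ)} {g g' : Gap} (h : g.Valid P) (h' : g'.Valid P)
    (hL : g'.L = g.C) (hR : g'.R = g.R) : g'.V ≤ g.V := by
  have h1 := h'.L_le
  have h2 := h'.le_R
  rw [hL] at h1
  rw [hR] at h2
  refine le_trans ?_ (h.le_V g'.C h'.C_mem (h.L_le.trans h1) h2)
  rw [h'.V_eq, hL, hR]
  exact min_le_min (sqDist_le_right (Sky.before h.L_mem h.C_mem h.L_le)
    (Sky.before h.C_mem h'.C_mem h1)) le_rfl

/-- No inserted point lies strictly inside the gap `b`, so each is at least as far from its farthest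
point `C` as one of the two ends: adding `C` keeps pairwise squared distances at least `(G b).V`.
The points inserted before `C`, at most `m + 1` of them, cover the skyline within the same value
because `b` was a worst gap. -/
theorem Inserted.split {P : Set (ℝ × ℝ)} {m : ℕ} {G G' : ℕ → Gap} {δ : ℝ}
    (h : Inserted P m G δ) {b : ℕ} (hb : b < m) (hmax : ∀ g < m, (G g).V ≤ (G b).V)
    (hG : ∀ g < m, g ≠ b → G' g = G g) (hb' : (G' b).Valid P) (hm' : (G' m).Valid P)
    (hbL : (G' b).L = (G b).L) (hbR : (G' b).R = (G b).C) (hmL : (G' m).L = (G b).C)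
    (hmR : (G' m).R = (G b).R) : Inserted P (m + 1) G' (G b).V := by
  have hv := h.valid b hb
  have cases : ∀ {g}, g < m + 1 → g = b ∨ g = m ∨ (g < m ∧ g ≠ b) := by omega
  obtain ⟨W, hW, hc1, hc2, hd, hends, hint⟩ := h.ends
  have hCd : ∀ u ∈ W, (G b).V ≤ sqDist u (G b).C := fun u hu => by
    rw [hv.V_eq]
    obtain hu' | hu' := hint u hu b hb
    · exact (min_le_left _ _).trans (sqDist_le_right (Sky.before (hW hu) hv.L_mem hu')
        (Sky.before hv.L_mem hv.C_mem hv.L_le))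
    · refine (min_le_right _ _).trans ?_
      rw [sqDist_comm _ (G b).C, sqDist_comm _ (G b).C]
      exact sqDist_le_left (Sky.before hv.C_mem hv.R_mem hv.le_R)
        (Sky.before hv.R_mem (hW hu) hu')
  refine ⟨fun g hg => ?_, fun g hg => ?_, fun p hp => ?_, fun g hg g' hg' hne => ?_,
    ⟨insert (G b).C W, ?_, ?_, fun hδ => ?_, fun u hu v hv' huv => ?_, fun g hg => ?_,
      fun u hu g hg => ?_⟩, ⟨W, hW, hc1, fun p hp => ?_⟩⟩
  · obtain rfl | rfl | ⟨hg, hgb⟩ := cases hg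
    · exact hb'
    · exact hm'
    · exact hG g hg hgb ▸ h.valid g hg
  · obtain rfl | rfl | ⟨hg, hgb⟩ := cases hg
    · exact hv.left_le hb' hbL hbR
    · exact hv.right_le hm' hmL hmR
    · exact hG g hg hgb ▸ hmax g hg
  · obtain ⟨g, hg, h1, h2⟩ := h.cover p hp
    by_cases hgb : g = b
    · subst hgb
      obtain hpc | hpc := le_total p.1 (G g).C.1
      · exact ⟨g, by omega, by rwa [hbL], by rwa [hbR]⟩
      · exact ⟨m, by omega, by rwa [hmL], by rwa [hmR]⟩
    · exact ⟨g, by omega, by rwa [hG g hg hgb], by rwa [hG g hg hgb]⟩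
  · have hCL := hv.L_le
    have hCR := hv.le_R
    obtain rfl | rfl | ⟨hg, hgb⟩ := cases hg <;> obtain rfl | rfl | ⟨hg', hgb'⟩ := cases hg'
    · exact absurd rfl hne
    · exact .inl (by rw [hbR, hmL])
    · rw [hbR, hbL, hG g' hg' hgb']
      exact (h.disj g hb g' hg' hne).imp hCR.trans id
    · exact .inr (by rw [hbR, hmL])
    · exact absurd rfl hne
    · rw [hmR, hmL, hG g' hg' hgb']
      exact (h.disj b hb g' hg' hgb'.symm).imp id (·.trans hCL)
    · rw [hbR, hbL, hG g hg hgb]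
      exact (h.disj g hg g' hb hne).imp id hCR.trans
    · rw [hmR, hmL, hG g hg hgb]
      exact (h.disj g hg b hb hgb).imp (·.trans hCL) id
    · rw [hG g hg hgb, hG g' hg' hgb']
      exact h.disj g hg g' hg' hne
  · rw [Finset.coe_insert]
    exact Set.insert_subset hv.C_mem hW
  · exact (Finset.card_insert_le _ _).trans (by omega)
  -- A positive distance of `C` to all earlier points makes `C` a new point.
  · rw [Finset.card_insert_of_notMem, hc2 (hδ.trans_le (h.le b hb))]
    intro hC
    have := hCd _ hC
    rw [sqDist_self] at this
    exact absurd hδ (not_lt.2 this)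
  · obtain rfl | hu := Finset.mem_insert.1 hu <;> obtain rfl | hv' := Finset.mem_insert.1 hv'
    · exact absurd rfl huv
    · exact sqDist_comm _ v ▸ hCd v hv'
    · exact hCd u hu
    · exact (h.le b hb).trans (hd u hu v hv' huv)
  · obtain rfl | rfl | ⟨hg, hgb⟩ := cases hg
    · rw [hbL, hbR]
      exact ⟨Finset.mem_insert_of_mem (hends g hb).1, Finset.mem_insert_self _ _⟩
    · rw [hmL, hmR]
      exact ⟨Finset.mem_insert_self _ _, Finset.mem_insert_of_mem (hends b hb).2⟩
    · rw [hG g hg hgb]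
      exact ⟨Finset.mem_insert_of_mem (hends g hg).1, Finset.mem_insert_of_mem (hends g hg).2⟩
  · obtain rfl | rfl | ⟨hg, hgb⟩ := cases hg
    · rw [hbL, hbR]
      obtain rfl | hu := Finset.mem_insert.1 hu
      · exact .inr le_rfl
      · exact (hint u hu g hb).imp id hv.le_R.trans
    · rw [hmL, hmR]
      obtain rfl | hu := Finset.mem_insert.1 hu
      · exact .inl le_rfl
      · exact (hint u hu b hb).imp (·.trans hv.L_le) id
    · rw [hG g hg hgb]
      obtain rfl | hu := Finset.mem_insert.1 hu
      · exact (h.disj b hb g hg hgb.symm).imp hv.le_R.trans (·.trans hv.L_le)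
      · exact hint u hu g hg
  · obtain ⟨g, hg, h1, h2⟩ := h.cover p hp
    obtain hle | hle := min_le_iff.1 (((h.valid g hg).le_V p hp h1 h2).trans (hmax g hg))
    · exact ⟨_, (hends g hg).1, hle⟩
    · exact ⟨_, (hends g hg).2, hle⟩

end RepSkyline

/-! ### Programs for the first skyline point and for farthest-point insertion -/

namespace RealRAM

open RepSkyline

/-- Put the first point of the skyline into the variables `9`, `10`. -/
def findFirst : Program :=
  block [search (.natLe (.const 1) (.const 0)), .setReal 10 (.var 3),
    search (.realLe (.var 10) (.get 3 (.var 18))), .setReal 9 (.var 2)]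

/-- The first skyline point is the highest one. A constantly false predicate makes the search return
the overall largest ordinate, and a second search finds the largest abscissa at that height. -/
theorem findFirst_spec {P : Set (ℝ × ℝ)} {w : ℕ} {s : State} (hs : Ready P w s)
    (hP : (Sky P).Nonempty) :
    findFirst.wp s fun s' t =>
      HasFirst P s' ∧ t ≤ 700 * ((s.nvar 0 / 2 ^ w + 1) * (w + 1)) := by
  obtain ⟨U, hU⟩ : ∃ U, (s.nvar 0 / 2 ^ w + 1) * (w + 1) = U := ⟨_, rfl⟩
  have hU1 : 1 ≤ U := hU ▸ Nat.succ_le_of_lt (by positivity)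
  obtain ⟨p₀, hp₀⟩ := hP
  have hc := hs.carries
  simp only [findFirst, wp_block_cons]
  refine (search_spec hs (fun _ => False) (by simp) (by simp) (by simp)).imp ?_
  rintro s₁ t₁ hf₁ ⟨-, hY, ht₁⟩
  have e0 := hf₁.nvar 0 (by simp [search_natVars])
  have e2 := hf₁.nvar 2 (by simp [search_natVars])
  have a2 := hf₁.rarr 2 (by simp [search_realArrs])
  have a3 := hf₁.rarr 3 (by simp [search_realArrs])
  have h20 : s₁.nvar 20 ≠ 0 := fun h0 => by
    obtain ⟨i, hi, -⟩ := hc.mem p₀ hp₀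
    exact hY.none h0 i hi id
  obtain ⟨p, hp, hpy⟩ : ∃ p ∈ Sky P, p.2 = s₁.rvar 3 := by
    obtain ⟨i, hi, -, hy⟩ := hY.some h20
    obtain ⟨p, hp, hle⟩ := hc.le i hi
    obtain ⟨j, hj, rfl⟩ := hc.mem p hp
    exact ⟨_, hp, le_antisymm (hY.le h20 j hj id) (hy ▸ hle.2)⟩
  have hmax : ∀ q ∈ Sky P, q.2 ≤ p.2 := fun q hq => by
    obtain ⟨i, hi, rfl⟩ := hc.mem q hq
    exact hpy ▸ hY.le h20 i hi id
  simp only [wp_setReal, RealExpr.eval, ← hpy]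
  have R₁ : Ready P w (s₁.setR 10 p.2) := hs.congr e0 e2 a2 a3
  refine (search_spec R₁ (fun i => p.2 ≤ (s.pt i).2) (by simp) ?_ ?_).imp ?_
  · intro s' hf' _
    have e10 := hf'.rvar 10 (by simp [search_realVars])
    have b3 := hf'.rarr 3 (by simp [search_realArrs])
    simp at e10 b3
    simp [e10, b3, a3, State.pt]
  · intro i j _ _ hij hj
    have hpt : (s₁.setR 10 p.2).pt = s.pt := by funext i; simp [State.pt, a2, a3]
    rw [hpt] at hij
    exact hj.trans hij.2
  rintro s₂ t₂ hf₂ ⟨hX, -, ht₂⟩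
  have e10 := hf₂.rvar 10 (by simp [search_realVars])
  have hpt : (s₁.setR 10 p.2).pt = s.pt := by funext i; simp [State.pt, a2, a3]
  have hn : (s₁.setR 10 p.2).nvar 0 = s.nvar 0 := e0
  rw [hpt, hn] at hX
  rw [hn] at ht₂
  simp at e10
  have h19 : s₂.nvar 19 ≠ 0 := fun h0 => by
    obtain ⟨i, hi, rfl⟩ := hc.mem p hp
    exact hX.none h0 i hi le_rfl
  have hx := hc.fst_eq hp (hX.some h19) (hX.le h19)
  simp only [wp_block_nil, hx]
  rw [hU] at ht₁ ht₂ ⊢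
  refine ⟨⟨by simpa [e10] using hp, fun q hq => ?_⟩, by simp; omega⟩
  simp
  by_contra! hlt
  exact absurd (Sky.snd_lt hq hp hlt) (not_lt.2 (hmax q hq))

/-- Is the point with the number in variable `18` at least as close to the point in the variables
`14`, `15` as to the point in the variables `16`, `17`? -/
def closer : Test :=
  .realLe (sqDistExpr (.var 14) (.var 15) (.get 2 (.var 18)) (.get 3 (.var 18)))
    (sqDistExpr (.var 16) (.var 17) (.get 2 (.var 18)) (.get 3 (.var 18)))

/-- The gap with the number `g`. -/
def State.gap (s : State) (g : ℕ) : Gap :=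
  ⟨(s.rarr 6 g, s.rarr 7 g), (s.rarr 8 g, s.rarr 9 g), (s.rarr 10 g, s.rarr 11 g), s.rarr 12 g⟩

/-- Compute the gap with the ends in the variables `14`–`17`, and store it with the number in
variable `28`. -/
def computeGap : Program :=
  block [cut closer,
    .ite (.natLe (.var 22) (.const 0))
      (block [.setReal 18 (.var 14), .setReal 19 (.var 15), .setReal 20 (.const 0)])
      (block [.setReal 20 (sqDistExpr (.var 14) (.var 15) (.var 7) (.var 8)),
        .setReal 23 (sqDistExpr (.var 16) (.var 17) (.var 5) (.var 6)),
        .ite (.realLe (.var 20) (.var 23))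
          (block [.setReal 18 (.var 5), .setReal 19 (.var 6), .setReal 20 (.var 23)])
          (block [.setReal 18 (.var 7), .setReal 19 (.var 8)])]),
    .storeReal 6 (.var 28) (.var 14), .storeReal 7 (.var 28) (.var 15),
    .storeReal 8 (.var 28) (.var 16), .storeReal 9 (.var 28) (.var 17),
    .storeReal 10 (.var 28) (.var 18), .storeReal 11 (.var 28) (.var 19),
    .storeReal 12 (.var 28) (.var 20)]

theorem computeGap_natVars : computeGap.natVars = (cut near).natVars := rfl

theorem computeGap_realVars : computeGap.realVars =
    [2, 3, 4, 2, 3, 6, 7, 2, 3, 7, 2, 3, 5, 2, 3, 8, 18, 19, 20, 20, 23, 18, 19, 20, 18, 19] := rfl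

theorem computeGap_realArrs : computeGap.realArrs = [6, 7, 8, 9, 10, 11, 12] := rfl

theorem computeGap_spec {P : Set (ℝ × ℝ)} {w : ℕ} {s : State} (hs : Ready P w s) {L R : ℝ × ℝ}
    (hL : L ∈ Sky P) (hR : R ∈ Sky P) (hLR : L.1 ≤ R.1) (h14 : s.rvar 14 = L.1)
    (h15 : s.rvar 15 = L.2) (h16 : s.rvar 16 = R.1) (h17 : s.rvar 17 = R.2) :
    computeGap.wp s fun s' t =>
      (s'.gap (s.nvar 28)).Valid P ∧ (s'.gap (s.nvar 28)).L = L ∧ (s'.gap (s.nvar 28)).R = R ∧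
      (∀ g, g ≠ s.nvar 28 → s'.gap g = s.gap g) ∧
      t ≤ 1700 * ((s.nvar 0 / 2 ^ w + 1) * (w + 1)) := by
  obtain ⟨U, hU⟩ : ∃ U, (s.nvar 0 / 2 ^ w + 1) * (w + 1) = U := ⟨_, rfl⟩
  have hU1 : 1 ≤ U := hU ▸ Nat.succ_le_of_lt (by positivity)
  simp only [computeGap, wp_block_cons]
  refine (cut_spec hs (Closer L R) (Closer.leftwardOn P (Sky.before hL hR hLR))
    ⟨L, hL, by simp [Closer, sqDist_nonneg]⟩ (by simp [closer]) ?_).imp ?_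
  · intro s' hf
    have e14 := hf.rvar 14 (by simp [search_realVars])
    have e15 := hf.rvar 15 (by simp [search_realVars])
    have e16 := hf.rvar 16 (by simp [search_realVars])
    have e17 := hf.rvar 17 (by simp [search_realVars])
    have a2 := hf.rarr 2 (by simp [search_realArrs])
    have a3 := hf.rarr 3 (by simp [search_realArrs])
    simp [closer, Closer, e14, e15, e16, e17, h14, h15, h16, h17, a2, a3, State.pt]
  rintro s₁ t₁ hf₁ ⟨hcut, ht₁⟩
  have e14 := hf₁.rvar 14 (by simp [cut_realVars])
  have e15 := hf₁.rvar 15 (by simp [cut_realVars])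
  have e16 := hf₁.rvar 16 (by simp [cut_realVars])
  have e17 := hf₁.rvar 17 (by simp [cut_realVars])
  have e28 := hf₁.nvar 28 (by simp [cut_natVars, search_natVars])
  have ha := fun a => hf₁.rarr a (by simp [cut_realArrs])
  rw [h14] at e14
  rw [h15] at e15
  rw [h16] at e16
  rw [h17] at e17
  obtain ⟨i, hi⟩ : ∃ i, s.nvar 28 = i := ⟨_, rfl⟩
  rw [hi] at e28 ⊢
  rw [hU] at ht₁ ⊢
  obtain ⟨c, hc⟩ : ∃ c : ℝ × ℝ, (s₁.rvar 7, s₁.rvar 8) = c := ⟨_, rfl⟩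
  have c1 : s₁.rvar 7 = c.1 := by rw [← hc]
  have c2 : s₁.rvar 8 = c.2 := by rw [← hc]
  obtain ⟨r, hr⟩ : ∃ r : ℝ × ℝ, (s₁.rvar 5, s₁.rvar 6) = r := ⟨_, rfl⟩
  have r1 : s₁.rvar 5 = r.1 := by rw [← hr]
  have r2 : s₁.rvar 6 = r.2 := by rw [← hr]
  rw [hc, hr] at hcut
  simp [e14, e15, e16, e17, e28, c1, c2, r1, r2]
  refine ⟨fun h0 => ?_, fun h0 => ⟨fun hle => ?_, fun hle => ?_⟩⟩
  · simp [State.gap]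
    refine ⟨Gap.valid_of_not hL hR hcut (by simpa using h0), ?_, by omega⟩
    intro g hg
    simp [hg, ha]
  · simp [State.gap]
    refine ⟨Gap.valid_right hL hR hcut h0 hle, ?_, by omega⟩
    intro g hg
    simp [hg, ha]
  · simp [State.gap]
    refine ⟨Gap.valid_left hL hR hcut h0 hle, ?_, by omega⟩
    intro g hg
    simp [hg, ha]

end RealRAM

namespace RealRAM

open RepSkyline

/-- Put the number of a gap with the largest value into variable `27`. -/
def argmaxGap : Program :=
  block [.setNat 27 (.const 0),
    forLoop 26 25 (.ite (.realLe (.get 12 (.var 27)) (.get 12 (.var 26)))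
      (.setNat 27 (.var 26)) .skip)]

theorem argmaxGap_natVars : argmaxGap.natVars = [27, 26, 27, 26] := rfl

theorem argmaxGap_realArrs : argmaxGap.realArrs = [] := rfl

theorem argmaxGap_spec {s : State} (hm : 0 < s.nvar 25) :
    argmaxGap.wp s fun s' t =>
      s'.nvar 27 < s.nvar 25 ∧ (∀ g < s.nvar 25, (s.gap g).V ≤ (s.gap (s'.nvar 27)).V) ∧
      t ≤ s.nvar 25 * 40 + 40 := by
  simp only [argmaxGap, wp_block_cons, wp_setNat, NatExpr.eval]
  refine (wp_forLoop (fun j s' => s'.nvar 27 < s.nvar 25 ∧ ∀ g < j, s.rarr 12 g ≤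
    s.rarr 12 (s'.nvar 27)) 10 (by simp) (by simp [Program.natVars]) (by simp [Program.natVars])
    (by simpa using hm) ?_).imp ?_
  · rintro j s₁ hf hj hm hlt ⟨hI, hI'⟩
    have a12 := hf.rarr 12 (by simp [forLoop, block, Program.realArrs])
    simp at hlt a12
    simp [hj, a12]
    refine ⟨fun h => ⟨hlt, fun g hg => ?_⟩, fun h => ⟨hI, fun g hg => ?_⟩⟩
    · obtain hg | rfl := hg.lt_or_eq
      · exact (hI' g hg).trans h
      · exact le_rfl
    · obtain hg | rfl := hg.lt_or_eq
      · exact hI' g hg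
      · exact h.le
  · rintro s' t - ⟨⟨h1, h2⟩, ht⟩
    simp at h2 ht
    simp
    exact ⟨h1, fun g hg => h2 g hg, by omega⟩

/-- Choose points of the skyline by farthest-point insertion. The squared distance at which the
last point is inserted goes to the real variable `21`. -/
def insertFarthest : Program :=
  block [.setReal 14 (.var 9), .setReal 15 (.var 10),
    cut (.natLe (.const 0) (.const 0)), .setReal 16 (.var 7), .setReal 17 (.var 8),
    .setReal 21 (sqDistExpr (.var 14) (.var 15) (.var 16) (.var 17)),
    .setNat 28 (.const 0), computeGap, .setNat 25 (.const 1),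
    .while (.natLe (.add (.var 25) (.const 1)) (.var 1)) (block [
      argmaxGap, .setReal 21 (.get 12 (.var 27)),
      .setReal 14 (.get 10 (.var 27)), .setReal 15 (.get 11 (.var 27)),
      .setReal 16 (.get 8 (.var 27)), .setReal 17 (.get 9 (.var 27)),
      .setNat 28 (.var 25), computeGap,
      .setReal 14 (.get 6 (.var 27)), .setReal 15 (.get 7 (.var 27)),
      .setReal 16 (.get 10 (.var 27)), .setReal 17 (.get 11 (.var 27)),
      .setNat 28 (.var 27), computeGap,
      .setNat 25 (.add (.var 25) (.const 1))])]

/-- Each of the fewer than `k` rounds scans at most `k` gaps for the largest value and recomputes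
two of them, with one cut each. Starting from the two extreme points and one gap, the loop ends with
`k` gaps, so with `k + 1` inserted points. -/
theorem insertFarthest_spec {P : Set (ℝ × ℝ)} {w : ℕ} {s : State} (hs : Ready P w s)
    (hf : HasFirst P s) (hk : 1 ≤ s.nvar 1) :
    insertFarthest.wp s fun s' t =>
      (∃ G, Inserted P (s.nvar 1) G (s'.rvar 21)) ∧
      t ≤ s.nvar 1 * (40 * s.nvar 1 + 3600 * ((s.nvar 0 / 2 ^ w + 1) * (w + 1))) +
        3600 * ((s.nvar 0 / 2 ^ w + 1) * (w + 1)) := by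
  obtain ⟨U, hU⟩ : ∃ U, (s.nvar 0 / 2 ^ w + 1) * (w + 1) = U := ⟨_, rfl⟩
  have hU1 : 1 ≤ U := hU ▸ Nat.succ_le_of_lt (by positivity)
  obtain ⟨k, hk'⟩ : ∃ k, s.nvar 1 = k := ⟨_, rfl⟩
  rw [hk'] at hk ⊢
  rw [hU]
  obtain ⟨L, hLe⟩ : ∃ L : ℝ × ℝ, (s.rvar 9, s.rvar 10) = L := ⟨_, rfl⟩
  have L1 : s.rvar 9 = L.1 := by rw [← hLe]
  have L2 : s.rvar 10 = L.2 := by rw [← hLe]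
  have hL := hf.mem
  have hLmin := hf.le
  rw [hLe] at hL
  rw [L1] at hLmin
  simp only [insertFarthest, wp_block_cons, wp_setReal, RealExpr.eval, L1, L2, State.setR_rvar]
  -- Cutting at the constantly true predicate returns the last skyline point.
  refine (cut_spec (w := w) (P := P) (hs.congr (by simp) (by simp) (by simp) (by simp))
    (fun _ => True) (fun _ _ _ _ _ _ => trivial) ⟨L, hL, trivial⟩ (by simp) (by simp)).imp ?_
  rintro s₁ t₁ hf₁ ⟨hcut, ht₁⟩
  obtain ⟨R, hRe⟩ : ∃ R : ℝ × ℝ, (s₁.rvar 7, s₁.rvar 8) = R := ⟨_, rfl⟩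
  have R1 : s₁.rvar 7 = R.1 := by rw [← hRe]
  have R2 : s₁.rvar 8 = R.2 := by rw [← hRe]
  rw [hRe] at hcut
  have hR := hcut.c_mem
  have hRmax : ∀ p ∈ Sky P, p.1 ≤ R.1 := fun p hp => (hcut.c_iff p hp).1 trivial
  have e0 := hf₁.nvar 0 (by simp [cut_natVars, search_natVars])
  have e1 := hf₁.nvar 1 (by simp [cut_natVars, search_natVars])
  have e2 := hf₁.nvar 2 (by simp [cut_natVars, search_natVars])
  have e14 := hf₁.rvar 14 (by simp [cut_realVars])
  have e15 := hf₁.rvar 15 (by simp [cut_realVars])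
  have a2 := hf₁.rarr 2 (by simp [cut_realArrs])
  have a3 := hf₁.rarr 3 (by simp [cut_realArrs])
  simp [hk'] at e0 e1 e2 e14 e15 a2 a3 ht₁
  rw [hU] at ht₁
  simp only [wp_setNat, sqDistExpr_eval, NatExpr.eval, RealExpr.eval, State.setR_rvar, R1, R2, e14,
    e15]
  refine (computeGap_spec (P := P) (w := w) (L := L) (R := R)
    (hs.congr (by simp [e0]) (by simp [e2]) (by simp [a2]) (by simp [a3]))
    hL hR (hLmin R hR) (by simp [e14]) (by simp [e15]) (by simp) (by simp)).imp ?_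
  rintro s₂ t₂ hf₂ ⟨hval, hgL, hgR, -, ht₂⟩
  have k0 := hf₂.nvar 0 (by simp [computeGap_natVars, cut_near_natVars])
  have k1 := hf₂.nvar 1 (by simp [computeGap_natVars, cut_near_natVars])
  have k2 := hf₂.nvar 2 (by simp [computeGap_natVars, cut_near_natVars])
  have k21 := hf₂.rvar 21 (by simp [computeGap_realVars])
  have b2 := hf₂.rarr 2 (by simp [computeGap_realArrs])
  have b3 := hf₂.rarr 3 (by simp [computeGap_realArrs])
  simp [e0, e1, e2, a2, a3] at hval hgL hgR k0 k1 k2 k21 b2 b3 ht₂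
  rw [hU] at ht₂
  have hstart : Inserted P 1 s₂.gap (sqDist L R) := by
    have := Inserted.start hval (by rwa [hgL]) (by rwa [hgR])
    rwa [hgL, hgR] at this
  refine (wp_while (fun s' => 1 ≤ s'.nvar 25 ∧ s'.nvar 25 ≤ k ∧
      Inserted P (s'.nvar 25) s'.gap (s'.rvar 21))
    (fun s' => (k - s'.nvar 25) * (40 * k + 3600 * U)) ?_ ?_).imp ?_
  · simp [k21]
    exact ⟨hk, hstart⟩
  · rintro s₃ hf₃ ⟨hm1, hmk, hins⟩ hlt
    have j0 := hf₃.nvar 0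
      (by simp [block, Program.natVars, computeGap_natVars, cut_near_natVars, argmaxGap_natVars])
    have j1 := hf₃.nvar 1
      (by simp [block, Program.natVars, computeGap_natVars, cut_near_natVars, argmaxGap_natVars])
    have j2 := hf₃.nvar 2
      (by simp [block, Program.natVars, computeGap_natVars, cut_near_natVars, argmaxGap_natVars])
    have c2 := hf₃.rarr 2
      (by simp [block, Program.realArrs, computeGap_realArrs, argmaxGap_realArrs])
    have c3 := hf₃.rarr 3
      (by simp [block, Program.realArrs, computeGap_realArrs, argmaxGap_realArrs])
    simp [k0, k1, k2, b2, b3] at j0 j1 j2 c2 c3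
    simp [j1] at hlt
    obtain ⟨m, hm⟩ : ∃ m, s₃.nvar 25 = m := ⟨_, rfl⟩
    rw [hm] at hm1 hmk hins hlt
    simp only [wp_block_cons]
    refine (argmaxGap_spec (by omega)).imp ?_
    rintro s₄ t₄ hf₄ ⟨hbm, hbmax, ht₄⟩
    obtain ⟨b, hb⟩ : ∃ b, s₄.nvar 27 = b := ⟨_, rfl⟩
    rw [hm, hb] at hbm hbmax
    rw [hm] at ht₄
    have l0 := hf₄.nvar 0 (by simp [argmaxGap_natVars])
    have l2 := hf₄.nvar 2 (by simp [argmaxGap_natVars])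
    have l25 := hf₄.nvar 25 (by simp [argmaxGap_natVars])
    have d := fun a => hf₄.rarr a (by simp [argmaxGap_realArrs])
    rw [j0] at l0
    rw [j2] at l2
    rw [hm] at l25
    have hv := hins.valid b hbm
    simp only [wp_setReal, wp_setNat, RealExpr.eval, NatExpr.eval, State.setR_nvar,
      State.setR_rarr, hb, l25, d]
    refine (computeGap_spec (P := P) (w := w) (L := (s₃.gap b).C) (R := (s₃.gap b).R)
      (hs.congr (by simp [l0]) (by simp [l2]) (by simp [d, c2]) (by simp [d, c3]))
      hv.C_mem hv.R_mem hv.le_R (by simp [State.gap]) (by simp [State.gap]) (by simp [State.gap])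
      (by simp [State.gap])).imp ?_
    rintro s₅ t₅ hf₅ ⟨hval₅, hL₅, hR₅, hoth₅, ht₅⟩
    have m0 := hf₅.nvar 0 (by simp [computeGap_natVars, cut_near_natVars])
    have m2 := hf₅.nvar 2 (by simp [computeGap_natVars, cut_near_natVars])
    have m25 := hf₅.nvar 25 (by simp [computeGap_natVars, cut_near_natVars])
    have m27 := hf₅.nvar 27 (by simp [computeGap_natVars, cut_near_natVars])
    have m21 := hf₅.rvar 21 (by simp [computeGap_realVars])
    have f2 := hf₅.rarr 2 (by simp [computeGap_realArrs])
    have f3 := hf₅.rarr 3 (by simp [computeGap_realArrs])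
    simp [l0, l2, l25, hb, d, c2, c3] at hval₅ hL₅ hR₅ hoth₅ m0 m2 m25 m27 m21 f2 f3 ht₅
    replace hoth₅ : ∀ g, g ≠ m → s₅.gap g = s₃.gap g := fun g hg =>
      (hoth₅ g hg).trans (by simp [State.gap, d])
    -- The right half was stored under the new number `m`, so the gap `b` is intact and still
    -- supplies the ends of the left half.
    have hgb : s₅.gap b = s₃.gap b := hoth₅ b (by omega)
    have hv' : (s₅.gap b).Valid P := hgb ▸ hv
    simp only [m27]
    refine (computeGap_spec (P := P) (w := w) (L := (s₅.gap b).L) (R := (s₅.gap b).C)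
      (hs.congr (by simp [m0]) (by simp [m2]) (by simp [f2]) (by simp [f3]))
      hv'.L_mem hv'.C_mem hv'.L_le (by simp [State.gap]) (by simp [State.gap])
      (by simp [State.gap]) (by simp [State.gap])).imp ?_
    rintro s₆ t₆ hf₆ ⟨hval₆, hL₆, hR₆, hoth₆, ht₆⟩
    have n25 := hf₆.nvar 25 (by simp [computeGap_natVars, cut_near_natVars])
    have n21 := hf₆.rvar 21 (by simp [computeGap_realVars])
    simp [m0, m25, m21] at hval₆ hL₆ hR₆ hoth₆ n25 n21 ht₆
    replace hoth₆ : ∀ g, g ≠ b → s₆.gap g = s₅.gap g := fun g hg => hoth₆ g hg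
    have hgm : s₆.gap m = s₅.gap m := hoth₆ m (by omega)
    have hsplit : Inserted P (m + 1) s₆.gap (s₃.gap b).V :=
      hins.split hbm hbmax (fun g hg hgb => (hoth₆ g hgb).trans (hoth₅ g (by omega))) hval₆
        (hgm ▸ hval₅) (by rw [hL₆, hgb]) (by rw [hR₆, hgb]) (by rw [hgm, hL₅]) (by rw [hgm, hR₅])
    rw [hU] at ht₅ ht₆
    simp [n25, n21, hm]
    refine ⟨⟨by omega, hsplit⟩, ?_⟩
    have hkm : k - m = (k - (m + 1)) + 1 := by omega
    rw [hkm, add_one_mul (k - (m + 1))]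
    omega
  · rintro s₃ t₃ hf₃ ⟨⟨hm1, hmk, hins⟩, hlt, ht₃⟩
    have j1 := hf₃.nvar 1
      (by simp [block, Program.natVars, computeGap_natVars, cut_near_natVars, argmaxGap_natVars])
    simp [k1] at j1
    simp [j1] at hlt ht₃
    have : s₃.nvar 25 = k := by omega
    simp
    refine ⟨⟨_, this ▸ hins⟩, ?_⟩
    have : (k - 1) * (40 * k + 3600 * U) ≤ k * (40 * k + 3600 * U) :=
      Nat.mul_le_mul_right _ (by omega)
    omega

/-! ### Bisection of the squared radius -/

/-- Bisection for the optimum, which is between a quarter of the real variable `21` and that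
variable. The result goes to the real variable `13`. -/
def bisectRadius : Program :=
  block [.setReal 27 (.var 21), .setReal 26 (.mul (.var 21) (.const (1 / 4))),
    .setNat 30 (.add (.var 5) (.const 2)),
    forLoop 29 30 (block [.setReal 13 (.mul (.add (.var 26) (.var 27)) (.const (1 / 2))), greedy,
      .ite (.natLe (.var 24) (.const 0)) (.setReal 27 (.var 13)) (.setReal 26 (.var 13))]),
    .setReal 13 (.var 27)]

theorem greedy_natVars : greedy.natVars =
    23 :: 24 :: ((cut near).natVars ++ 23 :: ((cut near).natVars ++ [24])) := by
  simp [greedy, block, Program.natVars]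

theorem greedy_realVars : greedy.realVars =
    11 :: 12 :: ((cut near).realVars ++ 11 :: 12 :: ((cut near).realVars ++ [11, 12])) := by
  simp [greedy, block, Program.realVars]

theorem greedy_realArrs : greedy.realArrs = [0, 1] := rfl

theorem greedy_cov {P : Set (ℝ × ℝ)} {k m : ℕ} {μ : ℝ} {c : ℕ → ℝ × ℝ} (hm : m ≤ k)
    (hc : ∀ i < m, c i ∈ Sky P) (h : ∀ p ∈ Sky P, ∃ i < m, sqDist (c i) p ≤ μ) : Cov P k μ := by
  classical
  refine ⟨(Finset.range m).image c, ?_, Finset.card_image_le.trans (by simpa using hm), ?_⟩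
  · intro q hq
    obtain ⟨i, hi, rfl⟩ := Finset.mem_image.1 (Finset.mem_coe.1 hq)
    exact hc i (Finset.mem_range.1 hi)
  · intro p hp
    obtain ⟨i, hi, h⟩ := h p hp
    exact ⟨c i, Finset.mem_image_of_mem _ (Finset.mem_range.2 hi), h⟩

/-- The upper end always admits a cover and the lower end is always a lower bound. After `K + 2`
halvings, `K` being the value of variable `5`, the width is at most `δ / (4 * 2 ^ K) ≤ ε * (δ / 4)`,
and `δ / 4` is at most the lower end. -/
theorem bisectRadius_spec {P : Set (ℝ × ℝ)} {w : ℕ} {s : State} {ε : ℝ} (hs : Ready P w s)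
    (hf : HasFirst P s) (hcov : Cov P (s.nvar 1) (s.rvar 21))
    (hlow : ∀ μ, Cov P (s.nvar 1) μ → s.rvar 21 ≤ 4 * μ) (hε : (1 / 2 : ℝ) ^ s.nvar 5 ≤ ε) :
    bisectRadius.wp s fun s' t =>
      Cov P (s.nvar 1) (s'.rvar 13) ∧
      (∀ μ, Cov P (s.nvar 1) μ → s'.rvar 13 ≤ (1 + ε) * μ) ∧
      t ≤ (s.nvar 5 + 2) *
        (s.nvar 1 * (3300 * ((s.nvar 0 / 2 ^ w + 1) * (w + 1))) + 120) + 50 := by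
  obtain ⟨T, hT⟩ : ∃ T, s.nvar 1 * (3300 * ((s.nvar 0 / 2 ^ w + 1) * (w + 1))) = T := ⟨_, rfl⟩
  obtain ⟨k, hk⟩ : ∃ k, s.nvar 1 = k := ⟨_, rfl⟩
  obtain ⟨δ, hδ⟩ : ∃ δ, s.rvar 21 = δ := ⟨_, rfl⟩
  rw [hT]
  rw [hk] at hcov hlow ⊢
  rw [hδ] at hcov hlow
  have hδ0 : 0 ≤ δ := hcov.nonneg ⟨_, hf.mem⟩
  simp only [bisectRadius, wp_block_cons, wp_setReal, wp_setNat, NatExpr.eval, RealExpr.eval,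
    State.setR_rvar, State.setR_nvar]
  refine (wp_forLoop (fun j s' => δ / 4 ≤ s'.rvar 26 ∧ Cov P k (s'.rvar 27) ∧
    (∀ μ, Cov P k μ → s'.rvar 26 ≤ μ) ∧ (s'.rvar 27 - s'.rvar 26) * 2 ^ j ≤ δ)
    (T + 80) (by simp) ?_ ?_ ?_ ?_).imp ?_
  · simp [block, Program.natVars, greedy_natVars, cut_near_natVars]
  · simp [block, Program.natVars, greedy_natVars, cut_near_natVars]
  · simp [hδ]
    refine ⟨by linarith, hcov, fun μ hμ => by linarith [hlow μ hμ], by linarith⟩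
  · rintro j s₁ hf₁ hj hN hlt ⟨h1, h2, h3, h4⟩
    have e0 := hf₁.nvar 0
      (by simp [forLoop, block, Program.natVars, greedy_natVars, cut_near_natVars])
    have e1 := hf₁.nvar 1
      (by simp [forLoop, block, Program.natVars, greedy_natVars, cut_near_natVars])
    have e2 := hf₁.nvar 2
      (by simp [forLoop, block, Program.natVars, greedy_natVars, cut_near_natVars])
    have e9 := hf₁.rvar 9
      (by simp [forLoop, block, Program.realVars, greedy_realVars, cut_realVars])
    have e10 := hf₁.rvar 10
      (by simp [forLoop, block, Program.realVars, greedy_realVars, cut_realVars])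
    have a2 := hf₁.rarr 2 (by simp [forLoop, block, Program.realArrs, greedy_realArrs])
    have a3 := hf₁.rarr 3 (by simp [forLoop, block, Program.realArrs, greedy_realArrs])
    simp [hk] at e0 e1 e2 e9 e10 a2 a3
    obtain ⟨x, hx⟩ : ∃ x, (s₁.rvar 26 + s₁.rvar 27) * ((1 / 2 : ℚ) : ℝ) = x := ⟨_, rfl⟩
    have hx' : x = (s₁.rvar 26 + s₁.rvar 27) / 2 := by rw [← hx]; push_cast; ring
    have hle : s₁.rvar 26 ≤ s₁.rvar 27 := h3 _ h2
    simp only [wp_block_cons, wp_setReal, RealExpr.eval, hx]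
    refine (greedy_spec (P := P) (w := w)
      (hs.congr (by simp [e0]) (by simp [e2]) (by simp [a2]) (by simp [a3]))
      (hf.congr (by simp [e9]) (by simp [e10])) (by simp; linarith)).imp ?_
    rintro s₂ t₂ hf₂ ⟨hm, hc, hyes, hno, ht₂⟩
    have k13 := hf₂.rvar 13 (by simp [greedy_realVars, cut_realVars])
    have k26 := hf₂.rvar 26 (by simp [greedy_realVars, cut_realVars])
    have k27 := hf₂.rvar 27 (by simp [greedy_realVars, cut_realVars])
    simp [-Prod.forall, e1] at hm hc hyes hno k13 k26 k27
    simp [e0, e1] at ht₂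
    rw [← hk, hT] at ht₂
    simp [k13, k26, k27]
    refine ⟨fun h0 => ⟨⟨h1, greedy_cov hm hc (hyes h0), h3, ?_⟩, by omega⟩,
      fun h0 => ⟨⟨by linarith, h2, fun μ hμ => ?_, ?_⟩, by omega⟩⟩
    · rw [pow_succ, hx']
      linarith
    -- A cover within some `μ` below the midpoint would also be a cover within the midpoint, which
    -- the greedy run has refuted.
    · by_contra! hlt
      obtain ⟨Q, hQ, hQk, hcv⟩ := hμ
      refine hno h0 ⟨Q, hQ, hQk, fun p hp => ?_⟩
      obtain ⟨q, hq, h⟩ := hcv p hp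
      exact ⟨q, hq, h.trans hlt.le⟩
    · rw [pow_succ, hx']
      linarith
  · rintro s₁ t₁ hf₁ ⟨⟨h1, h2, h3, h4⟩, ht₁⟩
    simp at h4 ht₁
    simp
    refine ⟨h2, fun μ hμ => ?_, ?_⟩
    · have hlo := h3 μ hμ
      have hε0 : 0 ≤ ε := le_trans (by positivity) hε
      have h5 : 1 ≤ ε * 2 ^ s.nvar 5 := by
        have := mul_le_mul_of_nonneg_right hε (show (0 : ℝ) ≤ 2 ^ s.nvar 5 by positivity)
        rwa [← mul_pow, show (1 / 2 * 2 : ℝ) = 1 by norm_num, one_pow] at this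
      have h6 : 0 ≤ s₁.rvar 27 - s₁.rvar 26 := sub_nonneg.2 (h3 _ h2)
      have h7 := mul_le_mul_of_nonneg_left h5 (mul_nonneg h6 (by norm_num : (0 : ℝ) ≤ 4))
      have h8 := mul_le_mul_of_nonneg_right h4 hε0
      rw [pow_add] at h8
      nlinarith
    · have : (s.nvar 5 + 2) * (T + 80 + 20) ≤ (s.nvar 5 + 2) * (T + 120) :=
        Nat.mul_le_mul_left _ (by omega)
      omega

end RealRAM

namespace RepSkyline

/-! ### The skyline as a sequence, and the dynamic program -/

/-- `S 0, …, S (h - 1)` is the skyline of `P` from the left to the right. -/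
structure Enum (P : Set (ℝ × ℝ)) (h : ℕ) (S : ℕ → ℝ × ℝ) : Prop where
  mem : ∀ i < h, S i ∈ Sky P
  lt : ∀ i j, i < j → j < h → (S i).1 < (S j).1
  surj : ∀ p ∈ Sky P, ∃ i < h, S i = p

/-- Strictly increasing abscissae make the points distinct, and each is among `n` array entries.
This bounds the number of extraction rounds. -/
theorem Carries.length_le {P : Set (ℝ × ℝ)} {n h : ℕ} {V S : ℕ → ℝ × ℝ} (hV : Carries P n V)
    (hS : ∀ i < h, S i ∈ Sky P) (hlt : ∀ i j, i < j → j < h → (S i).1 < (S j).1) : h ≤ n := by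
  have : ∀ i, ∃ j, i < h → j < n ∧ V j = S i := fun i => by
    by_cases hi : i < h
    · obtain ⟨j, hj, hji⟩ := hV.mem _ (hS i hi)
      exact ⟨j, fun _ => ⟨hj, hji⟩⟩
    · exact ⟨0, fun h => absurd h hi⟩
  choose f hf using this
  have := Finset.card_le_card_of_injOn (s := Finset.range h) (t := Finset.range n) f
    (fun i hi => by simpa using (hf i (by simpa using hi)).1) (fun i hi j hj hij => by
      have hi := Finset.mem_range.1 (Finset.mem_coe.1 hi)
      have hj := Finset.mem_range.1 (Finset.mem_coe.1 hj)
      have he : S i = S j := by rw [← (hf i hi).2, ← (hf j hj).2, hij]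
      rcases lt_trichotomy i j with h' | h' | h'
      · exact absurd (hlt i j h' hj) (by simp [he])
      · exact h'
      · exact absurd (hlt j i h' hi) (by simp [he]))
  simpa using this

theorem Enum.before {P : Set (ℝ × ℝ)} {h : ℕ} {S : ℕ → ℝ × ℝ} (hS : Enum P h S) {i j : ℕ}
    (hij : i ≤ j) (hj : j < h) : Before (S i) (S j) := by
  obtain hij | rfl := hij.lt_or_eq
  · exact Sky.before (hS.mem i (by omega)) (hS.mem j hj) (hS.lt i j hij hj).le
  · exact .refl _

theorem Enum.dist_le_left {P : Set (ℝ × ℝ)} {h : ℕ} {S : ℕ → ℝ × ℝ} (hS : Enum P h S)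
    {i j l : ℕ} (hij : i ≤ j) (hjl : j ≤ l) (hl : l < h) :
    sqDist (S i) (S j) ≤ sqDist (S i) (S l) :=
  sqDist_le_left (hS.before hij (by omega)) (hS.before hjl hl)

theorem Enum.dist_le_right {P : Set (ℝ × ℝ)} {h : ℕ} {S : ℕ → ℝ × ℝ} (hS : Enum P h S)
    {i j l : ℕ} (hij : i ≤ j) (hjl : j ≤ l) (hl : l < h) :
    sqDist (S j) (S l) ≤ sqDist (S i) (S l) :=
  sqDist_le_right (hS.before hij (by omega)) (hS.before hjl hl)

/-- `Reach S b μ m i`: unless `b ≤ μ`, the first `i` points of `S` are covered by `m` of them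
within `μ`. -/
def Reach (S : ℕ → ℝ × ℝ) (b μ : ℝ) : ℕ → ℕ → Prop
  | 0, i => i = 0 ∨ b ≤ μ
  | _ + 1, 0 => True
  | m + 1, j + 1 => ∃ c ≤ j, (∃ i ≤ c, Reach S b μ m i ∧ sqDist (S i) (S c) ≤ μ) ∧
      sqDist (S c) (S j) ≤ μ

theorem Reach.exists_finset {P : Set (ℝ × ℝ)} {h : ℕ} {S : ℕ → ℝ × ℝ} (hS : Enum P h S)
    {b μ : ℝ} (hb : μ < b) (m i : ℕ) (hi : i ≤ h) (hr : Reach S b μ m i) :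
    ∃ Q : Finset (ℝ × ℝ), ↑Q ⊆ Sky P ∧ Q.card ≤ m ∧ ∀ t < i, ∃ q ∈ Q, sqDist q (S t) ≤ μ := by
  induction m generalizing i with
  | zero =>
    obtain rfl | hle := hr
    · exact ⟨∅, by simp⟩
    · exact absurd hb (not_lt.2 hle)
  | succ m ih =>
    cases i with
    | zero => exact ⟨∅, by simp⟩
    | succ j =>
      obtain ⟨c, hcj, ⟨i, hic, hri, hd⟩, hd'⟩ := hr
      obtain ⟨Q, hQ, hcard, hcov⟩ := ih i (by omega) hri
      refine ⟨insert (S c) Q, ?_, (Finset.card_insert_le _ _).trans (by omega), fun t ht => ?_⟩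
      · rw [Finset.coe_insert]
        exact Set.insert_subset (hS.mem c (by omega)) hQ
      · by_cases hti : t < i
        · obtain ⟨q, hq, hqt⟩ := hcov t hti
          exact ⟨q, Finset.mem_insert_of_mem hq, hqt⟩
        · refine ⟨S c, Finset.mem_insert_self _ _, ?_⟩
          obtain htc | htc := le_total t c
          · rw [sqDist_comm]
            exact (hS.dist_le_right (not_lt.1 hti) htc (by omega)).trans hd
          · exact (hS.dist_le_left htc (by omega : t ≤ j) (by omega)).trans hd'

/-- The center covering the last point `S j` takes care of a contiguous range of points up to `j`.
Everything before that range is covered by the other centers, to which induction applies. -/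
theorem Reach.of_finset {P : Set (ℝ × ℝ)} {h : ℕ} {S : ℕ → ℝ × ℝ} (hS : Enum P h S)
    {b μ : ℝ} (hμ : 0 ≤ μ) (m i : ℕ) (hi : i ≤ h) (Q : Finset (ℝ × ℝ)) (hQ : ↑Q ⊆ Sky P)
    (hm : Q.card ≤ m) (hc : ∀ t < i, ∃ q ∈ Q, sqDist q (S t) ≤ μ) : Reach S b μ m i := by
  classical
  induction m generalizing i Q with
  | zero =>
    refine .inl (Nat.eq_zero_of_not_pos fun h0 => ?_)
    obtain ⟨q, hq, -⟩ := hc 0 h0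
    simp [Finset.card_eq_zero.1 (Nat.le_zero.1 hm)] at hq
  | succ m ih =>
    cases i with
    | zero => trivial
    | succ j =>
      obtain ⟨q, hq, hqj⟩ := hc j (by omega)
      obtain ⟨a, ha, rfl⟩ := hS.surj q (hQ hq)
      -- The center `S a` may lie beyond the segment. Then `S j` replaces it, which is at least as
      -- close to all points of the segment that `S a` covers.
      obtain ⟨c, hca, hcj, hd, hd'⟩ : ∃ c ≤ a, c ≤ j ∧ sqDist (S c) (S a) ≤ μ ∧
          sqDist (S c) (S j) ≤ μ := by
        obtain haj | haj := le_total a j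
        · exact ⟨a, le_rfl, haj, by simpa using hμ, hqj⟩
        · exact ⟨j, haj, le_rfl, by rwa [sqDist_comm], by simpa using hμ⟩
      -- The least index within reach of `S a`; no point before it is covered by `S a`, so that
      -- center can be erased.
      have hex : ∃ i, sqDist (S i) (S a) ≤ μ := ⟨c, hd⟩
      have hmin := Nat.find_min' hex hd
      refine ⟨c, hcj, ⟨Nat.find hex, hmin, ih _ (by omega) (Q.erase (S a)) ?_ ?_ ?_, ?_⟩, hd'⟩
      · exact (Finset.coe_subset.2 (Finset.erase_subset _ _)).trans hQ
      · rw [Finset.card_erase_of_mem hq]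
        omega
      · intro t ht
        obtain ⟨q, hq', hqt⟩ := hc t (by omega)
        refine ⟨q, Finset.mem_erase.2 ⟨?_, hq'⟩, hqt⟩
        rintro rfl
        exact Nat.find_min hex ht (by rwa [sqDist_comm])
      · exact (hS.dist_le_left hmin hca ha).trans (Nat.find_spec hex)

/-- The distance between the two extreme points serves as infinity in the table: from that radius on
a single center suffices, so the escape clause `b ≤ μ` of `Reach` does no harm. -/
theorem Enum.reach_iff_cov {P : Set (ℝ × ℝ)} {h : ℕ} {S : ℕ → ℝ × ℝ} (hS : Enum P h S)
    (hh : 0 < h) {k : ℕ} (hk : 0 < k) {μ : ℝ} (hμ : 0 ≤ μ) :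
    Reach S (sqDist (S 0) (S (h - 1))) μ k h ↔ Cov P k μ := by
  constructor
  · intro hr
    obtain hb | hb := le_or_gt (sqDist (S 0) (S (h - 1))) μ
    · refine ⟨{S 0}, by simpa using hS.mem 0 hh, by simp; omega, fun p hp => ⟨S 0, by simp, ?_⟩⟩
      obtain ⟨i, hi, rfl⟩ := hS.surj p hp
      exact (hS.dist_le_left (Nat.zero_le i) (by omega) (by omega)).trans hb
    · obtain ⟨Q, hQ, hc, hcov⟩ := hr.exists_finset hS hb _ _ le_rfl
      refine ⟨Q, hQ, hc, fun p hp => ?_⟩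
      obtain ⟨i, hi, rfl⟩ := hS.surj p hp
      exact hcov i hi
  · rintro ⟨Q, hQ, hc, hcov⟩
    exact Reach.of_finset hS hμ k h le_rfl Q hQ hc fun t ht => hcov _ (hS.mem t ht)

end RepSkyline

/-! ### Extracting the skyline by successive cuts -/

namespace RealRAM

open RepSkyline

/-- The sequence in the arrays `13` and `14`. -/
def State.seq (s : State) (i : ℕ) : ℝ × ℝ := (s.rarr 13 i, s.rarr 14 i)

/-- Is the point with the number in variable `18` not to the right of the real variable `11`? -/
def upTo : Test := .realLe (.get 2 (.var 18)) (.var 11)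

/-- Store the skyline in the arrays `13` and `14`, and its length in variable `31`. -/
def extractSky : Program :=
  block [.storeReal 13 (.const 0) (.var 9), .storeReal 14 (.const 0) (.var 10),
    .setNat 31 (.const 1), .setReal 11 (.var 9), cut upTo,
    .while (.natLe (.const 1) (.var 22)) (block [
      .storeReal 13 (.var 31) (.var 5), .storeReal 14 (.var 31) (.var 6),
      .setReal 11 (.var 5), .setNat 31 (.add (.var 31) (.const 1)), cut upTo])]

theorem cut_upTo_spec {P : Set (ℝ × ℝ)} {w : ℕ} {s : State} (hs : Ready P w s)
    (hl : ∃ l ∈ Sky P, l.1 ≤ s.rvar 11) :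
    (cut upTo).wp s fun s' t =>
      IsCut P (fun v => v.1 ≤ s.rvar 11) (s'.rvar 7, s'.rvar 8) (s'.rvar 5, s'.rvar 6)
        (s'.nvar 22 ≠ 0) ∧
      t ≤ 1600 * ((s.nvar 0 / 2 ^ w + 1) * (w + 1)) := by
  refine cut_spec hs _ (leftwardOn_fst_le P _) hl (by simp [upTo]) ?_
  intro s' hf
  have e11 := hf.rvar 11 (by simp [search_realVars])
  have a2 := hf.rarr 2 (by simp [search_realArrs])
  simp [upTo, e11, a2, State.pt]

/-- A cut at the abscissa of the last extracted point yields the next skyline point, so there is one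
cut per skyline point and at most `n` of them. -/
theorem extractSky_spec {P : Set (ℝ × ℝ)} {w : ℕ} {s : State} (hs : Ready P w s)
    (hf : HasFirst P s) :
    extractSky.wp s fun s' t =>
      Enum P (s'.nvar 31) s'.seq ∧ 0 < s'.nvar 31 ∧ s'.nvar 31 ≤ s.nvar 0 ∧
      t ≤ (s.nvar 0 + 1) * (1700 * ((s.nvar 0 / 2 ^ w + 1) * (w + 1))) := by
  obtain ⟨U, hU⟩ : ∃ U, (s.nvar 0 / 2 ^ w + 1) * (w + 1) = U := ⟨_, rfl⟩
  have hU1 : 1 ≤ U := hU ▸ Nat.succ_le_of_lt (by positivity)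
  obtain ⟨n, hn⟩ : ∃ n, s.nvar 0 = n := ⟨_, rfl⟩
  rw [hU, hn]
  have hc := hs.carries
  rw [hn] at hc
  simp only [extractSky, wp_block_cons, wp_setReal, wp_setNat, wp_storeReal, NatExpr.eval,
    RealExpr.eval, State.setN_rvar, State.setA_rvar]
  refine (cut_upTo_spec (P := P) (w := w)
    (hs.congr (by simp) (by simp) (by funext; simp) (by funext; simp))
    ⟨_, hf.mem, by simp⟩).imp ?_
  rintro s₁ t₁ hf₁ ⟨hcut, ht₁⟩
  have e0 := hf₁.nvar 0 (by simp [cut_natVars, search_natVars])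
  have e2 := hf₁.nvar 2 (by simp [cut_natVars, search_natVars])
  have e31 := hf₁.nvar 31 (by simp [cut_natVars, search_natVars])
  have e11 := hf₁.rvar 11 (by simp [cut_realVars])
  have ha := fun a => hf₁.rarr a (by simp [cut_realArrs])
  have a2 : s₁.rarr 2 = s.rarr 2 := by rw [ha]; funext; simp
  have a3 : s₁.rarr 3 = s.rarr 3 := by rw [ha]; funext; simp
  simp [hn] at e0 e2 e31 e11 hcut ht₁
  rw [← hn, hU] at ht₁
  have hseq0 : s₁.seq 0 = (s.rvar 9, s.rvar 10) := by simp [State.seq, ha]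
  refine (wp_while (fun s' => 0 < s'.nvar 31 ∧ (∀ i < s'.nvar 31, s'.seq i ∈ Sky P) ∧
      (∀ i j, i < j → j < s'.nvar 31 → (s'.seq i).1 < (s'.seq j).1) ∧
      s'.rvar 11 = (s'.seq (s'.nvar 31 - 1)).1 ∧
      (∀ p ∈ Sky P, p.1 ≤ s'.rvar 11 → ∃ i < s'.nvar 31, s'.seq i = p) ∧
      ∃ c, IsCut P (fun v => v.1 ≤ s'.rvar 11) c (s'.rvar 5, s'.rvar 6) (s'.nvar 22 ≠ 0))
    (fun s' => (n - s'.nvar 31) * (1700 * U)) ?_ ?_).imp ?_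
  · rw [e31, e11]
    refine ⟨by simp, fun i hi => ?_, fun i j hij hj => by omega, by simp [hseq0],
      fun p hp hp9 => ⟨0, by simp, ?_⟩, _, by simpa using hcut⟩
    · rw [Nat.lt_one_iff.1 hi, hseq0]
      exact hf.mem
    · rw [hseq0]
      exact Sky.ext_fst hf.mem hp (le_antisymm (hf.le p hp) hp9)
  · rintro s₂ hf₂ ⟨hh, hmem, hlt, h11, hsurj, c, hcut₂⟩ htest
    have k0 := hf₂.nvar 0 (by simp [block, Program.natVars, cut_natVars, search_natVars])
    have k2 := hf₂.nvar 2 (by simp [block, Program.natVars, cut_natVars, search_natVars])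
    have b2 := hf₂.rarr 2 (by simp [block, Program.realArrs, cut_realArrs])
    have b3 := hf₂.rarr 3 (by simp [block, Program.realArrs, cut_realArrs])
    rw [e0] at k0
    rw [e2] at k2
    rw [a2] at b2
    rw [a3] at b3
    have hfound : s₂.nvar 22 ≠ 0 := by simp at htest; omega
    obtain ⟨h, hhe⟩ : ∃ h, s₂.nvar 31 = h := ⟨_, rfl⟩
    rw [hhe] at hh hmem hlt h11 hsurj
    obtain ⟨r, hre⟩ : ∃ r : ℝ × ℝ, (s₂.rvar 5, s₂.rvar 6) = r := ⟨_, rfl⟩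
    have r1 : s₂.rvar 5 = r.1 := by rw [← hre]
    have r2 : s₂.rvar 6 = r.2 := by rw [← hre]
    rw [hre] at hcut₂
    have hr := hcut₂.r_mem hfound
    have hrx : s₂.rvar 11 < r.1 := not_le.1 (hcut₂.r_not hfound)
    simp only [wp_block_cons, wp_setReal, wp_setNat, wp_storeReal, NatExpr.eval, RealExpr.eval,
      State.setA_rvar, State.setA_nvar, State.setR_nvar, hhe, r1, r2]
    refine (cut_upTo_spec (P := P) (w := w)
      (hs.congr (by simp [hn, k0]) (by simp [k2]) (by funext; simp [b2]) (by funext; simp [b3]))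
      ⟨r, hr, by simp⟩).imp ?_
    rintro s₃ t₃ hf₃ ⟨hcut₃, ht₃⟩
    have j31 := hf₃.nvar 31 (by simp [cut_natVars, search_natVars])
    have j11 := hf₃.rvar 11 (by simp [cut_realVars])
    have hb := fun a => hf₃.rarr a (by simp [cut_realArrs])
    simp [k0] at j31 j11 hcut₃ ht₃
    rw [← hn, hU] at ht₃
    have hseq : ∀ i, s₃.seq i = if i = h then r else s₂.seq i := fun i => by
      by_cases hi : i = h <;> simp [State.seq, hb, hi]
    have hmem' : ∀ i < h + 1, s₃.seq i ∈ Sky P := fun i hi => by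
      rw [hseq]
      split_ifs with hih
      exacts [hr, hmem i (by omega)]
    have hlt' : ∀ i j, i < j → j < h + 1 → (s₃.seq i).1 < (s₃.seq j).1 := fun i j hij hj => by
      rw [hseq, hseq, if_neg (by omega)]
      split_ifs with hjh
      · refine lt_of_le_of_lt ?_ hrx
        rw [h11]
        obtain hi | hi := (show i ≤ h - 1 by omega).lt_or_eq
        · exact (hlt i (h - 1) hi (by omega)).le
        · rw [hi]
      · exact hlt i j hij (by omega)
    have hhn := hc.length_le hmem' hlt'
    simp only [wp_block_nil, j31, j11]
    refine ⟨⟨by omega, hmem', hlt', by simp [hseq], fun p hp hpr => ?_, _, by simpa using hcut₃⟩,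
      ?_⟩
    · by_cases hp11 : p.1 ≤ s₂.rvar 11
      · obtain ⟨i, hi, hip⟩ := hsurj p hp hp11
        exact ⟨i, by omega, by rw [hseq, if_neg hi.ne, hip]⟩
      · refine ⟨h, by omega, ?_⟩
        rw [hseq, if_pos rfl]
        exact Sky.ext_fst hr hp (le_antisymm ((hcut₂.r_iff hfound p hp).1 hp11) hpr)
    · have : n - h = (n - (h + 1)) + 1 := by omega
      rw [this, add_one_mul (n - (h + 1))]
      simp
      omega
  · rintro s₂ t₂ hf₂ ⟨⟨hh, hmem, hlt, h11, hsurj, c, hcut₂⟩, htest, ht₂⟩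
    have hfound : s₂.nvar 22 = 0 := by simp at htest; omega
    simp [e31] at ht₂
    simp only [wp_block_nil]
    refine ⟨⟨hmem, hlt, fun p hp => hsurj p hp (hcut₂.all (by simpa using hfound) p hp)⟩, hh,
      hc.length_le hmem hlt, ?_⟩
    have : (n - 1) * (1700 * U) ≤ n * (1700 * U) := Nat.mul_le_mul_right _ (by omega)
    rw [add_one_mul n]
    simp
    omega

end RealRAM

/-! ### The dynamic program, in linear time per center -/

namespace RepSkyline

/-- An optimal index `c` for `j` also serves `i` if `c ≤ i`; otherwise `i` itself does, at distance
zero and with `G i ≤ G c`. Monotonicity is what allows the next relaxation to use a moving pointer.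
-/
theorem Enum.mono_of_relax {P : Set (ℝ × ℝ)} {h : ℕ} {S : ℕ → ℝ × ℝ} (hS : Enum P h S)
    {G F : ℕ → ℝ} (hG : ∀ i j, i ≤ j → j < h → G i ≤ G j)
    (hF : ∀ j < h, ∀ μ, F j ≤ μ ↔ ∃ i ≤ j, G i ≤ μ ∧ sqDist (S i) (S j) ≤ μ) :
    ∀ i j, i ≤ j → j < h → F i ≤ F j := by
  intro i j hij hj
  obtain ⟨c, hc, hGc, hd⟩ := (hF j hj _).1 le_rfl
  refine (hF i (by omega) _).2 ?_
  obtain hci | hci := le_total c i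
  · exact ⟨c, hci, hGc, (hS.dist_le_left hci hij hj).trans hd⟩
  · exact ⟨i, le_rfl, (hG i c hci (by omega)).trans hGc, by
      simpa using (sqDist_nonneg _ _).trans hd⟩

end RepSkyline

namespace RealRAM

open RepSkyline

/-- The squared distance between the skyline points with the numbers in the variables `34`, `33`. -/
def pairDist : RealExpr :=
  sqDistExpr (.get 13 (.var 34)) (.get 14 (.var 34)) (.get 13 (.var 33)) (.get 14 (.var 33))

theorem pairDist_eval (s : State) :
    pairDist.eval s = sqDist (s.seq (s.nvar 34)) (s.seq (s.nvar 33)) := by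
  simp [pairDist, State.seq]

theorem pairDist_cost : pairDist.cost = 23 := by
  simp [pairDist]

/-- For every skyline point `j`, the smallest maximum of the entry `i` of the array `a` and the
squared distance between the points `i` and `j`, for `i ≤ j`; it goes to the entry `j + off` of the
array `b`. -/
def relax (a b off : ℕ) : Program :=
  block [.setNat 34 (.const 0), .setNat 33 (.const 0),
    .while (.natLe (.add (.var 33) (.const 1)) (.var 31))
      (.ite (.and (.natLe (.add (.var 34) (.const 1)) (.var 33))
          (.realLe (.get a (.add (.var 34) (.const 1))) pairDist))
        (.setNat 34 (.add (.var 34) (.const 1)))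
        (block [.ite (.realLe (.get a (.var 34)) pairDist)
            (.storeReal b (.add (.var 33) (.const off)) pairDist)
            (.storeReal b (.add (.var 33) (.const off)) (.get a (.var 34))),
          .setNat 33 (.add (.var 33) (.const 1))]))]

theorem relax_natVars (a b off : ℕ) : (relax a b off).natVars = [34, 33, 34, 33] := rfl

theorem relax_realArrs (a b off : ℕ) : (relax a b off).realArrs = [b, b] := rfl

/-- Entries of `a` increase with `i`, while the distance from `i` to `j` falls with `i` and grows
with `j`. The best `i` is where the two cross, and it only moves right as `j` grows. Two pointers
therefore find all minima in `O(h)` steps. -/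
theorem relax_spec {P : Set (ℝ × ℝ)} {a b off : ℕ} {s : State}
    (hab : a ≠ b) (hb3 : b ≠ 13) (hb4 : b ≠ 14) (hS : Enum P (s.nvar 31) s.seq)
    (hG : ∀ i j, i ≤ j → j < s.nvar 31 → s.rarr a i ≤ s.rarr a j) :
    (relax a b off).wp s fun s' t =>
      (∀ j < s.nvar 31, ∀ μ, s'.rarr b (j + off) ≤ μ ↔
        ∃ i ≤ j, s.rarr a i ≤ μ ∧ sqDist (s.seq i) (s.seq j) ≤ μ) ∧
      (∀ i < off, s'.rarr b i = s.rarr b i) ∧ t ≤ 300 * s.nvar 31 + 50 := by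
  obtain ⟨h, hh⟩ : ∃ h, s.nvar 31 = h := ⟨_, rfl⟩
  rw [hh] at hS hG ⊢
  simp only [relax, wp_block_cons, wp_setNat, NatExpr.eval]
  refine (wp_while (fun s' => s'.nvar 34 ≤ s'.nvar 33 ∧ s'.nvar 33 ≤ h ∧
      (s'.nvar 33 < h → ∀ i < s'.nvar 34,
        s.rarr a (i + 1) ≤ sqDist (s.seq i) (s.seq (s'.nvar 33))) ∧
      (∀ j < s'.nvar 33, ∀ μ, s'.rarr b (j + off) ≤ μ ↔
        ∃ i ≤ j, s.rarr a i ≤ μ ∧ sqDist (s.seq i) (s.seq j) ≤ μ) ∧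
      (∀ i < off, s'.rarr b i = s.rarr b i))
    (fun s' => (2 * h - s'.nvar 34 - s'.nvar 33) * 150) (by simp) ?_).imp ?_
  · rintro s₁ hf ⟨hij, -, hlt, hF, hoff⟩ htest
    have e31 := hf.nvar 31 (by simp [block, Program.natVars])
    have aa := hf.rarr a (by simp [block, Program.realArrs, hab])
    have a13 := hf.rarr 13 (by simp [block, Program.realArrs, hb3.symm])
    have a14 := hf.rarr 14 (by simp [block, Program.realArrs, hb4.symm])
    have hseq : s₁.seq = s.seq := by funext i; simp [State.seq, a13, a14]
    simp [hh] at e31 aa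
    obtain ⟨i, hi⟩ : ∃ i, s₁.nvar 34 = i := ⟨_, rfl⟩
    obtain ⟨j, hj⟩ : ∃ j, s₁.nvar 33 = j := ⟨_, rfl⟩
    simp [e31, hj] at htest
    rw [hi, hj] at hij
    rw [hi, hj] at hlt
    rw [hj] at hF
    have hlt := hlt (by omega)
    have hd := pairDist_eval s₁
    rw [hseq, hi, hj] at hd
    simp only [wp_ite, wp_setNat, wp_block_cons, wp_storeReal, wp_block_nil, Test.Holds,
      NatExpr.eval, RealExpr.eval, hd, pairDist_cost, Test.cost, NatExpr.cost, RealExpr.cost,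
      hi, hj, aa, State.setA_nvar]
    refine ⟨fun hadv => ?_, fun hadv => ?_⟩
    · simp [hj]
      refine ⟨⟨hadv.1, by omega, fun _ i' hi' => ?_, hF, hoff⟩, by omega⟩
      obtain hi' | rfl := hi'.lt_or_eq
      · exact hlt i' hi'
      · exact hadv.2
    -- The pointer has stopped at the best index. Every smaller one loses by distance, as the
    -- pointer has passed it; every larger one loses because the entry at `i + 1` already exceeds
    -- the distance at `i`.
    · have key : ∀ μ, (s.rarr a i ≤ μ ∧ sqDist (s.seq i) (s.seq j) ≤ μ) ↔
          ∃ i ≤ j, s.rarr a i ≤ μ ∧ sqDist (s.seq i) (s.seq j) ≤ μ := by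
        refine fun μ => ⟨fun hμ => ⟨i, hij, hμ⟩, ?_⟩
        rintro ⟨c, hcj, hGc, hdc⟩
        rcases lt_trichotomy c i with hci | rfl | hci
        · refine ⟨?_, (hS.dist_le_right hci.le hij (by omega)).trans hdc⟩
          have := hlt (i - 1) (by omega)
          rw [Nat.sub_add_cancel (by omega)] at this
          exact this.trans ((hS.dist_le_right (by omega) (by omega) (by omega)).trans hdc)
        · exact ⟨hGc, hdc⟩
        · refine ⟨(hG i c hci.le (by omega)).trans hGc, ?_⟩
          have : sqDist (s.seq i) (s.seq j) < s.rarr a (i + 1) :=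
            not_le.1 fun hle => hadv ⟨by omega, hle⟩
          exact this.le.trans ((hG _ c hci (by omega)).trans hGc)
      have post : ∀ v : ℝ, (∀ μ, v ≤ μ ↔ s.rarr a i ≤ μ ∧ sqDist (s.seq i) (s.seq j) ≤ μ) →
          i ≤ j + 1 ∧ j + 1 ≤ h ∧ (j + 1 < h → ∀ i' < i,
            s.rarr a (i' + 1) ≤ sqDist (s.seq i') (s.seq (j + 1))) ∧
          (∀ j' < j + 1, ∀ μ, (s₁.setA b (j + off) v).rarr b (j' + off) ≤ μ ↔
            ∃ i ≤ j', s.rarr a i ≤ μ ∧ sqDist (s.seq i) (s.seq j') ≤ μ) ∧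
          ∀ i < off, (s₁.setA b (j + off) v).rarr b i = s.rarr b i := by
        refine fun v hv => ⟨by omega, by omega, fun hj' i' hi' => (hlt i' hi').trans
          (hS.dist_le_left (by omega) (by omega) hj'), fun j' hj' μ => ?_, fun i' hi' => ?_⟩
        · obtain hj' | rfl := (Nat.lt_succ_iff.1 hj').lt_or_eq
          · simpa [hj'.ne] using hF j' hj' μ
          · simp only [State.setA_rarr, and_self, if_true]
            rw [hv, key]
        · rw [State.setA_rarr, if_neg (by omega), hoff i' hi']
      refine ⟨fun hle => ?_, fun hle => ?_⟩
      · have := post (sqDist (s.seq i) (s.seq j))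
          (fun μ => ⟨fun hμ => ⟨hle.trans hμ, hμ⟩, fun hμ => hμ.2⟩)
        simp only [State.setN_nvar, State.setN_rarr, State.setA_nvar, hi]
        exact ⟨by simpa using this, by simp; omega⟩
      · have := post (s.rarr a i)
          (fun μ => ⟨fun hμ => ⟨hμ, (not_le.1 hle).le.trans hμ⟩, fun hμ => hμ.1⟩)
        simp only [State.setN_nvar, State.setN_rarr, State.setA_nvar, hi]
        exact ⟨by simpa using this, by simp; omega⟩
  · rintro s₁ t hf ⟨⟨-, hjh, -, hF, hoff⟩, htest, ht⟩
    have e31 := hf.nvar 31 (by simp [block, Program.natVars])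
    simp [hh] at e31
    simp [e31] at htest ht
    have : s₁.nvar 33 = h := by omega
    rw [this] at hF
    simp only [wp_block_nil]
    exact ⟨hF, hoff, by simp; omega⟩

/-- The optimal squared radius for the sequence in the arrays `13` and `14`; it goes to the real
variable `13`. -/
def dp : Program :=
  block [.storeReal 15 (.const 0) (.const 0),
    .setReal 28 (sqDistExpr (.get 13 (.const 0)) (.get 14 (.const 0))
      (.get 13 (.sub (.var 31) (.const 1))) (.get 14 (.sub (.var 31) (.const 1)))),
    forLoop 36 31 (.storeReal 15 (.add (.var 36) (.const 1)) (.var 28)),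
    forLoop 35 1 (block [relax 15 16 0, relax 16 15 1]),
    .setReal 13 (.get 15 (.var 31))]

/-- The array `15` holds the squared radii for which the initial segments of the sequence are
reached with `m` centers. -/
structure Radii (S : ℕ → ℝ × ℝ) (h : ℕ) (b : ℝ) (m : ℕ) (s : State) : Prop where
  zero : s.rarr 15 0 = 0
  mono : ∀ i j, i ≤ j → j ≤ h → s.rarr 15 i ≤ s.rarr 15 j
  iff : ∀ i ≤ h, ∀ μ, 0 ≤ μ → (s.rarr 15 i ≤ μ ↔ Reach S b μ m i)

/-- The first relaxation chooses the start `i` of the range left of a center `c`, the second chooses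
`c` for the last point `j`. The offset `1` appears because the initial segment ending with the point
`j` has length `j + 1`; entry `0` stays zero. -/
theorem relax_relax_spec {P : Set (ℝ × ℝ)} {h m : ℕ} {b : ℝ} {S : ℕ → ℝ × ℝ} {s : State}
    (hS : Enum P h S) (hh : s.nvar 31 = h) (hseq : s.seq = S) (hs : Radii S h b m s) :
    (block [relax 15 16 0, relax 16 15 1]).wp s fun s' t =>
      Radii S h b (m + 1) s' ∧ t ≤ 600 * h + 101 := by
  subst hseq
  subst hh
  simp only [wp_block_cons]
  have hG : ∀ i j, i ≤ j → j < s.nvar 31 → s.rarr 15 i ≤ s.rarr 15 j :=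
    fun i j hij hj => hs.mono i j hij hj.le
  refine (relax_spec (by simp) (by simp) (by simp) hS hG).imp ?_
  rintro s₁ t₁ hf₁ ⟨hF, -, ht₁⟩
  have e31 := hf₁.nvar 31 (by simp [relax_natVars])
  have a13 := hf₁.rarr 13 (by simp [relax_realArrs])
  have a14 := hf₁.rarr 14 (by simp [relax_realArrs])
  have a15 := hf₁.rarr 15 (by simp [relax_realArrs])
  have hseq : s₁.seq = s.seq := by funext i; simp [State.seq, a13, a14]
  have hFm := hS.mono_of_relax hG hF
  refine (relax_spec (P := P) (by simp) (by simp) (by simp) (by rwa [e31, hseq])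
    (by rwa [e31])).imp ?_
  rintro s₂ t₂ - ⟨hG', h0, ht₂⟩
  rw [e31, hseq] at hG'
  rw [e31] at ht₂
  have hG0 : s₂.rarr 15 0 = 0 := by rw [h0 0 (by simp), a15, hs.zero]
  have hGm := hS.mono_of_relax hFm hG'
  simp only [wp_block_nil]
  refine ⟨⟨hG0, fun i j hij hj => ?_, fun i hi μ hμ => ?_⟩, by omega⟩
  · cases i with
    | zero =>
      cases j with
      | zero => exact le_rfl
      | succ j =>
        obtain ⟨c, -, -, hd⟩ := (hG' j (by omega) _).1 le_rfl
        rw [hG0]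
        exact (sqDist_nonneg _ _).trans hd
    | succ i =>
      obtain ⟨j, rfl⟩ : ∃ j', j = j' + 1 := ⟨j - 1, by omega⟩
      exact hGm i j (by omega) (by omega)
  · cases i with
    | zero => simpa [hG0, Reach] using hμ
    | succ j =>
      rw [hG' j (by omega), Reach]
      refine exists_congr fun c => and_congr_right fun hc => and_congr_left fun _ => ?_
      rw [show s₁.rarr 16 c ≤ μ ↔ _ from hF c (by omega) μ]
      exact exists_congr fun i => and_congr_right fun hi => and_congr_left fun _ =>
        hs.iff i (by omega) μ hμ

theorem dp_spec {P : Set (ℝ × ℝ)} {s : State} (hS : Enum P (s.nvar 31) s.seq)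
    (hh : 0 < s.nvar 31) (hk : 0 < s.nvar 1) :
    dp.wp s fun s' t =>
      Cov P (s.nvar 1) (s'.rvar 13) ∧ (∀ μ, Cov P (s.nvar 1) μ → s'.rvar 13 ≤ μ) ∧
      t ≤ (s.nvar 1 + 1) * (700 * (s.nvar 31 + 1)) := by
  obtain ⟨h, hhe⟩ : ∃ h, s.nvar 31 = h := ⟨_, rfl⟩
  obtain ⟨k, hke⟩ : ∃ k, s.nvar 1 = k := ⟨_, rfl⟩
  obtain ⟨S, hSe⟩ : ∃ S, s.seq = S := ⟨_, rfl⟩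
  rw [hhe] at hS hh ⊢
  rw [hke] at hk ⊢
  rw [hSe] at hS
  have hSne : (Sky P).Nonempty := ⟨_, hS.mem 0 hh⟩
  obtain ⟨b, hb⟩ : ∃ b, sqDist (S 0) (S (h - 1)) = b := ⟨_, rfl⟩
  have hb0 : 0 ≤ b := hb ▸ sqDist_nonneg _ _
  have hsq := fun i => congrFun hSe i
  simp only [State.seq] at hsq
  simp only [dp, wp_block_cons, wp_storeReal, wp_setReal, NatExpr.eval, RealExpr.eval,
    sqDistExpr_eval, sqDistExpr_cost]
  simp only [State.setA_rarr, State.setA_nvar, hhe]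
  simp [hsq, hb]
  refine (wp_forLoop (fun j s' => s'.rarr 15 0 = 0 ∧ ∀ i < j, s'.rarr 15 (i + 1) = b) 10
    (by simp) (by simp [Program.natVars]) (by simp [Program.natVars]) (by simp) ?_).imp ?_
  · rintro j s₁ hf hj - - ⟨h0, hG⟩
    have e28 := hf.rvar 28 (by simp [forLoop, block, Program.realVars])
    simp at e28
    simp [hj, h0, e28]
    intro i hi hne
    exact hG i (by omega)
  rintro s₁ t₁ hf₁ ⟨⟨h0, hG⟩, ht₁⟩
  have e1 := hf₁.nvar 1 (by simp [forLoop, block, Program.natVars])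
  have e31 := hf₁.nvar 31 (by simp [forLoop, block, Program.natVars])
  have a13 := hf₁.rarr 13 (by simp [forLoop, block, Program.realArrs])
  have a14 := hf₁.rarr 14 (by simp [forLoop, block, Program.realArrs])
  simp [hhe, hke] at e1 e31 hG ht₁
  have hseq₁ : s₁.seq = S := by rw [← hSe]; funext i; simp [State.seq, a13, a14]
  refine (wp_forLoop (fun m s' => Radii S h b m s') (600 * h + 101) (by simp)
    (by simp [block, Program.natVars, relax_natVars])
    (by simp [block, Program.natVars, relax_natVars]) ⟨by simpa, ?_, ?_⟩ ?_).imp ?_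
  · rintro i j hij hj
    cases i with
    | zero =>
      cases j with
      | zero => exact le_rfl
      | succ j => simpa [h0, hG j hj] using hb0
    | succ i =>
      obtain ⟨j, rfl⟩ : ∃ j', j = j' + 1 := ⟨j - 1, by omega⟩
      simp [hG i (by omega), hG j (by omega)]
  · rintro i hi μ hμ
    cases i with
    | zero => simpa [h0, Reach] using hμ
    | succ i => simp [hG i (by omega), Reach]
  · rintro m s₂ hf₂ - - - hI
    have k31 := hf₂.nvar 31 (by simp [forLoop, block, Program.natVars, relax_natVars])
    have b13 := hf₂.rarr 13 (by simp [forLoop, block, Program.realArrs, relax_realArrs])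
    have b14 := hf₂.rarr 14 (by simp [forLoop, block, Program.realArrs, relax_realArrs])
    refine (relax_relax_spec hS (k31.trans e31) ?_ hI).imp ?_
    · rw [← hseq₁]; funext i; simp [State.seq, b13, b14]
    · rintro s₃ t₃ - ⟨hR, ht₃⟩
      exact ⟨⟨hR.zero, hR.mono, hR.iff⟩, ht₃⟩
  rintro s₂ t₂ hf₂ ⟨hR, ht₂⟩
  have k31 := hf₂.nvar 31 (by simp [forLoop, block, Program.natVars, relax_natVars])
  rw [e31] at k31
  rw [e1] at hR ht₂
  have hpos : 0 ≤ s₂.rarr 15 h := hR.zero ▸ hR.mono 0 h (Nat.zero_le _) le_rfl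
  simp [k31]
  refine ⟨?_, fun μ hμ => ?_, ?_⟩
  · exact (hS.reach_iff_cov hh hk hpos).1 (hb ▸ (hR.iff h le_rfl _ hpos).1 le_rfl)
  · have h0 := hμ.nonneg hSne
    exact (hR.iff h le_rfl _ h0).2 (hb ▸ (hS.reach_iff_cov hh hk h0).2 hμ)
  · have : k * (600 * h + 101 + 20) ≤ k * (700 * (h + 1)) := Nat.mul_le_mul_left _ (by omega)
    rw [add_one_mul k]
    omega

end RealRAM

namespace RealRAM

open RepSkyline

/-! ### The algorithm -/

/-- Put the smallest `l` with `(1 / 2) ^ (2 ^ l) ≤ ε` into variable `37`, and `2 ^ l` into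
variable `5`. -/
def squarings : Program :=
  block [.setReal 1 (.const (1 / 2)), .setNat 37 (.const 0), .setNat 5 (.const 1),
    .while (.not (.realLe (.var 1) (.var 0))) (block [
      .setReal 1 (.mul (.var 1) (.var 1)), .setNat 37 (.add (.var 37) (.const 1)),
      .setNat 5 (.add (.var 5) (.var 5))])]

theorem squarings_spec {s : State} (hε : 0 < s.rvar 0) :
    squarings.wp s fun s' t =>
      (1 / 2 : ℝ) ^ s'.nvar 5 ≤ s.rvar 0 ∧ s'.nvar 5 = 2 ^ s'.nvar 37 ∧
      (s'.nvar 37 = 0 ∨ s.rvar 0 < (1 / 2) ^ 2 ^ (s'.nvar 37 - 1)) ∧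
      t ≤ 50 * s'.nvar 37 + 50 := by
  obtain ⟨ε, he⟩ : ∃ ε, s.rvar 0 = ε := ⟨_, rfl⟩
  rw [he] at hε ⊢
  have hanti : ∀ a b : ℕ, a ≤ b → (1 / 2 : ℝ) ^ b ≤ (1 / 2) ^ a := fun a b hab =>
    pow_le_pow_of_le_one (by norm_num) (by norm_num) hab
  have hex : ∃ m, (1 / 2 : ℝ) ^ 2 ^ m ≤ ε := by
    obtain ⟨m, hm⟩ := exists_pow_lt_of_lt_one hε (by norm_num : (1 / 2 : ℝ) < 1)
    exact ⟨m, (hanti _ _ Nat.lt_two_pow_self.le).trans hm.le⟩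
  classical
  obtain ⟨m, hm, hmin⟩ : ∃ m, (1 / 2 : ℝ) ^ 2 ^ m ≤ ε ∧ ∀ l, (1 / 2 : ℝ) ^ 2 ^ l ≤ ε → m ≤ l :=
    ⟨Nat.find hex, Nat.find_spec hex, fun _ => Nat.find_min' hex⟩
  simp only [squarings, wp_block_cons, wp_setReal, wp_setNat, NatExpr.eval, RealExpr.eval]
  refine (wp_while (fun s' => s'.nvar 37 ≤ m ∧ s'.rvar 1 = (1 / 2) ^ s'.nvar 5 ∧
      s'.nvar 5 = 2 ^ s'.nvar 37 ∧ (s'.nvar 37 = 0 ∨ ε < (1 / 2) ^ 2 ^ (s'.nvar 37 - 1)) )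
    (fun s' => (m - s'.nvar 37) * 50) (by simp) ?_).imp ?_
  · rintro s₁ hf ⟨-, h1, h5, -⟩ ht
    have e0 := hf.rvar 0 (by simp [block, Program.realVars])
    simp [he] at e0
    simp only [Test.Holds, RealExpr.eval, e0, h1, not_le] at ht
    have hlt : s₁.nvar 37 < m := by
      by_contra! hge
      exact absurd (ht.trans_le (hanti _ _
        (h5 ▸ Nat.pow_le_pow_right (by simp) hge : 2 ^ m ≤ s₁.nvar 5))) (not_lt.2 hm)
    rw [h5] at ht
    have : m - s₁.nvar 37 = m - (s₁.nvar 37 + 1) + 1 := by omega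
    simp [h1, h5, pow_succ, mul_two, pow_add]
    exact ⟨⟨hlt, by simpa using ht⟩, by omega⟩
  · rintro s₁ t hf ⟨⟨hle, h1, h5, hl⟩, hb, ht⟩
    have e0 := hf.rvar 0 (by simp [block, Program.realVars])
    simp [he] at e0
    simp only [Test.Holds, RealExpr.eval, e0, h1, not_not] at hb
    have := hmin _ (h5 ▸ hb)
    simp at ht
    simp only [wp_block_nil]
    exact ⟨hb, h5, hl, by simp; omega⟩

/-- Put a number `l` with `k ≤ 2 ^ l` and `l ≤ k` into variable `38`. -/
def ceilLog : Program :=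
  block [.setNat 6 (.const 1), .setNat 38 (.const 0),
    .while (.natLe (.add (.var 6) (.const 1)) (.var 1)) (block [
      .setNat 6 (.add (.var 6) (.var 6)), .setNat 38 (.add (.var 38) (.const 1))])]

theorem ceilLog_spec (s : State) :
    ceilLog.wp s fun s' t =>
      s.nvar 1 ≤ 2 ^ s'.nvar 38 ∧ s'.nvar 38 ≤ s.nvar 1 ∧ t ≤ 30 * s.nvar 1 + 30 := by
  obtain ⟨k, hk⟩ : ∃ k, s.nvar 1 = k := ⟨_, rfl⟩
  rw [hk]
  simp only [ceilLog, wp_block_cons, wp_setNat, NatExpr.eval]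
  refine (wp_while (fun s' => s'.nvar 38 ≤ k ∧ s'.nvar 6 = 2 ^ s'.nvar 38)
    (fun s' => (k - s'.nvar 38) * 20) (by simp) ?_).imp ?_
  · rintro s₁ hf ⟨-, h6⟩ ht
    have e1 := hf.nvar 1 (by simp [block, Program.natVars])
    simp [hk] at e1
    simp [e1, h6] at ht
    have := Nat.lt_two_pow_self (n := s₁.nvar 38)
    simp [h6, pow_succ]
    omega
  · rintro s₁ t hf ⟨⟨hle, h6⟩, hb, ht⟩
    have e1 := hf.nvar 1 (by simp [block, Program.natVars])
    simp [hk] at e1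
    simp [e1, h6] at hb ht
    simp
    omega

/-- Find a squared radius that is optimal up to the factor `1 + ε`, for the real variable `13`. -/
def radius : Program :=
  .ite (.natLe (.var 0) (.var 2)) (block [extractSky, dp]) (block [insertFarthest, bisectRadius])

/-- With more points than the block length, `n / b + 1` blocks of length `b` have total length at
most `2 n`; the factor `K` for the bisection rounds is absorbed by the block length. -/
theorem radius_cost_blocks {n w K b : ℕ} (hb : b < n) (hK : (K + 2) * (w + 1) ≤ 6 * b) :
    (K + 2) * ((n / b + 1) * (w + 1)) ≤ 12 * n := by
  have h := Nat.div_mul_le_self n b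
  calc (K + 2) * ((n / b + 1) * (w + 1)) = (n / b + 1) * ((K + 2) * (w + 1)) := by ring
    _ ≤ (n / b + 1) * (6 * b) := Nat.mul_le_mul_left _ hK
    _ = 6 * (n / b * b + b) := by ring
    _ ≤ 12 * n := by omega

/-- With `n ≤ 2 ^ w` a cut is cheap enough to extract the entire skyline and solve exactly.
Otherwise the blocks are short against `n`, and `K + 2` greedy decisions are affordable by
`radius_cost_blocks`. -/
theorem radius_spec {P : Set (ℝ × ℝ)} {w : ℕ} {s : State} {ε : ℝ} (hs : Ready P w s)
    (hf : HasFirst P s) (hk : 1 ≤ s.nvar 1) (hkn : s.nvar 1 ≤ s.nvar 0) (hε0 : 0 ≤ ε)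
    (hε : (1 / 2 : ℝ) ^ s.nvar 5 ≤ ε) (hw : (s.nvar 5 + 2) * (w + 1) ≤ 6 * 2 ^ w) :
    radius.wp s fun s' t =>
      Cov P (s.nvar 1) (s'.rvar 13) ∧ (∀ μ, Cov P (s.nvar 1) μ → s'.rvar 13 ≤ (1 + ε) * μ) ∧
      t ≤ 100000 * (s.nvar 0 * (w + 1 + s.nvar 1)) := by
  have hS : (Sky P).Nonempty := ⟨_, hf.mem⟩
  obtain ⟨n, hn⟩ : ∃ n, s.nvar 0 = n := ⟨_, rfl⟩
  obtain ⟨k, hk'⟩ : ∃ k, s.nvar 1 = k := ⟨_, rfl⟩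
  obtain ⟨K, hK⟩ : ∃ K, s.nvar 5 = K := ⟨_, rfl⟩
  have h2 := hs.size
  rw [hn, hk'] at hkn
  rw [hk'] at hk
  rw [hK] at hw
  simp only [radius, wp_ite, Test.Holds, NatExpr.eval, wp_block_cons, wp_block_nil, hn, hk', h2]
  refine ⟨fun hle => ?_, fun hlt => ?_⟩
  · refine (extractSky_spec hs hf).imp ?_
    rintro s₁ t₁ hf₁ ⟨hE, h0, hh, ht₁⟩
    have e1 := hf₁.nvar 1 (by
      simp [extractSky, block, Program.natVars, cut_natVars, search_natVars])
    refine (dp_spec hE h0 (by omega)).imp ?_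
    rintro s₂ t₂ - ⟨hc, hmin, ht₂⟩
    rw [e1, hk'] at hc hmin ht₂
    rw [hn] at ht₁ hh
    refine ⟨hc, fun μ hμ => (hmin μ hμ).trans ?_, ?_⟩
    · nlinarith [hμ.nonneg hS]
    · have hU : n / 2 ^ w + 1 ≤ 2 := by
        have : n / 2 ^ w ≤ 1 := (Nat.div_le_div_right hle).trans_eq (Nat.div_self (by positivity))
        omega
      have h1 : (n + 1) * (1700 * ((n / 2 ^ w + 1) * (w + 1))) ≤
          (2 * n) * (1700 * (2 * (w + 1))) := by gcongr; omega
      have h3 : (k + 1) * (700 * (s₁.nvar 31 + 1)) ≤ (2 * k) * (700 * (2 * n)) := by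
        gcongr <;> omega
      simp
      nlinarith
  · refine (insertFarthest_spec hs hf (by omega)).imp ?_
    rintro s₁ t₁ hf₁ ⟨⟨G, hG⟩, ht₁⟩
    have e0 := hf₁.nvar 0 (by decide)
    have e1 := hf₁.nvar 1 (by decide)
    have e2 := hf₁.nvar 2 (by decide)
    have e5 := hf₁.nvar 5 (by decide)
    have e9 := hf₁.rvar 9 (by decide)
    have e10 := hf₁.rvar 10 (by decide)
    have a2 := hf₁.rarr 2 (by decide)
    have a3 := hf₁.rarr 3 (by decide)
    refine (bisectRadius_spec (hs.congr e0 e2 a2 a3) (hf.congr e9 e10) (e1.symm ▸ hG.cov)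
      (fun μ hμ => hG.le_four_mul hS (e1 ▸ hμ)) (e5.symm ▸ hε)).imp ?_
    rintro s₂ t₂ - ⟨hc, hmin, ht₂⟩
    rw [e1, hk'] at hc hmin
    refine ⟨hc, hmin, ?_⟩
    rw [e0, e1, e5, hn, hk', hK] at ht₂
    rw [hn, hk'] at ht₁
    have hU := radius_cost_blocks (not_le.1 hlt) hw
    obtain ⟨U, hUe⟩ : ∃ U, (n / 2 ^ w + 1) * (w + 1) = U := ⟨_, rfl⟩
    have hU1 : 1 ≤ U := hUe ▸ Nat.succ_le_of_lt (by positivity)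
    rw [hUe] at hU ht₁ ht₂
    have hU2 : U ≤ 6 * n := by nlinarith
    have h1 : k * (40 * k + 3600 * U) ≤ k * (40 * n + 3600 * (6 * n)) := by gcongr
    have h3 : (K + 2) * (k * (3300 * U) + 120) ≤ (3420 * k) * ((K + 2) * U) := by
      have : k * (3300 * U) + 120 ≤ 3420 * k * U := by nlinarith
      calc _ ≤ (K + 2) * (3420 * k * U) := Nat.mul_le_mul_left _ this
        _ = _ := by ring
    have h4 : (3420 * k) * ((K + 2) * U) ≤ (3420 * k) * (12 * n) := Nat.mul_le_mul_left _ hU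
    have h5 : n ≤ k * n := Nat.le_mul_of_pos_left _ hk
    simp
    nlinarith

end RealRAM

namespace RepSkyline

/-! ### Points of the plane as pairs -/

/-- The pair of the coordinates of a point. -/
def coords (p : Point) : ℝ × ℝ := (p 0, p 1)

theorem coords_injective : Function.Injective coords := fun p q h => by
  ext i
  fin_cases i
  · exact congrArg Prod.fst h
  · exact congrArg Prod.snd h

theorem dist_sq_eq (p q : Point) : dist p q ^ 2 = sqDist (coords p) (coords q) := by
  rw [EuclideanSpace.dist_eq, Real.sq_sqrt (by positivity)]
  simp [Fin.sum_univ_two, Real.dist_eq, sqDist, coords]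

theorem mem_skyline_iff {A : Set Point} {p : Point} :
    p ∈ skyline A ↔ coords p ∈ Sky (coords '' A) := by
  constructor
  · rintro ⟨hp, h⟩
    refine ⟨⟨p, hp, rfl⟩, ?_⟩
    rintro _ ⟨q, hq, rfl⟩ hle
    by_cases hqp : q = p
    · rw [hqp]
    · obtain h | h := h q hq hqp
      · exact absurd hle.1 (not_le.2 h)
      · exact absurd hle.2 (not_le.2 h)
  · rintro ⟨⟨q, hq, hqp⟩, h⟩
    obtain rfl := coords_injective hqp
    refine ⟨hq, fun r hr hne => ?_⟩
    by_contra! hcon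
    exact hne (coords_injective (le_antisymm (h ⟨r, hr, rfl⟩ hcon) hcon))

theorem exists_mem_skyline {A : Set Point} {s : ℝ × ℝ} (hs : s ∈ Sky (coords '' A)) :
    ∃ p ∈ skyline A, coords p = s := by
  obtain ⟨p, -, rfl⟩ := hs.1
  exact ⟨p, mem_skyline_iff.2 hs, rfl⟩

theorem psi_le_of_cover {A Q : Set Point} {μ : ℝ}
    (h : ∀ s ∈ Sky (coords '' A), ∃ q ∈ Q, sqDist (coords q) s ≤ μ) :
    psi Q A ≤ ENNReal.ofReal √μ := by
  refine iSup₂_le fun p hp => ?_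
  obtain ⟨q, hq, hqp⟩ := h _ (mem_skyline_iff.1 hp)
  refine (iInf₂_le q hq).trans (ENNReal.ofReal_le_ofReal (Real.le_sqrt_of_sq_le ?_))
  rwa [dist_comm, dist_sq_eq]

/-- The infimum over the finite set `Q` is attained. `Q` is nonempty because an empty set would have
cost `∞`. -/
theorem cov_of_psi {A Q : Set Point} {k : ℕ} (hA : (skyline A).Nonempty) (hQ : Feasible A k Q)
    (h : psi Q A ≠ ⊤) : Cov (coords '' A) k ((psi Q A).toReal ^ 2) := by
  classical
  have hfin : Q.Finite := Set.finite_of_encard_le_coe hQ.2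
  have hle : ∀ p ∈ skyline A, ⨅ q ∈ Q, ENNReal.ofReal (dist p q) ≤ psi Q A := fun p hp =>
    le_iSup₂ (f := fun p (_ : p ∈ skyline A) => ⨅ q ∈ Q, ENNReal.ofReal (dist p q)) p hp
  have hne : Q.Nonempty := by
    obtain ⟨p, hp⟩ := hA
    by_contra! hcon
    have := hle p hp
    simp [hcon] at this
    exact h (hcon ▸ this)
  refine ⟨hfin.toFinset.image coords, ?_, ?_, fun s hs => ?_⟩
  · intro s hs
    obtain ⟨q, hq, rfl⟩ := Finset.mem_image.1 (Finset.mem_coe.1 hs)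
    exact mem_skyline_iff.1 (hQ.1 (by simpa using hq))
  · refine Finset.card_image_le.trans ?_
    have := hQ.2
    rw [hfin.encard_eq_coe_toFinset_card] at this
    exact_mod_cast this
  · obtain ⟨p, hp, rfl⟩ := exists_mem_skyline hs
    obtain ⟨q, hq, hmin⟩ := Set.exists_min_image Q (fun q => dist p q) hfin hne
    refine ⟨coords q, Finset.mem_image_of_mem _ (by simpa using hq), ?_⟩
    rw [← dist_sq_eq, dist_comm]
    refine pow_le_pow_left₀ dist_nonneg ?_ 2
    rw [← ENNReal.ofReal_le_iff_le_toReal h]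
    exact (le_iInf₂ fun q' hq' => ENNReal.ofReal_le_ofReal (hmin q' hq')).trans (hle p hp)

theorem sqrt_le_mul_opt {A : Set Point} {k : ℕ} {ε μ : ℝ} (hA : (skyline A).Nonempty)
    (hε : 0 < ε) (h : ∀ ν, Cov (coords '' A) k ν → μ ≤ (1 + ε) * ν) :
    ENNReal.ofReal √μ ≤ ENNReal.ofReal (1 + ε) * opt A k := by
  have h0 : ENNReal.ofReal (1 + ε) ≠ 0 := by simp; linarith
  rw [opt, ENNReal.mul_iInf_of_ne h0 ENNReal.ofReal_ne_top]
  refine le_iInf fun Q => ?_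
  rw [ENNReal.mul_iInf_of_ne h0 ENNReal.ofReal_ne_top]
  refine le_iInf fun hQ => ?_
  by_cases htop : psi Q A = ⊤
  · simp [htop, ENNReal.mul_top h0]
  · rw [← ENNReal.ofReal_toReal htop, ← ENNReal.ofReal_mul (by linarith)]
    refine ENNReal.ofReal_le_ofReal (Real.sqrt_le_iff.2 ⟨by positivity, ?_⟩)
    refine (h _ (cov_of_psi hA hQ htop)).trans ?_
    rw [mul_pow]
    -- Squared radii lose only the factor `1 + ε ≤ (1 + ε) ^ 2`.
    exact mul_le_mul_of_nonneg_right (by nlinarith) (by positivity)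

end RepSkyline

/-! ### Assembling the algorithm, its running time and the theorem -/

namespace RealRAM

open RepSkyline

/-- The preparations: cap the number of centers, and sort the points in blocks. -/
def prepare : Program :=
  block [.setNat 1 (.sub (.var 1) (.sub (.var 1) (.var 0))), copyPoints 0 1 2 3, squarings, ceilLog,
    .setNat 3 (.add (.add (.var 37) (.var 37)) (.add (.var 38) (.var 38))), buildStairs, findFirst]

/-- The whole algorithm. -/
def representatives : Program :=
  block [prepare, radius, greedy, .setNat 0 (.var 23)]

/-- With `a = 2 ^ (l + m)` the block length is `a ^ 2`. One factor `a` pays for the `2 ^ l`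
bisection rounds, the other for the logarithmic cost of a binary search. -/
theorem blockSize_bound (l m : ℕ) :
    (2 ^ l + 2) * (l + l + (m + m) + 1) ≤ 6 * 2 ^ (l + l + (m + m)) := by
  have h1 : 2 ^ l ≤ 2 ^ (l + m) := Nat.pow_le_pow_right (by simp) (by simp)
  have h2 := Nat.lt_two_pow_self (n := l + m)
  have h3 : 2 ^ (l + l + (m + m)) = 2 ^ (l + m) * 2 ^ (l + m) := by
    rw [← pow_add]
    congr 1
    ring
  rw [h3]
  generalize 2 ^ (l + m) = a at *
  calc _ ≤ (3 * a) * (2 * a) := Nat.mul_le_mul (by omega) (by omega)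
    _ = _ := by ring


end RealRAM

namespace RealRAM

open RepSkyline

theorem prepare_spec {P : Set (ℝ × ℝ)} {n k : ℕ} {s : State} (h0 : s.nvar 0 = n)
    (h1 : s.nvar 1 = k) (hε : 0 < s.rvar 0) (hP : Carries P n s.center) (hS : (Sky P).Nonempty)
    (hn : 1 ≤ n) :
    prepare.wp s fun s' t => ∃ l m, Ready P (l + l + (m + m)) s' ∧ HasFirst P s' ∧
      s'.nvar 0 = n ∧ s'.nvar 1 = min k n ∧ m ≤ min k n ∧ s'.nvar 5 = 2 ^ l ∧
      (1 / 2 : ℝ) ^ 2 ^ l ≤ s.rvar 0 ∧ (l = 0 ∨ s.rvar 0 < (1 / 2) ^ 2 ^ (l - 1)) ∧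
      t ≤ 3000 * (n * (l + l + (m + m) + 1 + min k n)) := by
  simp only [prepare, wp_block_cons, wp_setNat, NatExpr.eval, h0, h1]
  refine (copyPoints_spec (by simp) (by simp) (by simp) (by simp) (by simp)).imp ?_
  rintro s₁ t₁ hf₁ ⟨hcopy, ht₁⟩
  have a0 := hf₁.nvar 0 (by decide)
  have a1 := hf₁.nvar 1 (by decide)
  have ar := hf₁.rvar 0 (by decide)
  simp [h0] at a0 a1 ar hcopy ht₁
  refine (squarings_spec (by rwa [ar])).imp ?_
  rintro s₂ t₂ hf₂ ⟨hle, h5, hl, ht₂⟩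
  rw [ar] at hle hl
  refine (ceilLog_spec s₂).imp ?_
  rintro s₃ t₃ hf₃ ⟨-, hm, ht₃⟩
  have hf₁₃ : ∀ x, x ∉ squarings.natVars → x ∉ ceilLog.natVars → s₃.nvar x = s₁.nvar x :=
    fun x hx hx' => (hf₃.nvar x hx').trans (hf₂.nvar x hx)
  have b0 := (hf₁₃ 0 (by decide) (by decide)).trans a0
  have b1 := (hf₁₃ 1 (by decide) (by decide)).trans a1
  have b1' := (hf₂.nvar 1 (by decide)).trans a1
  have b5 := hf₃.nvar 5 (by decide)
  have b37 := hf₃.nvar 37 (by decide)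
  have ra2 : s₃.rarr 2 = s₁.rarr 2 := (hf₃.rarr 2 (by decide)).trans (hf₂.rarr 2 (by decide))
  have ra3 : s₃.rarr 3 = s₁.rarr 3 := (hf₃.rarr 3 (by decide)).trans (hf₂.rarr 3 (by decide))
  obtain ⟨l, hl'⟩ : ∃ l, s₂.nvar 37 = l := ⟨_, rfl⟩
  obtain ⟨m, hm'⟩ : ∃ m, s₃.nvar 38 = m := ⟨_, rfl⟩
  -- The program caps the number of centers at `n` by truncated subtraction.
  have hmin : k - (k - n) = min k n := by omega
  rw [hmin] at b1 b1'
  rw [b1'] at ht₃ hm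
  rw [hm'] at hm
  rw [hl'] at h5 hl ht₂ b37
  rw [h5] at hle b5
  rw [b37, hm']
  have hpt : ∀ i < n, s₃.pt i = s.center i := fun i hi => by
    simp [State.pt, State.center, ra2, ra3, hcopy i hi]
  have hC : Carries P n s₃.pt :=
    ⟨fun i hi => hpt i hi ▸ hP.le i hi, fun p hp => by
      obtain ⟨i, hi, h⟩ := hP.mem p hp
      exact ⟨i, hi, (hpt i hi).trans h⟩⟩
  refine (buildStairs_spec (P := P) (w := l + l + (m + m)) (by simp) ?_).imp ?_
  · simp only [State.setN_nvar, b0]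
    exact hC
  rintro s₄ t₄ hf₄ ⟨hR, ht₄⟩
  have c0 := hf₄.nvar 0 (by decide)
  have c1 := hf₄.nvar 1 (by decide)
  have c5 := hf₄.nvar 5 (by decide)
  simp [b0, b1, b5] at c0 c1 c5 ht₄
  refine (findFirst_spec hR hS).imp ?_
  rintro s₅ t₅ hf₅ ⟨hF, ht₅⟩
  have d0 := hf₅.nvar 0 (by decide)
  have d2 := hf₅.nvar 2 (by decide)
  simp only [wp_block_nil]
  refine ⟨l, m, hR.congr d0 d2 (hf₅.rarr 2 (by decide)) (hf₅.rarr 3 (by decide)), hF,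
    d0.trans c0, ((hf₅.nvar 1 (by decide)).trans c1), hm, (hf₅.nvar 5 (by decide)).trans c5, hle,
    hl, ?_⟩
  rw [c0] at ht₅
  generalize min k n = k' at *
  generalize hw : l + l + (m + m) = w at *
  have hU : (n / 2 ^ w + 1) * (w + 1) ≤ (2 * n) * (w + 1) := by
    have := Nat.div_le_self n (2 ^ w)
    gcongr
    omega
  have hn1 : w ≤ n * w := Nat.le_mul_of_pos_left _ hn
  have hn2 : k' ≤ n * k' := Nat.le_mul_of_pos_left _ hn
  simp
  nlinarith

/-- The final greedy run happens in both cases: for `b < n` it costs no more than one bisection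
round, and for `n ≤ b` each of its `O(k)` cuts takes `O(w + 1)` steps, with `k ≤ n`. -/
theorem greedy_cost_bound {n k w K b : ℕ} (hkn : k ≤ n) (hK : (K + 2) * (w + 1) ≤ 6 * b) :
    k * ((n / b + 1) * (w + 1)) ≤ 12 * (n * (w + 1 + k)) := by
  obtain hlt | hge := lt_or_ge b n
  · have h1 : (n / b + 1) * (w + 1) ≤ 12 * n :=
      (Nat.le_mul_of_pos_left _ (by omega)).trans (radius_cost_blocks hlt hK)
    calc _ ≤ k * (12 * n) := Nat.mul_le_mul_left _ h1
      _ = 12 * (n * k) := by ring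
      _ ≤ _ := by gcongr; omega
  · have h1 : n / b ≤ 1 := Nat.div_le_of_le_mul (by omega)
    calc _ ≤ n * ((1 + 1) * (w + 1)) := by gcongr
      _ = 2 * (n * (w + 1)) := by ring
      _ ≤ _ := Nat.mul_le_mul (by simp) (Nat.mul_le_mul_left _ (by simp))

set_option maxRecDepth 10000 in
/-- The time bound is in terms of the number `l` of squarings. -/
theorem representatives_spec {P : Set (ℝ × ℝ)} {n k : ℕ} {s : State} (h0 : s.nvar 0 = n)
    (h1 : s.nvar 1 = k) (hε : 0 < s.rvar 0) (hP : Carries P n s.center) (hfin : (Sky P).Finite)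
    (hcard : (Sky P).ncard ≤ n) (hS : (Sky P).Nonempty) (hn : 1 ≤ n) (hk : 1 ≤ k) :
    representatives.wp s fun s' t =>
      s'.nvar 0 ≤ k ∧ (∀ i < s'.nvar 0, s'.center i ∈ Sky P) ∧
      (∃ μ, (∀ p ∈ Sky P, ∃ i < s'.nvar 0, sqDist (s'.center i) p ≤ μ) ∧
        ∀ ν, Cov P k ν → μ ≤ (1 + s.rvar 0) * ν) ∧
      ∃ l, (l = 0 ∨ s.rvar 0 < (1 / 2) ^ 2 ^ (l - 1)) ∧ t ≤ 1000000 * (n * (l + k)) := by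
  simp only [representatives, wp_block_cons, wp_setNat, NatExpr.eval, wp_block_nil]
  refine (prepare_spec h0 h1 hε hP hS hn).imp ?_
  rintro s₁ t₁ - ⟨l, m, hR, hF, a0, a1, hm, a5, hle, hl, ht₁⟩
  have hw := blockSize_bound l m
  have hk' : 1 ≤ min k n := by omega
  refine (radius_spec hR hF (by omega) (by omega) hε.le (by rwa [a5]) (by rwa [a5])).imp ?_
  rintro s₂ t₂ hf₂ ⟨hcov, hmin, ht₂⟩
  have b0 := hf₂.nvar 0 (by decide)
  have b1 := hf₂.nvar 1 (by decide)
  have b2 := hf₂.nvar 2 (by decide)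
  rw [a0] at b0
  rw [a1] at b1 hcov hmin
  rw [a0, a1] at ht₂
  refine (greedy_spec (hR.congr (b0.trans a0.symm) b2 (hf₂.rarr 2 (by decide))
    (hf₂.rarr 3 (by decide))) (hF.congr (hf₂.rvar 9 (by decide)) (hf₂.rvar 10 (by decide)))
    (hcov.nonneg hS)).imp ?_
  rintro s₃ t₃ - ⟨hc, hcen, hall, hno, ht₃⟩
  rw [b1] at hc hno
  rw [b0, b1] at ht₃
  have hz : s₃.nvar 24 = 0 := by
    by_contra hne
    exact hno hne hcov
  simp only [State.setN_nvar, if_true, State.setN_center]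
  refine ⟨by omega, hcen, ⟨_, hall hz, fun ν hν => hmin ν (hν.min hS hfin hcard)⟩, l, hl, ?_⟩
  have hg : min k n * ((n / 2 ^ (l + l + (m + m)) + 1) * (l + l + (m + m) + 1)) ≤
      12 * (n * (l + l + (m + m) + 1 + min k n)) :=
    greedy_cost_bound (min_le_right k n) hw
  have hsum : n * (l + l + (m + m) + 1 + min k n) ≤ 4 * (n * (l + k)) := by
    calc _ ≤ n * (4 * (l + k)) := Nat.mul_le_mul_left _ (by omega)
      _ = _ := by ring
  have hpos : 1 ≤ n * (l + k) := Nat.mul_pos hn (by omega)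
  simp
  nlinarith

/-- One squaring less did not suffice, so `log (1 / ε)` exceeds `2 ^ (l - 1) * log 2`, which is at
least `2 ^ (l - 2)` by `log 2 ≥ 1 / 2`. Taking logarithms and using `log 2 ≥ 1 / 2` once more gives
the factor `2`. -/
theorem squarings_bound {l : ℕ} {ε : ℝ} (hε : 0 < ε) (h : l = 0 ∨ ε < (1 / 2) ^ 2 ^ (l - 1)) :
    (l : ℝ) ≤ 2 + 2 * max 0 (Real.log (Real.log (1 / ε))) := by
  have hmax := le_max_left 0 (Real.log (Real.log (1 / ε)))
  have hmax' := le_max_right 0 (Real.log (Real.log (1 / ε)))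
  obtain hl | hl := le_or_gt l 2
  · have : (l : ℝ) ≤ 2 := by exact_mod_cast hl
    linarith
  obtain ⟨m, rfl⟩ : ∃ m, l = m + 2 := ⟨l - 2, by omega⟩
  replace h := h.resolve_left (by omega)
  simp only [Nat.add_succ_sub_one] at h
  have hlog : (1 / 2 : ℝ) ≤ Real.log 2 := by linarith [Real.log_two_gt_d9]
  have h1 : (2 : ℝ) ^ m ≤ Real.log (1 / ε) := by
    have := Real.log_le_log hε h.le
    rw [Real.log_pow, one_div, Real.log_inv] at this
    rw [one_div, Real.log_inv]
    push_cast at this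
    rw [pow_succ] at this
    nlinarith [pow_pos (two_pos : (0 : ℝ) < 2) m]
  have h2 := Real.log_le_log (by positivity) h1
  rw [Real.log_pow] at h2
  push_cast
  have : (0 : ℝ) ≤ m := Nat.cast_nonneg m
  nlinarith

end RealRAM

theorem mainTheorem5 :
    ∃ (A : RealRAM.Program) (C : ℝ),
      ∀ (n k : ℕ) (p : Fin n → Point) (ε : ℝ),
        1 ≤ n → 1 ≤ k → Function.Injective p → 0 < ε → ε < 1 →
        ∃ (s : RealRAM.State) (t m : ℕ) (q : Fin m → Point),
          RealRAM.Run A (RealRAM.input p k ε) s t ∧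
          (t : ℝ) ≤ C * ((k : ℝ) * n + n * max 0 (Real.log (Real.log (1 / ε)))) ∧
          s.Stores q ∧ m ≤ k ∧
          RepSkyline.Feasible (Set.range p) k (Set.range q) ∧
          RepSkyline.psi (Set.range q) (Set.range p) ≤
            ENNReal.ofReal (1 + ε) * RepSkyline.opt (Set.range p) k := by
  open RealRAM RepSkyline in
  refine ⟨representatives, 3000000, fun n k p ε hn hk hp hε _ => ?_⟩
  have hfinA : (Set.range p).Finite := Set.finite_range p
  have hfinP := hfinA.image coords
  have hfin : (Sky (coords '' Set.range p)).Finite := hfinP.subset (Sky.subset _)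
  have hcen : ∀ i : Fin n, (input p k ε).center i = coords (p i) := fun i => by
    simp [input, State.center, coords]
  have hcard : (Sky (coords '' Set.range p)).ncard ≤ n := by
    refine (Set.ncard_le_ncard (Sky.subset _) hfinP).trans ?_
    refine (Set.ncard_image_le hfinA).trans ?_
    rw [← Set.image_univ]
    refine (Set.ncard_image_le Set.finite_univ).trans ?_
    simp [Set.ncard_univ]
  have hmem : ∀ i, coords (p i) ∈ coords '' Set.range p := fun i => ⟨p i, ⟨i, rfl⟩, rfl⟩
  obtain ⟨s₀, hs₀, -⟩ := Sky.exists_ge hfinP (hmem ⟨0, hn⟩)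
  obtain ⟨p₀, hp₀, -⟩ := exists_mem_skyline hs₀
  have hC : Carries (coords '' Set.range p) n (input p k ε).center := by
    refine ⟨fun i hi => ?_, fun s hs => ?_⟩
    · have := hcen ⟨i, hi⟩
      simp only at this
      rw [this]
      exact Sky.exists_ge hfinP (hmem _)
    · obtain ⟨_, ⟨i, rfl⟩, rfl⟩ := hs.1
      exact ⟨i, i.2, hcen i⟩
  obtain ⟨s, t, hrun, hsk, hmemc, ⟨μ, hcov, hopt⟩, l, hl, ht⟩ :=
    representatives_spec (s := input p k ε) (n := n) (k := k) (by simp [input]) (by simp [input])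
      (by simpa [input] using hε) hC hfin hcard ⟨s₀, hs₀⟩ hn hk
  have hre : (input p k ε).rvar 0 = ε := by simp [input]
  rw [hre] at hl hopt
  obtain ⟨q, hq⟩ : ∃ q : Fin (s.nvar 0) → Point, ∀ i, q i = !₂[s.rarr 0 i, s.rarr 1 i] :=
    ⟨_, fun _ => rfl⟩
  have hqc : ∀ i, coords (q i) = s.center i := fun i => by simp [hq, coords, State.center]
  refine ⟨s, t, s.nvar 0, q, hrun, ?_, ⟨rfl, fun i => by simp [hq]⟩, hsk, ⟨?_, ?_⟩, ?_⟩
  · have hb := squarings_bound hε hl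
    have ht' : (t : ℝ) ≤ 1000000 * (n * (l + k)) := by exact_mod_cast ht
    have hk1 : (1 : ℝ) ≤ k := by exact_mod_cast hk
    have hn0 : (0 : ℝ) ≤ n := by positivity
    have hL := le_max_left 0 (Real.log (Real.log (1 / ε)))
    generalize max 0 (Real.log (Real.log (1 / ε))) = L at *
    calc (t : ℝ) ≤ 1000000 * (n * (l + k)) := ht'
      -- The additive constant `2` in the bound on `l` is absorbed by `2 * k`, as `k ≥ 1`.
      _ ≤ 1000000 * (n * ((2 * k + 2 * L) + k)) := by gcongr; linarith
      _ ≤ 3000000 * (k * n + n * L) := by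
        linarith [mul_nonneg hn0 hL]
  · rintro _ ⟨i, rfl⟩
    rw [mem_skyline_iff, hqc]
    exact hmemc i i.2
  · rw [← Set.image_univ]
    refine (Set.encard_image_le _ _).trans ?_
    simpa using hsk
  · refine le_trans (psi_le_of_cover (μ := μ) fun v hv => ?_) (sqrt_le_mul_opt ⟨p₀, hp₀⟩ hε hopt)
    obtain ⟨i, hi, h⟩ := hcov v hv
    exact ⟨_, ⟨⟨i, hi⟩, rfl⟩, by rwa [hqc]⟩
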